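/- **Setting.** Let $n\ge 2$, $0\le p\le n-2$, $q=n-p-2$ and $\kappa\in\mathbb R^\times$. Let $\mathsf{ST}$ be the site of oriented Riemannian $n$-manifolds, or the site of oriented Lorentzian $n$-manifolds, with the orientation-preserving isometric open embeddings as morphisms and the jointly surjective families as covers. We consider sheaves on $\mathsf{ST}$ valued in the derived category $\mathcal D_{\mathbb Z}$ of abelian groups. They are given locally (on coordinate patches, that is, on $\mathbb R^n$ with a metric of the given signature) by cochain complexes, up to quasi-isomorphism; $\Omega^k$ denotes $k$-forms, $\star$ the Hodge star, and $\mathbb Z,\mathbb R$ are included in $\Omega^0$ as constant functions. * $\mathrm{Mxw}_{p,n}\langle\kappa\rangle$ is $$\mathbb Z\to\Omega^0\xrightarrow{d}\cdots\xrightarrow{d}\Omega^p\xrightarrow{\kappa\, d\star d}\Omega^{n-p}\xrightarrow{d}\cdots\xrightarrow{d}\Omega^n,$$ with $\Omega^p$ in degree $0$. * $\widetilde{\mathrm{Mxw}}_{p,n}\langle\kappa\rangle$ has the two rows $\mathbb Z\to\Omega^0\xrightarrow{d}\cdots\xrightarrow{d}\Omega^p$ and $\mathbb R\to\Omega^0\xrightarrow{d}\cdots\xrightarrow{d}\Omega^{q}$,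 with $\Omega^p$ and $\Omega^{q}$ in degree $0$, together with $\Omega^{n-p-1}$ in degree $1$, which receives $\star d$ from $\Omega^p$ and $-\kappa\, d$ from $\Omega^{q}$. * $\mathrm{MxwBF}_{p,n}\langle\kappa\rangle$ has the four rows $$\begin{aligned}&(1)\quad \mathbb Z\to\Omega^0\xrightarrow{d}\cdots\xrightarrow{d}\Omega^n,&&\Omega^{p+1}\text{ in degree }0,\\ &(2)\quad \mathbb Z\to\Omega^0\xrightarrow{d}\cdots\xrightarrow{d}\Omega^p,&&\Omega^{p}\text{ in degree }0,\\ &(3)\quad \mathbb R\to\Omega^0\xrightarrow{d}\cdots\xrightarrow{d}\Omega^{q},&&\Omega^{q}\text{ in degree }0,\\ &(4)\quad \mathbb Z\to\Omega^0\xrightarrow{d}\cdots\xrightarrow{d}\Omega^n,&&\Omega^{q}\text{ in degree }0,\end{aligned}$$ together with $\Omega^{n-p-1}$ in degree $1$. Besides the maps within the rows, the differential consists of $-1$ from $\mathbb Z$ in row 1 to $\mathbb Z$ in row 2; of $(-1)^k$ from $\Omega^k$ in row 1 to $\Omega^k$ in row 2 for $0\le k\le p$; of $\star d$ from $\Omega^p$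 in row 2, $-\kappa\,d$ from $\Omega^{q}$ in row 3 and $(-1)^{p+1}\star$ from $\Omega^{p+1}$ in row 1 to the summand $\Omega^{n-p-1}$; and, on $\mathbb R\oplus\mathbb Z$ at the left of rows 3 and 4, it is $(x,m)\mapsto(x-m,\,x+m)$ into the $\Omega^0$ of row 3 plus the $\Omega^0$ of row 4. Each of these also makes sense in smooth families over a parameter space $X=\mathbb R^m$: $\Omega^k$ becomes the smooth families over $X$ of $k$-forms on spacetime, with $d$ and $\star$ taken along spacetime, $\mathbb R$ becomes the functions that are constant along spacetime (the smooth functions on $X$), and $\mathbb Z$ stays constant. The families are extended from Cartesian spaces to derived manifolds through their derived $C^\infty$-rings of functions. The *moduli stack* presented by such a theory is the sheaf on $\mathsf{ST}\times\mathrm{DerMfld}$, valued in simplicial abelian groups up to weak equivalence, that is obtained by truncating to degrees $\le 0$, applying the Dold–Kan correspondence and passing to the associated sheaf. Here $\mathrm{DerMfld}$ is the site of derived manifolds (the opposite of the smallest class of derived $C^\infty$-rings that contains $C^\infty(\mathbb R^m)$ for all $m$ and is closed under homotopy pushouts and retracts), covered by jointly surjective families of open embeddings given by $C^\infty$-localization.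 Let $\mathbb{M}\mathrm{xwBF}_{p,n}\langle\kappa\rangle$, $\mathbb{M}\mathrm{xw}_{p,n}\langle\kappa\rangle$ and $\widetilde{\mathbb{M}\mathrm{xw}}_{p,n}\langle\kappa\rangle$ be the moduli stacks presented by $\mathrm{MxwBF}_{p,n}\langle\kappa\rangle$, $\mathrm{Mxw}_{p,n}\langle\kappa\rangle$ and $\widetilde{\mathrm{Mxw}}_{p,n}\langle\kappa\rangle$. **Proposition.** 1. $\mathrm{MxwBF}_{p,n}\langle\kappa\rangle$ is quasi-isomorphic to $\widetilde{\mathrm{Mxw}}_{n-p-2,n}\langle1/\kappa\rangle$: they are isomorphic as sheaves on $\mathsf{ST}$ valued in $\mathcal D_{\mathbb Z}$. 2. Hence they present isomorphic moduli stacks: there are isomorphisms of moduli stacks $$\mathbb{M}\mathrm{xwBF}_{p,n}\langle\kappa\rangle\;\simeq\;\widetilde{\mathbb{M}\mathrm{xw}}_{n-p-2,n}\langle1/\kappa\rangle\qquad\text{and}\qquad \mathbb{M}\mathrm{xwBF}_{p,n}\langle\kappa\rangle\;\simeq\;\mathbb{M}\mathrm{xw}_{n-p-2,n}\langle1/\kappa\rangle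 .$$ -/

import Mathlib

open CategoryTheory Opposite Limits Topology
open scoped ContDiff Manifold Matrix

noncomputable section
namespace HigherMaxwell

/-! ### Linear algebra and forms on Cartesian spaces -/

/-- Cartesian space `ℝⁿ`. -/
abbrev Coord (n : ℕ) : Type := Fin n → ℝ

/-- Alternating `k`-covectors on `ℝⁿ`. -/
abbrev Cov (n k : ℕ) : Type := Coord n [⋀^Fin k]→L[ℝ] ℝ

/-- The standard basis vector `e_i` of `ℝⁿ`. -/
def stdVec {n : ℕ} (i : Fin n) : Coord n := Pi.single i 1

/-- The determinant as a multilinear function of `k` and then `l` vectors of `ℝⁿ`, `k + l = n`. -/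
def detSplit {n k l : ℕ} (h : k + l = n) :
    MultilinearMap ℝ (fun _ : Fin k => Coord n)
      (MultilinearMap ℝ (fun _ : Fin l => Coord n) ℝ) :=
  ((Matrix.detRowAlternating (n := Fin n) (R := ℝ)).toMultilinearMap.domDomCongr
    ((finCongr h.symm).trans finSumFinEquiv.symm)).currySum

theorem detSplit_apply {n k l : ℕ} (h : k + l = n) (u : Fin k → Coord n) (w : Fin l → Coord n) :
    detSplit h u w = Matrix.det (Matrix.of fun a : Fin n =>
      (Fin.append u w : Fin (k + l) → Coord n) (Fin.cast h.symm a)) := by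
  subst h
  change Matrix.det _ = _
  congr 1
  ext a b
  simp only [Matrix.of_apply, Fin.cast_refl, id]
  refine Fin.addCases (fun i => ?_) (fun i => ?_) a
  · simp
  · simp

/-- The covector `(w₁, …, w_l) ↦ det (e_{i 1}, …, e_{i k}, w₁, …, w_l)` where `k + l = n`. -/
def volumeContraction {n k l : ℕ} (h : k + l = n) (i : Fin k → Fin n) : Cov n l where
  toMultilinearMap := detSplit h fun b => stdVec (i b)
  map_eq_zero_of_eq' := by
    intro v a b hab hne
    change detSplit h _ _ = 0
    rw [detSplit_apply]
    subst h
    refine Matrix.det_zero_of_row_eq (i := Fin.natAdd k a) (j := Fin.natAdd k b)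
      (by simpa [Fin.ext_iff] using hne) ?_
    ext c
    simp [hab]
  cont := by
    change Continuous fun w => detSplit h (fun b => stdVec (i b)) w
    simp only [detSplit_apply]
    subst h
    refine Continuous.matrix_det (continuous_matrix fun a b => ?_)
    simp only [Matrix.of_apply, Fin.cast_refl, id]
    refine Fin.addCases (fun c => ?_) (fun c => ?_) a
    · simp only [Fin.append_left]; exact continuous_const
    · simp only [Fin.append_right]; fun_prop

/-- The Hodge star on `k`-covectors for the inner product with Gram matrix `G`, in index notation
`(⋆α)_{b₁…b_l} = (√|det G| / k!) α^{i₁…i_k} ε_{i₁…i_k b₁…b_l}`; it is characterised by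
`β ∧ ⋆α = ⟨β, α⟩ vol`. -/
def hodgeStar {n k l : ℕ} (h : k + l = n) (G : Matrix (Fin n) (Fin n) ℝ) :
    Cov n k →ₗ[ℝ] Cov n l where
  toFun α := (√|G.det| / (k.factorial : ℝ)) • ∑ i : Fin k → Fin n,
    (∑ j : Fin k → Fin n, (∏ a, G⁻¹ (i a) (j a)) * α fun a => stdVec (j a)) • volumeContraction h i
  map_add' α β := by
    simp [mul_add, add_smul, Finset.sum_add_distrib]
  map_smul' c α := by
    have : ∀ i : Fin k → Fin n,
        (∑ j : Fin k → Fin n, (∏ a, G⁻¹ (i a) (j a)) * (c • α) fun a => stdVec (j a)) =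
        c * ∑ j : Fin k → Fin n, (∏ a, G⁻¹ (i a) (j a)) * α fun a => stdVec (j a) := by
      intro i
      rw [Finset.mul_sum]
      exact Finset.sum_congr rfl fun j _ => by
        simp only [ContinuousAlternatingMap.smul_apply, smul_eq_mul]; ring
    simp only [this, RingHom.id_apply, mul_smul, ← Finset.smul_sum]
    rw [smul_comm]

theorem eq_sum_stdVec {n : ℕ} (v : Coord n) : v = ∑ i, v i • stdVec i := by
  ext j
  simp [stdVec, Finset.sum_apply, Pi.single_apply]

theorem cov_expand {n k : ℕ} (α : Cov n k) (c : Fin k → Fin n → ℝ) (u : Fin n → Coord n) :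
    α (fun a => ∑ b, c a b • u b) =
      ∑ r : Fin k → Fin n, (∏ a, c a (r a)) * α fun a => u (r a) := by
  change α.toMultilinearMap _ = _
  rw [MultilinearMap.map_sum]
  refine Finset.sum_congr rfl fun r _ => ?_
  rw [MultilinearMap.map_smul_univ]
  rfl

theorem cov_apply {n k : ℕ} (α : Cov n k) (v : Fin k → Coord n) :
    α v = ∑ r : Fin k → Fin n, (∏ a, v a (r a)) * α fun a => stdVec (r a) := by
  rw [← cov_expand]
  congr 1
  funext a
  exact eq_sum_stdVec _

/-- Smoothness of a covector-valued map can be tested on components. -/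
theorem contDiff_cov {n k : ℕ} {X : Type*} [NormedAddCommGroup X] [NormedSpace ℝ X]
    {f : X → Cov n k} (h : ∀ j : Fin k → Fin n, ContDiff ℝ ∞ fun x => f x fun a => stdVec (j a)) :
    ContDiff ℝ ∞ f := by
  let E : Cov n k →ₗ[ℝ] ((Fin k → Fin n) → ℝ) :=
    { toFun := fun α j => α fun a => stdVec (j a)
      map_add' := fun _ _ => rfl
      map_smul' := fun _ _ => rfl }
  have hE : LinearMap.ker E = ⊥ := by
    rw [LinearMap.ker_eq_bot]
    intro α β hαβ
    ext v
    rw [cov_apply α, cov_apply β]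
    refine Finset.sum_congr rfl fun r _ => ?_
    rw [show (α fun a => stdVec (r a)) = β fun a => stdVec (r a) from congrFun hαβ r]
  obtain ⟨R, hR⟩ := E.exists_leftInverse_of_injective hE
  have : f = fun x => (LinearMap.toContinuousLinearMap R) (E (f x)) := by
    funext x
    exact (LinearMap.congr_fun hR (f x)).symm
  rw [this]
  exact (LinearMap.toContinuousLinearMap R).contDiff.comp (contDiff_pi.2 h)

theorem hodgeStar_apply {n k l : ℕ} (h : k + l = n) (G : Matrix (Fin n) (Fin n) ℝ) (α : Cov n k)
    (w : Fin l → Coord n) :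
    hodgeStar h G α w = (√|G.det| / (k.factorial : ℝ)) *
      ∑ i : Fin k → Fin n, (α fun a => G⁻¹ (i a)) * detSplit h (fun b => stdVec (i b)) w := by
  have : ∀ i : Fin k → Fin n, (α fun a => G⁻¹ (i a)) =
      ∑ j : Fin k → Fin n, (∏ a, G⁻¹ (i a) (j a)) * α fun a => stdVec (j a) :=
    fun i => cov_apply α _
  simp only [this]
  change ((√|G.det| / (k.factorial : ℝ)) • ∑ i : Fin k → Fin n, _ • volumeContraction h i) w = _
  rw [ContinuousAlternatingMap.smul_apply, ContinuousAlternatingMap.sum_apply, smul_eq_mul]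
  rfl

theorem detSplit_mul {n k l : ℕ} (h : k + l = n) (J : Matrix (Fin n) (Fin n) ℝ)
    (u : Fin k → Coord n) (w : Fin l → Coord n) :
    detSplit h (fun a => J *ᵥ u a) (fun a => J *ᵥ w a) = J.det * detSplit h u w := by
  rw [detSplit_apply, detSplit_apply, mul_comm, ← Matrix.det_transpose J, ← Matrix.det_mul]
  congr 1
  subst h
  ext a b
  rw [Matrix.mul_apply]
  simp only [Matrix.of_apply, Fin.cast_refl, id, Matrix.transpose_apply]
  refine Fin.addCases (fun c => ?_) (fun c => ?_) a
  · simp [Matrix.mulVec, dotProduct, mul_comm]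
  · simp [Matrix.mulVec, dotProduct, mul_comm]

/-- The Hodge star commutes with orientation-preserving linear isometries. -/
theorem hodgeStar_comp {n k l : ℕ} (h : k + l = n) (G H : Matrix (Fin n) (Fin n) ℝ)
    (J : Coord n →L[ℝ] Coord n)
    (hJ : 0 < (LinearMap.toMatrix' (J : Coord n →ₗ[ℝ] Coord n)).det)
    (hG : (LinearMap.toMatrix' (J : Coord n →ₗ[ℝ] Coord n))ᵀ * H *
      LinearMap.toMatrix' (J : Coord n →ₗ[ℝ] Coord n) = G) (hH : H.det ≠ 0) (α : Cov n k) :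
    hodgeStar h G (α.compContinuousLinearMap J) =
      (hodgeStar h H α).compContinuousLinearMap J := by
  set M := LinearMap.toMatrix' (J : Coord n →ₗ[ℝ] Coord n) with hM
  have hJv : ∀ v, J v = M *ᵥ v := fun v => by
    rw [hM, ← Matrix.toLin'_apply, Matrix.toLin'_toMatrix']; rfl
  have hMu : IsUnit M.det := isUnit_iff_ne_zero.2 hJ.ne'
  have hHu : IsUnit H.det := isUnit_iff_ne_zero.2 hH
  have hdet : √|G.det| = M.det * √|H.det| := by
    rw [← hG, Matrix.det_mul, Matrix.det_mul, Matrix.det_transpose,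
      show M.det * H.det * M.det = M.det ^ 2 * H.det by ring, abs_mul, abs_of_nonneg (sq_nonneg _),
      Real.sqrt_mul (sq_nonneg _), Real.sqrt_sq hJ.le]
  have hinv : G⁻¹ * Mᵀ = M⁻¹ * H⁻¹ := by
    rw [← hG, Matrix.mul_inv_rev, Matrix.mul_inv_rev, Matrix.mul_assoc, Matrix.mul_assoc,
      Matrix.nonsing_inv_mul _ (by rwa [Matrix.det_transpose]), Matrix.mul_one]
  have hrow : ∀ i : Fin n, J (G⁻¹ i) = ∑ b, M⁻¹ i b • H⁻¹ b := by
    intro i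
    rw [hJv]
    ext c
    have := congrFun (congrFun hinv i) c
    rw [Matrix.mul_apply, Matrix.mul_apply] at this
    simp only [Matrix.transpose_apply] at this
    simp only [Matrix.mulVec, dotProduct, Finset.sum_apply, Pi.smul_apply, smul_eq_mul]
    rw [← this]
    exact Finset.sum_congr rfl fun _ _ => mul_comm _ _
  ext w
  rw [ContinuousAlternatingMap.compContinuousLinearMap_apply, hodgeStar_apply, hodgeStar_apply,
    hdet]
  have key : ∀ r : Fin k → Fin n,
      ∑ i : Fin k → Fin n, (∏ a, M⁻¹ (i a) (r a)) * detSplit h (fun b => stdVec (i b)) w =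
        M.det⁻¹ * detSplit h (fun b => stdVec (r b)) (J ∘ w) := by
    intro r
    have h1 : detSplit h (fun b => stdVec (r b)) (J ∘ w) =
        M.det * detSplit h (fun b => M⁻¹ *ᵥ stdVec (r b)) w := by
      rw [← detSplit_mul]
      congr 2
      · funext b
        rw [Matrix.mulVec_mulVec, Matrix.mul_nonsing_inv _ hMu, Matrix.one_mulVec]
      · funext b
        exact hJv _
    have h2 : (fun b => M⁻¹ *ᵥ stdVec (r b)) = fun b : Fin k => ∑ c, M⁻¹ c (r b) • stdVec c := by
      funext b
      rw [eq_sum_stdVec (M⁻¹ *ᵥ stdVec (r b))]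
      refine Finset.sum_congr rfl fun c _ => ?_
      simp [stdVec]
    rw [h1, ← mul_assoc, inv_mul_cancel₀ hJ.ne', one_mul, h2, MultilinearMap.map_sum,
      sum_apply]
    refine Finset.sum_congr rfl fun i _ => ?_
    rw [MultilinearMap.map_smul_univ]
    rfl
  have hL : ∀ i : Fin k → Fin n, ((α.compContinuousLinearMap J) fun a => G⁻¹ (i a)) =
      ∑ r : Fin k → Fin n, (∏ a, M⁻¹ (i a) (r a)) * α fun a => H⁻¹ (r a) := by
    intro i
    exact (congrArg α (funext fun a => hrow (i a))).trans
      (cov_expand α (fun a b => M⁻¹ (i a) b) fun b => H⁻¹ b)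
  simp only [hL, Finset.sum_mul]
  rw [Finset.sum_comm]
  have : ∀ r : Fin k → Fin n, ∑ i : Fin k → Fin n,
      (∏ a, M⁻¹ (i a) (r a)) * (α fun a => H⁻¹ (r a)) * detSplit h (fun b => stdVec (i b)) w =
      M.det⁻¹ * ((α fun a => H⁻¹ (r a)) * detSplit h (fun b => stdVec (r b)) (J ∘ w)) := by
    intro r
    rw [mul_left_comm, ← key, Finset.mul_sum]
    exact Finset.sum_congr rfl fun _ _ => by ring
  simp only [this]
  rw [← Finset.mul_sum]
  field_simp

/-- Smooth families, parametrised by `ℝᵐ`, of `k`-forms on `ℝⁿ`. -/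
def Form (n m k : ℕ) : Submodule ℝ (Coord n × Coord m → Cov n k) where
  carrier := {α | ContDiff ℝ ∞ α}
  add_mem' h h' := ContDiff.add (Set.mem_ofPred.1 h) (Set.mem_ofPred.1 h')
  zero_mem' := Set.mem_ofPred.2 contDiff_const
  smul_mem' _ _ h := Set.mem_ofPred.2 (contDiff_const.smul (Set.mem_ofPred.1 h))

/-- Smooth families, parametrised by `ℝᵐ`, of differential forms on `ℝⁿ`, with components in
all degrees. -/
abbrev Forms (n m : ℕ) : Type := ∀ k : ℕ, Form n m k

/-- Smooth functions on the parameter space `ℝᵐ`. -/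
def Param (m : ℕ) : Submodule ℝ (Coord m → ℝ) where
  carrier := {f | ContDiff ℝ ∞ f}
  add_mem' h h' := ContDiff.add (Set.mem_ofPred.1 h) (Set.mem_ofPred.1 h')
  zero_mem' := Set.mem_ofPred.2 contDiff_const
  smul_mem' _ _ h := Set.mem_ofPred.2 (contDiff_const.smul (Set.mem_ofPred.1 h))

theorem Form.smooth {n m k : ℕ} (α : Form n m k) : ContDiff ℝ ∞ α.1 := α.2

theorem Form.slice {n m k : ℕ} (α : Form n m k) (s : Coord m) :
    ContDiff ℝ ∞ fun x => α.1 (x, s) :=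
  (Form.smooth α).comp (contDiff_id.prodMk contDiff_const)

theorem Form.differentiable {n m k : ℕ} (α : Form n m k) (s : Coord m) :
    Differentiable ℝ fun x => α.1 (x, s) :=
  (Form.slice α s).differentiable (by simp)

theorem contDiff_extDeriv_slice {n m k : ℕ} (α : Form n m k) :
    ContDiff ℝ ∞ fun z : Coord n × Coord m => extDeriv (fun x => α.1 (x, z.2)) z.1 := by
  have h1 : ContDiff ℝ ∞ fun z : Coord n × Coord m => fderiv ℝ (fun x => α.1 (x, z.2)) z.1 := by
    have h2 : ContDiff ℝ ∞
        (Function.uncurry fun (z : Coord n × Coord m) x => α.1 (x, z.2)) :=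
      (Form.smooth α).comp (contDiff_snd.prodMk (contDiff_snd.comp contDiff_fst))
    exact h2.fderiv (m := ∞) contDiff_fst (by simp)
  exact (ContinuousAlternatingMap.alternatizeUncurryFinCLM ℝ (Coord n) ℝ).contDiff.comp h1

/-- The exterior derivative along `ℝⁿ` of a family of `k`-forms. -/
def dForm (n m k : ℕ) : Form n m k →ₗ[ℝ] Form n m (k + 1) where
  toFun α := ⟨fun z => extDeriv (fun x => α.1 (x, z.2)) z.1, contDiff_extDeriv_slice α⟩
  map_add' α β := by
    ext1; funext z
    exact extDeriv_fun_add (Form.differentiable α z.2 _) (Form.differentiable β z.2 _)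
  map_smul' c α := by
    ext1; funext z
    exact extDeriv_fun_smul c _

/-- The exterior derivative along `ℝⁿ`. -/
def dForms (n m : ℕ) : Forms n m →ₗ[ℝ] Forms n m :=
  LinearMap.pi fun
    | 0 => 0
    | k + 1 => dForm n m k ∘ₗ LinearMap.proj k

/-- The projection to the components whose degree satisfies `P`. -/
def keep (n m : ℕ) (P : ℕ → Prop) [DecidablePred P] : Forms n m →ₗ[ℝ] Forms n m :=
  LinearMap.pi fun k => if P k then LinearMap.proj k else 0

/-- Multiplication of `k`-forms by `(-1)ᵏ`. -/
def alternate (n m : ℕ) : Forms n m →ₗ[ℝ] Forms n m :=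
  LinearMap.pi fun k => (-1 : ℝ) ^ k • LinearMap.proj k

/-- A function of the parameter alone, as a family of `0`-forms constant along `ℝⁿ`. -/
def const (n m : ℕ) : Param m →ₗ[ℝ] Forms n m :=
  LinearMap.pi fun
    | 0 =>
      { toFun := fun r => ⟨fun z => ContinuousAlternatingMap.constOfIsEmpty ℝ (Coord n) (Fin 0)
          (r.1 z.2), contDiff_cov fun _ => (show ContDiff ℝ ∞ r.1 from r.2).comp contDiff_snd⟩
        map_add' := fun _ _ => rfl
        map_smul' := fun _ _ => rfl }
    | _ + 1 => 0

/-- An integer as a constant function of the parameter. -/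
def intParam (m : ℕ) : ℤ →+ Param m where
  toFun z := ⟨fun _ => z, show ContDiff ℝ ∞ fun _ : Coord m => (z : ℝ) from contDiff_const⟩
  map_zero' := by ext; simp
  map_add' _ _ := by ext; simp

/-- An integer as a constant `0`-form. -/
def intConst (n m : ℕ) : ℤ →+ Forms n m :=
  (const n m).toAddMonoidHom.comp (intParam m)

/-! ### Metrics -/

/-- The two kinds of metrics that are considered. -/
inductive Signature
  | riemannian
  | lorentzian

/-- The diagonal matrix `diag(1, …, 1)`, respectively `diag(-1, 1, …, 1)`. -/
def Signature.flat (σ : Signature) (n : ℕ) : Matrix (Fin n) (Fin n) ℝ :=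
  Matrix.diagonal fun i => match σ with
    | .riemannian => 1
    | .lorentzian => if i.val = 0 then -1 else 1

/-- `G` is the Gram matrix of an inner product of signature `σ`. -/
def Signature.IsGram (σ : Signature) {n : ℕ} (G : Matrix (Fin n) (Fin n) ℝ) : Prop :=
  ∃ P : Matrix (Fin n) (Fin n) ℝ, P.det ≠ 0 ∧ Pᵀ * G * P = σ.flat n

theorem Signature.IsGram.det_ne_zero {σ : Signature} {n : ℕ} {G : Matrix (Fin n) (Fin n) ℝ}
    (h : σ.IsGram G) : G.det ≠ 0 := by
  obtain ⟨P, hP, h⟩ := h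
  intro h0
  have h1 := congrArg Matrix.det h
  rw [Matrix.det_mul, Matrix.det_mul, h0, mul_zero, zero_mul] at h1
  rw [Signature.flat, Matrix.det_diagonal, eq_comm, Finset.prod_eq_zero_iff] at h1
  obtain ⟨i, -, hi⟩ := h1
  cases σ
  · simp at hi
  · by_cases hi0 : i.val = 0 <;> simp [hi0] at hi

/-- The Jacobian matrix of `τ` at `y`. -/
def jacobian {n : ℕ} (τ : Coord n → Coord n) (y : Coord n) : Matrix (Fin n) (Fin n) ℝ :=
  LinearMap.toMatrix' (fderiv ℝ τ y : Coord n →ₗ[ℝ] Coord n)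

theorem jacobian_comp {n : ℕ} {τ τ' : Coord n → Coord n} {y : Coord n}
    (h' : DifferentiableAt ℝ τ' (τ y)) (h : DifferentiableAt ℝ τ y) :
    jacobian (τ' ∘ τ) y = jacobian τ' (τ y) * jacobian τ y := by
  rw [jacobian, fderiv_comp y h' h]
  exact LinearMap.toMatrix'_comp _ _

/-- On the set `S`, the map `τ` is smooth with positive Jacobian determinant, and it pulls back the
metric `h` to the metric `g`. -/
structure IsOrientedIsometryOn {n : ℕ} (τ : Coord n → Coord n)
    (g h : Coord n → Matrix (Fin n) (Fin n) ℝ) (S : Set (Coord n)) : Prop where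
  contDiffOn : ContDiffOn ℝ ∞ τ S
  det_pos : ∀ y ∈ S, 0 < (jacobian τ y).det
  isometry : ∀ y ∈ S, (jacobian τ y)ᵀ * h (τ y) * jacobian τ y = g y

/-- An oriented `n`-manifold with a metric of signature `σ`: a smooth manifold (Hausdorff and second
countable) whose atlas is oriented, with a metric given by its Gram matrices in the charts of the
atlas. -/
structure Spacetime (σ : Signature) (n : ℕ) where
  carrier : Type
  [topology : TopologicalSpace carrier]
  [t2 : T2Space carrier]
  [secondCountable : SecondCountableTopology carrier]
  [charts : ChartedSpace (Coord n) carrier]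
  [smooth : IsManifold 𝓘(ℝ, Coord n) ∞ carrier]
  metric : OpenPartialHomeomorph carrier (Coord n) → Coord n → Matrix (Fin n) (Fin n) ℝ
  contDiffOn_metric : ∀ φ ∈ atlas (Coord n) carrier, ∀ i j,
    ContDiffOn ℝ ∞ (fun y => metric φ y i j) φ.target
  isGram_metric : ∀ φ ∈ atlas (Coord n) carrier, ∀ y ∈ φ.target, σ.IsGram (metric φ y)
  compatible : ∀ φ ∈ atlas (Coord n) carrier, ∀ ψ ∈ atlas (Coord n) carrier,
    IsOrientedIsometryOn (ψ ∘ φ.symm) (metric φ) (metric ψ) (φ.target ∩ φ.symm ⁻¹' ψ.source)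

namespace Spacetime

attribute [instance] topology charts

variable {σ : Signature} {n : ℕ}

/-- An isometric, orientation-preserving (open, smooth) embedding of spacetimes. -/
@[ext]
structure Hom (M N : Spacetime σ n) where
  toFun : M.carrier → N.carrier
  isOpenEmbedding : IsOpenEmbedding toFun
  isometry : ∀ φ ∈ atlas (Coord n) M.carrier, ∀ ψ ∈ atlas (Coord n) N.carrier,
    IsOrientedIsometryOn (ψ ∘ toFun ∘ φ.symm) (M.metric φ) (N.metric ψ)
      (φ.target ∩ φ.symm ⁻¹' (toFun ⁻¹' ψ.source))

theorem Hom.isometry_comp {M N P : Spacetime σ n} (f : Hom M N) (g : Hom N P) :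
    ∀ φ ∈ atlas (Coord n) M.carrier, ∀ ψ ∈ atlas (Coord n) P.carrier,
      IsOrientedIsometryOn (ψ ∘ (g.toFun ∘ f.toFun) ∘ φ.symm) (M.metric φ) (P.metric ψ)
        (φ.target ∩ φ.symm ⁻¹' ((g.toFun ∘ f.toFun) ⁻¹' ψ.source)) := by
  intro φ hφ ψ hψ
  have main : ∀ y ∈ φ.target ∩ φ.symm ⁻¹' ((g.toFun ∘ f.toFun) ⁻¹' ψ.source),
      ContDiffAt ℝ ∞ (ψ ∘ (g.toFun ∘ f.toFun) ∘ φ.symm) y ∧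
      0 < (jacobian (ψ ∘ (g.toFun ∘ f.toFun) ∘ φ.symm) y).det ∧
      (jacobian (ψ ∘ (g.toFun ∘ f.toFun) ∘ φ.symm) y)ᵀ *
        P.metric ψ ((ψ ∘ (g.toFun ∘ f.toFun) ∘ φ.symm) y) *
        jacobian (ψ ∘ (g.toFun ∘ f.toFun) ∘ φ.symm) y = M.metric φ y := by
    rintro y ⟨hy, hy'⟩
    let χ := chartAt (Coord n) (f.toFun (φ.symm y))
    have hχ : χ ∈ atlas (Coord n) N.carrier := chart_mem_atlas _ _
    have hyχ : f.toFun (φ.symm y) ∈ χ.source := mem_chart_source _ _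
    have hy1 : y ∈ φ.target ∩ φ.symm ⁻¹' (f.toFun ⁻¹' χ.source) := ⟨hy, hyχ⟩
    have hS1 : IsOpen (φ.target ∩ φ.symm ⁻¹' (f.toFun ⁻¹' χ.source)) :=
      φ.isOpen_inter_preimage_symm (χ.open_source.preimage f.isOpenEmbedding.continuous)
    have hz : (χ ∘ f.toFun ∘ φ.symm) y ∈ χ.target ∩ χ.symm ⁻¹' (g.toFun ⁻¹' ψ.source) :=
      ⟨χ.map_source hyχ, by
        simpa only [Set.mem_preimage, Function.comp_apply, χ.left_inv hyχ] using hy'⟩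
    have hS2 : IsOpen (χ.target ∩ χ.symm ⁻¹' (g.toFun ⁻¹' ψ.source)) :=
      χ.isOpen_inter_preimage_symm (ψ.open_source.preimage g.isOpenEmbedding.continuous)
    have F := f.isometry φ hφ χ hχ
    have G := g.isometry χ hχ ψ hψ
    have cF : ContDiffAt ℝ ∞ (χ ∘ f.toFun ∘ φ.symm) y :=
      F.contDiffOn.contDiffAt (hS1.mem_nhds hy1)
    have cG : ContDiffAt ℝ ∞ (ψ ∘ g.toFun ∘ χ.symm) ((χ ∘ f.toFun ∘ φ.symm) y) :=
      G.contDiffOn.contDiffAt (hS2.mem_nhds hz)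
    have heq : (ψ ∘ (g.toFun ∘ f.toFun) ∘ φ.symm) =ᶠ[𝓝 y]
        (ψ ∘ g.toFun ∘ χ.symm) ∘ (χ ∘ f.toFun ∘ φ.symm) := by
      filter_upwards [hS1.mem_nhds hy1] with x hx
      simp only [Function.comp_apply, χ.left_inv hx.2]
    have hjac : jacobian (ψ ∘ (g.toFun ∘ f.toFun) ∘ φ.symm) y =
        jacobian (ψ ∘ g.toFun ∘ χ.symm) ((χ ∘ f.toFun ∘ φ.symm) y) *
          jacobian (χ ∘ f.toFun ∘ φ.symm) y := by
      rw [← jacobian_comp (cG.differentiableAt (by simp)) (cF.differentiableAt (by simp)),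
        jacobian, jacobian, heq.fderiv_eq]
    refine ⟨(cG.comp y cF).congr_of_eventuallyEq heq, ?_, ?_⟩
    · rw [hjac, Matrix.det_mul]
      exact mul_pos (G.det_pos _ hz) (F.det_pos _ hy1)
    · rw [hjac, ← F.isometry y hy1, ← G.isometry _ hz, heq.eq_of_nhds, Matrix.transpose_mul]
      simp only [Matrix.mul_assoc, Function.comp_apply]
  exact ⟨fun y hy => (main y hy).1.contDiffWithinAt, fun y hy => (main y hy).2.1,
    fun y hy => (main y hy).2.2⟩

instance : Category (Spacetime σ n) where
  Hom := Hom
  id M := ⟨id, .id, fun φ hφ ψ hψ => M.compatible φ hφ ψ hψ⟩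
  comp f g := ⟨g.toFun ∘ f.toFun, g.isOpenEmbedding.comp f.isOpenEmbedding, f.isometry_comp g⟩

/-- The families of embeddings that are jointly surjective. -/
def coverage (σ : Signature) (n : ℕ) : Precoverage (Spacetime σ n) where
  coverings M := {R | ∀ x : M.carrier, ∃ (U : Spacetime σ n) (f : U ⟶ M), R f ∧
    x ∈ Set.range f.toFun}

end Spacetime

/-- A coordinate patch: `ℝⁿ` with an arbitrary metric of signature `σ`. -/
structure Patch (σ : Signature) (n : ℕ) where
  metric : Coord n → Matrix (Fin n) (Fin n) ℝ
  contDiff_metric : ∀ i j, ContDiff ℝ ∞ fun y => metric y i j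
  isGram_metric : ∀ y, σ.IsGram (metric y)

/-- A coordinate patch as a spacetime. -/
def Patch.toSpacetime {σ : Signature} {n : ℕ} (V : Patch σ n) : Spacetime σ n where
  carrier := Coord n
  metric _ := V.metric
  contDiffOn_metric _ _ i j := (V.contDiff_metric i j).contDiffOn
  isGram_metric _ _ y _ := V.isGram_metric y
  compatible φ hφ ψ hψ := by
    rw [chartedSpaceSelf_atlas] at hφ hψ
    subst hφ hψ
    have h : jacobian (n := n) (_root_.id ∘ _root_.id) = fun _ => 1 := by
      funext y
      simp [jacobian]
    change IsOrientedIsometryOn (_root_.id ∘ _root_.id) _ _ _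
    exact ⟨contDiff_id.contDiffOn, fun y _ => by rw [h]; simp, fun y _ => by rw [h]; simp⟩

/-- The category of coordinate patches, as a full subcategory of the category of spacetimes. -/
abbrev PatchCat (σ : Signature) (n : ℕ) : Type :=
  InducedCategory (Spacetime σ n) (Patch.toSpacetime (σ := σ) (n := n))

/-- The inclusion of coordinate patches in spacetimes. -/
abbrev patchInclusion (σ : Signature) (n : ℕ) : PatchCat σ n ⥤ Spacetime σ n :=
  inducedFunctor _

/-! ### Operations on forms on coordinate patches -/

theorem hodgeStar_smooth {n m k l : ℕ} (h : k + l = n)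
    {g : Coord n → Matrix (Fin n) (Fin n) ℝ} (hg : ∀ i j, ContDiff ℝ ∞ fun y => g y i j)
    (hdet : ∀ y, (g y).det ≠ 0) (α : Form n m k) :
    ContDiff ℝ ∞ fun z : Coord n × Coord m => hodgeStar h (g z.1) (α.1 z) := by
  have hd : ∀ M : Coord n → Matrix (Fin n) (Fin n) ℝ, (∀ i j, ContDiff ℝ ∞ fun y => M y i j) →
      ContDiff ℝ ∞ fun y => (M y).det := by
    intro M hM
    simp only [Matrix.det_apply']
    exact ContDiff.sum fun s _ => contDiff_const.mul (contDiff_prod fun i _ => hM _ _)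
  have hinv : ∀ i j, ContDiff ℝ ∞ fun y => (g y)⁻¹ i j := by
    intro i j
    have : (fun y => (g y)⁻¹ i j) = fun y => ((g y).det)⁻¹ * (g y).adjugate i j := by
      funext y
      rw [Matrix.inv_def, Matrix.smul_apply, smul_eq_mul, Ring.inverse_eq_inv']
    rw [this]
    refine ((hd g hg).inv hdet).mul ?_
    simp only [Matrix.adjugate_apply]
    refine hd _ fun a b => ?_
    by_cases hab : a = j
    · simp only [hab, Matrix.updateRow_self]; exact contDiff_const
    · simp only [Matrix.updateRow_ne hab]; exact hg _ _
  have hvol : ContDiff ℝ ∞ fun z : Coord n × Coord m =>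
      √|(g z.1).det| / (k.factorial : ℝ) := by
    refine ContDiff.div_const ?_ _
    refine (((hd g hg).comp contDiff_fst).abs fun z => hdet _).sqrt fun z => ?_
    exact abs_ne_zero.2 (hdet _)
  have hα : ∀ j : Fin k → Fin n, ContDiff ℝ ∞ fun z => α.1 z fun a => stdVec (j a) := fun j =>
    (ContinuousAlternatingMap.apply ℝ (Coord n) ℝ fun a => stdVec (j a)).contDiff.comp
      (Form.smooth α)
  change ContDiff ℝ ∞ fun z : Coord n × Coord m =>
    (√|(g z.1).det| / (k.factorial : ℝ)) • ∑ i : Fin k → Fin n, (∑ j : Fin k → Fin n,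
      (∏ a, (g z.1)⁻¹ (i a) (j a)) * (α.1 z) fun a => stdVec (j a)) • volumeContraction h i
  refine hvol.smul (ContDiff.sum fun i _ => ?_)
  have hc : ContDiff ℝ ∞ fun z : Coord n × Coord m => ∑ j : Fin k → Fin n,
      (∏ a, (g z.1)⁻¹ (i a) (j a)) * (α.1 z) fun a => stdVec (j a) :=
    ContDiff.sum fun j _ =>
      (contDiff_prod fun a _ => (hinv _ _).comp contDiff_fst).mul (hα j)
  exact hc.smul contDiff_const

/-- The Hodge star of a coordinate patch, from `k`-forms to `l`-forms where `k + l = n`. -/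
def Patch.starForm {σ : Signature} {n : ℕ} (V : Patch σ n) (m : ℕ) {k l : ℕ} (h : k + l = n) :
    Form n m k →ₗ[ℝ] Form n m l where
  toFun α := ⟨fun z => hodgeStar h (V.metric z.1) (α.1 z),
    hodgeStar_smooth h V.contDiff_metric (fun y => (V.isGram_metric y).det_ne_zero) α⟩
  map_add' α β := by ext1; funext z; exact map_add (hodgeStar h (V.metric z.1)) _ _
  map_smul' c α := by ext1; funext z; exact map_smul (hodgeStar h (V.metric z.1)) _ _

/-- The Hodge star of a coordinate patch, in all degrees. -/
def Patch.star {σ : Signature} {n : ℕ} (V : Patch σ n) (m : ℕ) : Forms n m →ₗ[ℝ] Forms n m :=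
  LinearMap.pi fun l =>
    if h : l ≤ n then V.starForm m (Nat.sub_add_cancel h) ∘ₗ LinearMap.proj (n - l) else 0

/-- The pullback of families of `k`-forms along a map of `ℝⁿ` and a map of parameter spaces. -/
def pullbackForm {n m m' : ℕ} {τ : Coord n → Coord n} (hτ : ContDiff ℝ ∞ τ)
    {θ : Coord m' → Coord m} (hθ : ContDiff ℝ ∞ θ) (k : ℕ) : Form n m k →ₗ[ℝ] Form n m' k where
  toFun α := ⟨fun z => (α.1 (τ z.1, θ z.2)).compContinuousLinearMap (fderiv ℝ τ z.1), by
    refine contDiff_cov fun j => ?_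
    have h1 : ContDiff ℝ ∞ fun z : Coord n × Coord m' => α.1 (τ z.1, θ z.2) :=
      (Form.smooth α).comp ((hτ.comp contDiff_fst).prodMk (hθ.comp contDiff_snd))
    have h2 : ∀ v : Coord n, ContDiff ℝ ∞ fun z : Coord n × Coord m' => fderiv ℝ τ z.1 v :=
      fun v => ((hτ.fderiv_right (m := ∞) (by simp)).comp contDiff_fst).clm_apply contDiff_const
    have h3 : (fun z : Coord n × Coord m' => (α.1 (τ z.1, θ z.2)).compContinuousLinearMap
        (fderiv ℝ τ z.1) fun a => stdVec (j a)) = fun z => ∑ r : Fin k → Fin n,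
        (∏ a, fderiv ℝ τ z.1 (stdVec (j a)) (r a)) *
          α.1 (τ z.1, θ z.2) fun a => stdVec (r a) := by
      funext z
      exact cov_apply (α.1 (τ z.1, θ z.2)) fun a => fderiv ℝ τ z.1 (stdVec (j a))
    rw [h3]
    exact ContDiff.sum fun r _ => (contDiff_prod fun a _ => contDiff_pi.1 (h2 _) _).mul
      ((ContinuousAlternatingMap.apply ℝ (Coord n) ℝ fun a => stdVec (r a)).contDiff.comp h1)⟩
  map_add' _ _ := rfl
  map_smul' _ _ := rfl

/-- The pullback of families of forms along a map of `ℝⁿ` and a map of parameter spaces. -/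
def pullback {n m m' : ℕ} {τ : Coord n → Coord n} (hτ : ContDiff ℝ ∞ τ)
    {θ : Coord m' → Coord m} (hθ : ContDiff ℝ ∞ θ) : Forms n m →ₗ[ℝ] Forms n m' :=
  LinearMap.pi fun k => pullbackForm hτ hθ k ∘ₗ LinearMap.proj k

/-- The pullback of functions along a map of parameter spaces. -/
def pullbackParam {m m' : ℕ} {θ : Coord m' → Coord m} (hθ : ContDiff ℝ ∞ θ) :
    Param m →ₗ[ℝ] Param m' where
  toFun f := ⟨fun s => f.1 (θ s), (show ContDiff ℝ ∞ f.1 from f.2).comp hθ⟩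
  map_add' _ _ := rfl
  map_smul' _ _ := rfl

theorem two_le_smooth : minSmoothness ℝ 2 ≤ ∞ := by
  simp only [minSmoothness_of_isRCLikeNormedField]
  exact WithTop.coe_le_coe.2 le_top

section Naturality

variable {n m m' : ℕ} {τ : Coord n → Coord n} (hτ : ContDiff ℝ ∞ τ)
  {θ : Coord m' → Coord m} (hθ : ContDiff ℝ ∞ θ)

theorem pullback_dForms (α : Forms n m) :
    pullback hτ hθ (dForms n m α) = dForms n m' (pullback hτ hθ α) := by
  funext k
  cases k with
  | zero => exact map_zero (pullbackForm hτ hθ 0)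
  | succ k =>
    ext1
    funext z
    exact (extDeriv_pullback (r := ∞) (f := τ) (x := z.1)
      (Form.differentiable (α k) (θ z.2) (τ z.1)) hτ.contDiffAt two_le_smooth).symm

theorem pullback_keep (P : ℕ → Prop) [DecidablePred P] (α : Forms n m) :
    pullback hτ hθ (keep n m P α) = keep n m' P (pullback hτ hθ α) := by
  funext k
  by_cases h : P k <;> simp [keep, pullback, h]

theorem pullback_alternate (α : Forms n m) :
    pullback hτ hθ (alternate n m α) = alternate n m' (pullback hτ hθ α) := by
  funext k
  simp [alternate, pullback]

theorem pullback_const (r : Param m) :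
    pullback hτ hθ (const n m r) = const n m' (pullbackParam hθ r) := by
  funext k
  cases k with
  | zero => ext z v; rfl
  | succ k => exact map_zero (pullbackForm hτ hθ _)

theorem pullback_intConst (z : ℤ) :
    pullback hτ hθ (intConst n m z) = intConst n m' z :=
  pullback_const hτ hθ _

theorem pullback_star {σ : Signature} {V W : Patch σ n}
    (h : IsOrientedIsometryOn τ V.metric W.metric Set.univ) (α : Forms n m) :
    pullback hτ hθ (W.star m α) = V.star m' (pullback hτ hθ α) := by
  funext l
  by_cases hl : l ≤ n
  · simp only [pullback, Patch.star, LinearMap.pi_apply, LinearMap.comp_apply,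
      LinearMap.proj_apply, dif_pos hl]
    ext1
    funext z
    exact (hodgeStar_comp _ _ _ _ (h.det_pos _ trivial) (h.isometry _ trivial)
      (W.isGram_metric _).det_ne_zero _).symm
  · simp [pullback, Patch.star, dif_neg hl]

theorem pullback_id (α : Forms n m) :
    pullback (contDiff_id : ContDiff ℝ ∞ (id : Coord n → Coord n))
      (contDiff_id : ContDiff ℝ ∞ (id : Coord m → Coord m)) α = α := by
  funext k
  ext z v
  change (α k).1 z (fderiv ℝ id z.1 ∘ v) = _
  rw [fderiv_id]
  rfl

theorem pullback_pullback {m'' : ℕ} {τ' : Coord n → Coord n} (hτ' : ContDiff ℝ ∞ τ')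
    {θ' : Coord m'' → Coord m'} (hθ' : ContDiff ℝ ∞ θ') (α : Forms n m) :
    pullback hτ' hθ' (pullback hτ hθ α) = pullback (hτ.comp hτ') (hθ.comp hθ') α := by
  funext k
  ext z v
  change (α k).1 (τ (τ' z.1), θ (θ' z.2)) (fderiv ℝ τ (τ' z.1) ∘ fderiv ℝ τ' z.1 ∘ v) =
    (α k).1 (τ (τ' z.1), θ (θ' z.2)) (fderiv ℝ (τ ∘ τ') z.1 ∘ v)
  rw [fderiv_comp _ (hτ.differentiable (by simp) _) (hτ'.differentiable (by simp) _)]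
  rfl

end Naturality

theorem dForms_dForms {n m : ℕ} (α : Forms n m) : dForms n m (dForms n m α) = 0 := by
  funext k
  match k with
  | 0 => rfl
  | 1 => exact map_zero (dForm n m 0)
  | k + 2 =>
    ext1
    funext z
    exact extDeriv_extDeriv_apply (r := ∞) (Form.slice (α k) z.2).contDiffAt two_le_smooth

theorem dForms_const {n m : ℕ} (r : Param m) : dForms n m (const n m r) = 0 := by
  funext k
  match k with
  | 0 => rfl
  | 1 =>
    ext1
    funext z
    change extDeriv (fun _ : Coord n => ContinuousAlternatingMap.constOfIsEmpty ℝ (Coord n) (Fin 0)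
      (r.1 z.2)) z.1 = 0
    rw [extDeriv_constOfIsEmpty]
    ext v
    simp
  | k + 2 => exact map_zero (dForm n m (k + 1))

/-! ### Cochain complexes given by a differential on a sum of homogeneous parts -/

/-- An abelian group with a differential and with subgroups of elements that are homogeneous of
degree `i`. -/
structure DiffGroup where
  carrier : Type
  [group : AddCommGroup carrier]
  diff : carrier →+ carrier
  degree : ℤ → AddSubgroup carrier
  diff_mem : ∀ i, ∀ x ∈ degree i, diff x ∈ degree (i + 1)
  diff_diff : ∀ x, diff (diff x) = 0

namespace DiffGroup

attribute [instance] group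

@[ext]
structure Hom (A B : DiffGroup) where
  map : A.carrier →+ B.carrier
  map_mem : ∀ i, ∀ x ∈ A.degree i, map x ∈ B.degree i
  map_diff : ∀ x, map (A.diff x) = B.diff (map x)

instance : Category DiffGroup where
  Hom := Hom
  id A := ⟨AddMonoidHom.id _, fun _ _ h => h, fun _ => rfl⟩
  comp f g := ⟨g.map.comp f.map, fun i x h => g.map_mem i _ (f.map_mem i x h),
    fun x => (congrArg g.map (f.map_diff x)).trans (g.map_diff _)⟩

/-- The restriction of the differential to homogeneous elements. -/
def restrictDiff (A : DiffGroup) {i j : ℤ} (h : i + 1 = j) : A.degree i →+ A.degree j where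
  toFun x := ⟨A.diff x, h ▸ A.diff_mem i x x.2⟩
  map_zero' := by ext; simp
  map_add' _ _ := by ext; simp

/-- The restriction of a morphism to homogeneous elements. -/
def Hom.restrict {A B : DiffGroup} (f : Hom A B) (i : ℤ) : A.degree i →+ B.degree i where
  toFun x := ⟨f.map x, f.map_mem i x x.2⟩
  map_zero' := by ext; simp
  map_add' _ _ := by ext; simp

/-- The cochain complex `⋯ → A.degree i → A.degree (i + 1) → ⋯`. -/
def toComplex : DiffGroup ⥤ CochainComplex AddCommGrpCat.{0} ℤ where
  obj A :=
    { X := fun i => AddCommGrpCat.of (A.degree i)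
      d := fun i j => if h : i + 1 = j then AddCommGrpCat.ofHom (A.restrictDiff h) else 0
      shape := fun i j h => dif_neg h
      d_comp_d' := by
        intro i j k hij hjk
        change i + 1 = j at hij
        change j + 1 = k at hjk
        rw [dif_pos hij, dif_pos hjk]
        ext x
        exact A.diff_diff x.1 }
  map {A B} f :=
    { f := fun i => AddCommGrpCat.ofHom (Hom.restrict f i)
      comm' := by
        intro i j hij
        change i + 1 = j at hij
        change AddCommGrpCat.ofHom (Hom.restrict f i) ≫
            (if h : i + 1 = j then AddCommGrpCat.ofHom (B.restrictDiff h) else 0) =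
          (if h : i + 1 = j then AddCommGrpCat.ofHom (A.restrictDiff h) else 0) ≫
            AddCommGrpCat.ofHom (Hom.restrict f j)
        rw [dif_pos hij, dif_pos hij]
        ext x
        exact (f.map_diff x.1).symm }
  map_id _ := rfl
  map_comp _ _ := rfl

end DiffGroup

/-- The forms whose components all have degrees satisfying `P`. -/
def formsIn (n m : ℕ) (P : ℕ → Prop) : AddSubgroup (Forms n m) :=
  Submodule.toAddSubgroup (R := ℝ)
    { carrier := {α : Forms n m | ∀ k, ¬ P k → α k = 0}
      zero_mem' := Set.mem_ofPred.2 fun _ _ => rfl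
      add_mem' := fun ha hb => Set.mem_ofPred.2 fun k hk => by
        rw [Pi.add_apply, Set.mem_ofPred.1 ha k hk, Set.mem_ofPred.1 hb k hk, add_zero]
      smul_mem' := fun c _ ha => Set.mem_ofPred.2 fun k hk => by
        rw [Pi.smul_apply, Set.mem_ofPred.1 ha k hk, smul_zero] }

theorem mem_formsIn {n m : ℕ} {P : ℕ → Prop} {α : Forms n m} :
    α ∈ formsIn n m P ↔ ∀ k, ¬ P k → α k = 0 := Iff.rfl

/-- The whole group if `P` holds, and the trivial group otherwise. -/
def onlyIf (G : Type) [AddCommGroup G] (P : Prop) : AddSubgroup G where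
  carrier := {x | ¬ P → x = 0}
  zero_mem' := Set.mem_ofPred.2 fun _ => rfl
  add_mem' ha hb := Set.mem_ofPred.2 fun h => by
    rw [Set.mem_ofPred.1 ha h, Set.mem_ofPred.1 hb h, add_zero]
  neg_mem' ha := Set.mem_ofPred.2 fun h => by rw [Set.mem_ofPred.1 ha h, neg_zero]

theorem mem_onlyIf {G : Type} [AddCommGroup G] {P : Prop} {x : G} :
    x ∈ onlyIf G P ↔ (¬ P → x = 0) := Iff.rfl

/-- Cartesian spaces and smooth maps. -/
structure CartSp : Type where
  dim : ℕ

instance : Category CartSp where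
  Hom X Y := {f : Coord X.dim → Coord Y.dim // ContDiff ℝ ∞ f}
  id _ := ⟨id, contDiff_id⟩
  comp f g := ⟨g.1 ∘ f.1, g.2.comp f.2⟩

theorem Patch.isOrientedIsometryOn {σ : Signature} {n : ℕ} {V W : PatchCat σ n} (f : V ⟶ W) :
    IsOrientedIsometryOn (n := n) f.hom.toFun (Patch.metric V) (Patch.metric W) Set.univ := by
  have h := f.hom.isometry (OpenPartialHomeomorph.refl (Coord n))
    (chartedSpaceSelf_atlas.2 rfl) (OpenPartialHomeomorph.refl (Coord n))
    (chartedSpaceSelf_atlas.2 rfl)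
  have key : ∀ y : Coord n, y ∈ (OpenPartialHomeomorph.refl (Coord n)).target ∩
      (OpenPartialHomeomorph.refl (Coord n)).symm ⁻¹'
        (f.hom.toFun ⁻¹' (OpenPartialHomeomorph.refl (Coord n)).source) :=
    fun y => ⟨Set.mem_univ y, Set.mem_univ (f.hom.toFun y)⟩
  exact ⟨h.contDiffOn.mono fun y _ => key y, fun y _ => h.det_pos y (key y),
    fun y _ => h.isometry y (key y)⟩

theorem Patch.contDiff_toFun {σ : Signature} {n : ℕ} {V W : PatchCat σ n} (f : V ⟶ W) :
    @ContDiff ℝ _ (Coord n) _ _ (Coord n) _ _ ∞ f.hom.toFun :=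
  contDiffOn_univ.1 (Patch.isOrientedIsometryOn f).contDiffOn

theorem pullback_mem_formsIn {n m m' : ℕ} {τ : Coord n → Coord n} (hτ : ContDiff ℝ ∞ τ)
    {θ : Coord m' → Coord m} (hθ : ContDiff ℝ ∞ θ) {P : ℕ → Prop} {α : Forms n m}
    (h : α ∈ formsIn n m P) : pullback hτ hθ α ∈ formsIn n m' P :=
  mem_formsIn.2 fun k hk => (congrArg (pullbackForm hτ hθ k) (mem_formsIn.1 h k hk)).trans (map_zero _)

theorem map_mem_onlyIf {G H : Type} [AddCommGroup G] [AddCommGroup H] (f : G →+ H) {P : Prop}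
    {x : G} (h : x ∈ onlyIf G P) : f x ∈ onlyIf H P :=
  mem_onlyIf.2 fun hP => (congrArg f (mem_onlyIf.1 h hP)).trans (map_zero f)

theorem dForms_mem {n m : ℕ} {P Q : ℕ → Prop} (hPQ : ∀ k, P k → Q (k + 1)) {α : Forms n m}
    (h : α ∈ formsIn n m P) : dForms n m α ∈ formsIn n m Q := by
  refine mem_formsIn.2 fun k hk => ?_
  match k with
  | 0 => rfl
  | k + 1 =>
    exact (congrArg (dForm n m k) (mem_formsIn.1 h k fun hP => hk (hPQ k hP))).trans (map_zero _)

theorem keep_mem {n m : ℕ} {P Q R : ℕ → Prop} [DecidablePred R] (hPQ : ∀ k, P k → R k → Q k)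
    {α : Forms n m} (h : α ∈ formsIn n m P) : keep n m R α ∈ formsIn n m Q := by
  refine mem_formsIn.2 fun k hk => ?_
  by_cases hR : R k
  · simpa [keep, hR] using mem_formsIn.1 h k fun hP => hk (hPQ k hP hR)
  · simp [keep, hR]

theorem alternate_mem {n m : ℕ} {P Q : ℕ → Prop} (hPQ : ∀ k, P k → Q k)
    {α : Forms n m} (h : α ∈ formsIn n m P) : alternate n m α ∈ formsIn n m Q := by
  refine mem_formsIn.2 fun k hk => ?_
  have := mem_formsIn.1 h k fun hP => hk (hPQ k hP)
  simp [alternate, this]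

theorem star_mem {σ : Signature} {n m : ℕ} (V : Patch σ n) {P Q : ℕ → Prop}
    (hPQ : ∀ k l, k + l = n → P k → Q l) {α : Forms n m}
    (h : α ∈ formsIn n m P) : V.star m α ∈ formsIn n m Q := by
  refine mem_formsIn.2 fun l hl => ?_
  by_cases hln : l ≤ n
  · have h0 := mem_formsIn.1 h (n - l) fun hP => hl (hPQ _ _ (Nat.sub_add_cancel hln) hP)
    simp [Patch.star, hln, h0]
  · simp [Patch.star, hln]

theorem const_mem {n m : ℕ} {P : Prop} {Q : ℕ → Prop} (hPQ : P → Q 0) {r : Param m}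
    (h : r ∈ onlyIf (Param m) P) : const n m r ∈ formsIn n m Q := by
  refine mem_formsIn.2 fun k hk => ?_
  match k with
  | 0 =>
    rw [mem_onlyIf.1 h fun hP => hk (hPQ hP), map_zero]
    rfl
  | k + 1 => rfl

theorem intConst_mem {n m : ℕ} {P : Prop} {Q : ℕ → Prop} (hPQ : P → Q 0) {z : ℤ}
    (h : z ∈ onlyIf ℤ P) : intConst n m z ∈ formsIn n m Q :=
  const_mem hPQ (map_mem_onlyIf (intParam m) h)

theorem formsIn_mono {n m : ℕ} {P Q : ℕ → Prop} (hPQ : ∀ k, P k → Q k) {α : Forms n m}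
    (h : α ∈ formsIn n m P) : α ∈ formsIn n m Q :=
  mem_formsIn.2 fun k hk => mem_formsIn.1 h k fun hP => hk (hPQ k hP)

theorem smul_mem_formsIn {n m : ℕ} {P : ℕ → Prop} (c : ℝ) {α : Forms n m}
    (h : α ∈ formsIn n m P) : c • α ∈ formsIn n m P :=
  mem_formsIn.2 fun k hk => by rw [Pi.smul_apply, mem_formsIn.1 h k hk, smul_zero]

theorem dForms_intConst {n m : ℕ} (z : ℤ) : dForms n m (intConst n m z) = 0 :=
  dForms_const _

theorem keep_const {n m : ℕ} {P : ℕ → Prop} [DecidablePred P] (hP : P 0) (r : Param m) :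
    keep n m P (const n m r) = const n m r := by
  funext k
  match k with
  | 0 => simp [keep, hP]
  | k + 1 => by_cases h : P (k + 1) <;> simp [keep, h, const]

theorem keep_const_eq_zero {n m : ℕ} {P : ℕ → Prop} [DecidablePred P] (hP : ¬ P 0) (r : Param m) :
    keep n m P (const n m r) = 0 := by
  funext k
  match k with
  | 0 => simp [keep, hP]
  | k + 1 => by_cases h : P (k + 1) <;> simp [keep, h, const]

theorem dForms_apply_succ {n m : ℕ} (α : Forms n m) (k : ℕ) :
    dForms n m α (k + 1) = dForm n m k (α k) := rfl

/-- The de Rham differential vanishes twice also after truncation to degrees `≤ p`. -/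
theorem keep_dForms_keep_dForms {n m p : ℕ} (α : Forms n m) :
    keep n m (· ≤ p) (dForms n m (keep n m (· ≤ p) (dForms n m α))) = 0 := by
  funext k
  by_cases hk : k ≤ p
  · match k with
    | 0 => simp [keep, dForms]
    | k + 1 =>
      have h1 := congrFun (dForms_dForms α) (k + 1)
      have h2 : k ≤ p := by omega
      simpa [keep, hk, h2, dForms_apply_succ] using h1
  · simp [keep, hk]

theorem dForms_keep_eq_keep_dForms {n m p : ℕ} (α : Forms n m) :
    dForms n m (keep n m (· = p) (keep n m (· ≤ p) (dForms n m α))) = 0 := by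
  funext k
  match k with
  | 0 => rfl
  | k + 1 =>
    by_cases hk : k = p
    · have h1 := congrFun (dForms_dForms α) (k + 1)
      have h2 : k ≤ p := by omega
      simpa [keep, hk, h2, dForms_apply_succ] using h1
    · simp [keep, hk, dForms_apply_succ]

theorem dForms_keep_const {n m : ℕ} (P : ℕ → Prop) [DecidablePred P] (r : Param m) :
    dForms n m (keep n m P (const n m r)) = 0 := by
  by_cases hP : P 0
  · rw [keep_const hP, dForms_const]
  · rw [keep_const_eq_zero hP, map_zero]

theorem dForms_keep_intConst {n m : ℕ} (P : ℕ → Prop) [DecidablePred P] (z : ℤ) :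
    dForms n m (keep n m P (intConst n m z)) = 0 :=
  dForms_keep_const P _

theorem keep_keep_le {n m p : ℕ} (α : Forms n m) :
    keep n m (· = p) (keep n m (· ≤ p) α) = keep n m (· = p) α := by
  funext k
  by_cases hk : k = p
  · simp [keep, hk]
  · simp [keep, hk]

/-! ### The theories on coordinate patches -/

section Theories

variable {σ : Signature} {n : ℕ} (V : Patch σ n) (m p : ℕ) (κ : ℝ)

/-- Families, parametrised by `ℝᵐ`, of elements of `p`-form Maxwell theory. An element `(z, A, β)`
consists of
* an integer `z`, in degree `-p-1`,
* forms `A` of degrees `k ≤ p`, where a `k`-form has degree `k - p`,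
* forms `β` of degrees `k ≥ n-p`, where a `k`-form has degree `k - (n-p) + 1`. -/
def maxwellPatch : DiffGroup where
  carrier := ℤ × Forms n m × Forms n m
  diff := AddMonoidHom.mk' (fun x =>
    (0,
      keep n m (· ≤ p) (dForms n m x.2.1) + intConst n m x.1,
      κ • dForms n m (V.star m (dForms n m (keep n m (· = p) x.2.1))) + dForms n m x.2.2))
    (by
      intro x y
      ext1
      · simp
      ext1
      · simp only [Prod.fst_add, Prod.snd_add, map_add]; abel
      · simp only [Prod.snd_add, map_add, Prod.fst_add, smul_add]; abel)
  degree i := (onlyIf ℤ (i = -p - 1)).prod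
    ((formsIn n m fun k => (k : ℤ) = i + p ∧ k ≤ p).prod
      (formsIn n m fun k => (k : ℤ) = i + n - p - 1 ∧ n ≤ k + p))
  diff_mem := by
    rintro i ⟨z, A, β⟩ ⟨hz, hA, hβ⟩
    refine ⟨zero_mem _, add_mem ?_ ?_, add_mem (smul_mem_formsIn κ ?_) ?_⟩
    · exact keep_mem (P := fun k => (k : ℤ) = i + 1 + p) (fun k h h' => ⟨h, h'⟩)
        (dForms_mem (fun k h => by push_cast; omega) hA)
    · exact intConst_mem (fun h => by push_cast; omega) hz
    · have h1 : keep n m (· = p) A ∈ formsIn n m fun k => i = 0 ∧ k = p :=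
        keep_mem (fun k h h' => by omega) hA
      have h2 := dForms_mem (Q := fun k => i = 0 ∧ k = p + 1) (fun k h => by omega) h1
      have h3 := star_mem V (Q := fun k => i = 0 ∧ k + (p + 1) = n) (fun k l hkl h => by omega) h2
      exact dForms_mem (fun k h => by push_cast; omega) h3
    · exact dForms_mem (fun k h => by push_cast; omega) hβ
  diff_diff := by
    rintro ⟨z, A, β⟩
    ext1
    · rfl
    ext1
    · simp [keep_dForms_keep_dForms, dForms_intConst]
    · simp [dForms_dForms, dForms_keep_eq_keep_dForms, dForms_keep_intConst]

/-- Families, parametrised by `ℝᵐ`, of elements of the second presentation of `p`-form Maxwell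
theory, where `p + 2 ≤ n`. With `q = n-p-2`, an element `(z, A, r, C, ρ)` consists of
* an integer `z`, in degree `-p-1`,
* forms `A` of degrees `k ≤ p`, where a `k`-form has degree `k - p`,
* a function `r` that is constant along `ℝⁿ`, in degree `-q-1`,
* forms `C` of degrees `k ≤ q`, where a `k`-form has degree `k - q`,
* a `q+1`-form `ρ`, in degree `1`. -/
def maxwellTildePatch (hp : p + 2 ≤ n) : DiffGroup where
  carrier := ℤ × Forms n m × Param m × Forms n m × Forms n m
  diff := AddMonoidHom.mk' (fun x =>
    (0,
      keep n m (· ≤ p) (dForms n m x.2.1) + intConst n m x.1,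
      0,
      keep n m (· ≤ n - p - 2) (dForms n m x.2.2.2.1) + const n m x.2.2.1,
      V.star m (dForms n m (keep n m (· = p) x.2.1)) +
        (-κ) • dForms n m (keep n m (· = n - p - 2) x.2.2.2.1)))
    (by
      intro x y
      ext1
      · simp
      ext1
      · simp only [Prod.fst_add, Prod.snd_add, map_add]; abel
      ext1
      · simp
      ext1
      · simp only [Prod.snd_add, map_add, Prod.fst_add]; abel
      · simp only [Prod.snd_add, map_add, Prod.fst_add, smul_add]; abel)
  degree i := (onlyIf ℤ (i = -p - 1)).prod
    ((formsIn n m fun k => (k : ℤ) = i + p ∧ k ≤ p).prod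
      ((onlyIf (Param m) (i = -(n - p - 2 : ℕ) - 1)).prod
        ((formsIn n m fun k => (k : ℤ) = i + (n - p - 2 : ℕ) ∧ k ≤ n - p - 2).prod
          (formsIn n m fun k => i = 1 ∧ k = n - p - 1))))
  diff_mem := by
    rintro i ⟨z, A, r, C, ρ⟩ ⟨hz, hA, hr, hC, hρ⟩
    refine ⟨zero_mem _, add_mem ?_ ?_, zero_mem _, add_mem ?_ ?_,
      add_mem ?_ (smul_mem_formsIn (-κ) ?_)⟩
    · exact keep_mem (P := fun k => (k : ℤ) = i + 1 + p) (fun k h h' => ⟨h, h'⟩)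
        (dForms_mem (fun k h => by push_cast; omega) hA)
    · exact intConst_mem (fun h => by push_cast; omega) hz
    · exact keep_mem (P := fun k => (k : ℤ) = i + 1 + (n - p - 2 : ℕ)) (fun k h h' => ⟨h, h'⟩)
        (dForms_mem (fun k h => by push_cast; omega) hC)
    · exact const_mem (fun h => by push_cast; omega) hr
    · have h1 : keep n m (· = p) A ∈ formsIn n m fun k => i = 0 ∧ k = p :=
        keep_mem (fun k h h' => by omega) hA
      have h2 := dForms_mem (Q := fun k => i = 0 ∧ k = p + 1) (fun k h => by omega) h1
      exact star_mem V (fun k l hkl h => by omega) h2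
    · have h1 : keep n m (· = n - p - 2) C ∈ formsIn n m fun k => i = 0 ∧ k = n - p - 2 :=
        keep_mem (fun k h h' => by omega) hC
      exact dForms_mem (fun k h => by omega) h1
  diff_diff := by
    rintro ⟨z, A, r, C, ρ⟩
    ext1
    · rfl
    ext1
    · simp [keep_dForms_keep_dForms, dForms_intConst]
    ext1
    · rfl
    ext1
    · simp [keep_dForms_keep_dForms, dForms_const]
    · simp [dForms_keep_eq_keep_dForms, dForms_keep_intConst, dForms_keep_const]

/-- The signs make row 1 and row 2 of the coupled theory anticommute. -/
theorem keep_alternate_dForms (α : Forms n m) :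
    keep n m (· ≤ p) (dForms n m (keep n m (· ≤ p) (alternate n m α))) +
      keep n m (· ≤ p) (alternate n m (dForms n m α)) = 0 := by
  funext k
  by_cases hk : k ≤ p
  · match k with
    | 0 => simp [keep, dForms, alternate]
    | k + 1 =>
      have h2 : k ≤ p := by omega
      simp [keep, hk, h2, dForms_apply_succ, alternate, pow_succ]
      rw [← add_smul, add_neg_cancel, zero_smul]
  · simp [keep, hk]

theorem keep_alternate_intConst (z : ℤ) :
    keep n m (· ≤ p) (alternate n m (intConst n m z)) = intConst n m z := by
  have h : alternate n m (intConst n m z) = intConst n m z := by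
    funext k
    match k with
    | 0 => simp [alternate]
    | k + 1 => exact smul_zero (A := Form n m (k + 1)) ((-1 : ℝ) ^ (k + 1))
  rw [h]
  exact keep_const (Nat.zero_le p) _

theorem dForms_keep_alternate (α : Forms n m) :
    dForms n m (keep n m (· = p) (keep n m (· ≤ p) (alternate n m α))) =
      ((-1 : ℝ) ^ p) • keep n m (· = p + 1) (dForms n m α) := by
  funext k
  match k with
  | 0 => simp [keep, dForms]
  | k + 1 =>
    by_cases hk : k = p
    · subst hk
      simp [keep, dForms_apply_succ, alternate]
    · simp [keep, hk, dForms_apply_succ]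

theorem keep_succ_intConst (z : ℤ) : keep n m (· = p + 1) (intConst n m z) = 0 :=
  keep_const_eq_zero (by simp) _

/-- Families, parametrised by `ℝᵐ`, of elements of `p`-form Maxwell theory coupled to a topological
`BF` theory, where `p + 2 ≤ n`. With `q = n-p-2`, an element `(y, B, z, A, ρ, r, C, w, E)` consists
of
* an integer `y`, in degree `-p-2`, and forms `B` of all degrees `k`, where a `k`-form has degree
  `k - (p+1)` (the first row),
* an integer `z`, in degree `-p-1`, and forms `A` of degrees `k ≤ p`, where a `k`-form has degree
  `k - p` (the second row),
* a `q+1`-form `ρ`, in degree `1`,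
* a function `r` that is constant along `ℝⁿ`, in degree `-q-1`, and forms `C` of degrees `k ≤ q`,
  where a `k`-form has degree `k - q` (the third row),
* an integer `w`, in degree `-q-1`, and forms `E` of all degrees `k`, where a `k`-form has degree
  `k - q` (the fourth row). -/
def maxwellBFPatch (hp : p + 2 ≤ n) : DiffGroup where
  carrier := ℤ × Forms n m × ℤ × Forms n m × Forms n m × Param m × Forms n m × ℤ × Forms n m
  diff := AddMonoidHom.mk' (fun x =>
    let y := x.1
    let B := x.2.1
    let z := x.2.2.1
    let A := x.2.2.2.1
    let r := x.2.2.2.2.2.1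
    let C := x.2.2.2.2.2.2.1
    let w := x.2.2.2.2.2.2.2.1
    let E := x.2.2.2.2.2.2.2.2
    (0,
      dForms n m B + intConst n m y,
      -y,
      keep n m (· ≤ p) (dForms n m A) + intConst n m z + keep n m (· ≤ p) (alternate n m B),
      V.star m (dForms n m (keep n m (· = p) A)) +
        (-κ) • dForms n m (keep n m (· = n - p - 2) C) +
        ((-1 : ℝ) ^ (p + 1)) • V.star m (keep n m (· = p + 1) B),
      0,
      keep n m (· ≤ n - p - 2) (dForms n m C) + const n m r + intConst n m (-w),
      0,
      dForms n m E + const n m r + intConst n m w))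
    (by
      intro x x'
      refine Prod.ext ?_ (Prod.ext ?_ (Prod.ext ?_ (Prod.ext ?_ (Prod.ext ?_ (Prod.ext ?_
        (Prod.ext ?_ (Prod.ext ?_ ?_))))))) <;>
      simp only [Prod.fst_add, Prod.snd_add, map_add, smul_add, neg_add, add_zero] <;> abel)
  degree i := (onlyIf ℤ (i = -p - 2)).prod <|
    (formsIn n m fun k => (k : ℤ) = i + p + 1).prod <|
    (onlyIf ℤ (i = -p - 1)).prod <|
    (formsIn n m fun k => (k : ℤ) = i + p ∧ k ≤ p).prod <|
    (formsIn n m fun k => i = 1 ∧ k = n - p - 1).prod <|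
    (onlyIf (Param m) (i = -(n - p - 2 : ℕ) - 1)).prod <|
    (formsIn n m fun k => (k : ℤ) = i + (n - p - 2 : ℕ) ∧ k ≤ n - p - 2).prod <|
    (onlyIf ℤ (i = -(n - p - 2 : ℕ) - 1)).prod <|
    formsIn n m fun k => (k : ℤ) = i + (n - p - 2 : ℕ)
  diff_mem := by
    rintro i ⟨y, B, z, A, ρ, r, C, w, E⟩ ⟨hy, hB, hz, hA, hρ, hr, hC, hw, hE⟩
    refine ⟨zero_mem _, add_mem ?_ ?_, ?_, add_mem (add_mem ?_ ?_) ?_,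
      add_mem (add_mem ?_ (smul_mem_formsIn (-κ) ?_)) (smul_mem_formsIn _ ?_), zero_mem _,
      add_mem (add_mem ?_ ?_) ?_, zero_mem _, add_mem (add_mem ?_ ?_) ?_⟩
    · exact dForms_mem (fun k h => by push_cast; omega) hB
    · exact intConst_mem (fun h => by push_cast; omega) hy
    · exact mem_onlyIf.2 fun h => neg_eq_zero.2 (mem_onlyIf.1 hy fun h' => h (by omega))
    · exact keep_mem (P := fun k => (k : ℤ) = i + 1 + p) (fun k h h' => ⟨h, h'⟩)
        (dForms_mem (fun k h => by push_cast; omega) hA)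
    · exact intConst_mem (fun h => by push_cast; omega) hz
    · exact keep_mem (P := fun k => (k : ℤ) = i + 1 + p) (fun k h h' => ⟨h, h'⟩)
        (alternate_mem (fun k h => by omega) hB)
    · have h1 : keep n m (· = p) A ∈ formsIn n m fun k => i = 0 ∧ k = p :=
        keep_mem (fun k h h' => by omega) hA
      have h2 := dForms_mem (Q := fun k => i = 0 ∧ k = p + 1) (fun k h => by omega) h1
      exact star_mem V (fun k l hkl h => by omega) h2
    · have h1 : keep n m (· = n - p - 2) C ∈ formsIn n m fun k => i = 0 ∧ k = n - p - 2 :=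
        keep_mem (fun k h h' => by omega) hC
      exact dForms_mem (fun k h => by omega) h1
    · have h1 : keep n m (· = p + 1) B ∈ formsIn n m fun k => i = 0 ∧ k = p + 1 :=
        keep_mem (fun k h h' => by omega) hB
      exact star_mem V (fun k l hkl h => by omega) h1
    · exact keep_mem (P := fun k => (k : ℤ) = i + 1 + (n - p - 2 : ℕ)) (fun k h h' => ⟨h, h'⟩)
        (dForms_mem (fun k h => by push_cast; omega) hC)
    · exact const_mem (fun h => by push_cast; omega) hr
    · exact intConst_mem (fun h => by push_cast; omega) (neg_mem hw)
    · exact dForms_mem (fun k h => by push_cast; omega) hE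
    · exact const_mem (fun h => by push_cast; omega) hr
    · exact intConst_mem (fun h => by push_cast; omega) hw
  diff_diff := by
    rintro ⟨y, B, z, A, ρ, r, C, w, E⟩
    refine Prod.ext ?_ (Prod.ext ?_ (Prod.ext ?_ (Prod.ext ?_ (Prod.ext ?_ (Prod.ext ?_
      (Prod.ext ?_ (Prod.ext ?_ ?_)))))))
    · rfl
    · change dForms n m (dForms n m B + intConst n m y) + intConst n m 0 = 0
      simp only [map_add, dForms_dForms, dForms_intConst, map_zero, add_zero]
    · exact neg_zero
    · change keep n m (· ≤ p) (dForms n m (keep n m (· ≤ p) (dForms n m A) + intConst n m z +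
          keep n m (· ≤ p) (alternate n m B))) + intConst n m (-y) +
          keep n m (· ≤ p) (alternate n m (dForms n m B + intConst n m y)) = 0
      have h1 := keep_alternate_dForms m p B
      have h2 := (intConst n m).map_add (-y) y
      rw [neg_add_cancel, map_zero] at h2
      simp only [map_add, keep_dForms_keep_dForms, dForms_intConst, zero_add, add_zero,
        keep_alternate_intConst]
      rw [add_assoc, add_left_comm (intConst n m (-y)), ← h2, add_zero, h1]
    · change V.star m (dForms n m (keep n m (· = p) (keep n m (· ≤ p) (dForms n m A) +
          intConst n m z + keep n m (· ≤ p) (alternate n m B)))) +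
        (-κ) • dForms n m (keep n m (· = n - p - 2) (keep n m (· ≤ n - p - 2) (dForms n m C) +
          const n m r + intConst n m (-w))) +
        ((-1 : ℝ) ^ (p + 1)) • V.star m (keep n m (· = p + 1) (dForms n m B + intConst n m y)) = 0
      simp only [map_add, dForms_keep_eq_keep_dForms, dForms_keep_intConst, dForms_keep_const,
        zero_add, add_zero, smul_zero, dForms_keep_alternate, keep_succ_intConst,
        map_smul]
      rw [← add_smul, pow_succ, mul_neg_one, add_neg_cancel, zero_smul]
    · rfl
    · change keep n m (· ≤ n - p - 2) (dForms n m (keep n m (· ≤ n - p - 2) (dForms n m C) +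
          const n m r + intConst n m (-w))) + const n m 0 + intConst n m (-0) = 0
      simp only [map_add, keep_dForms_keep_dForms, dForms_const, dForms_intConst, map_zero,
        neg_zero, add_zero]
    · rfl
    · change dForms n m (dForms n m E + const n m r + intConst n m w) + const n m 0 +
          intConst n m 0 = 0
      simp only [map_add, dForms_dForms, dForms_const, dForms_intConst, map_zero, add_zero]

end Theories

/-! ### Functoriality of the theories -/

/-- Maps of forms and of functions that commute with the operations that enter the theories. -/
structure Transport {σ : Signature} {n : ℕ} (V W : Patch σ n) (m m' : ℕ) where
  form : Forms n m' →+ Forms n m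
  param : Param m' →+ Param m
  form_mem : ∀ (P : ℕ → Prop) (α : Forms n m'), α ∈ formsIn n m' P → form α ∈ formsIn n m P
  form_smul : ∀ (c : ℝ) (α : Forms n m'), form (c • α) = c • form α
  form_dForms : ∀ α, form (dForms n m' α) = dForms n m (form α)
  form_keep : ∀ (P : ℕ → Prop) [DecidablePred P] (α : Forms n m'),
    form (keep n m' P α) = keep n m P (form α)
  form_alternate : ∀ α, form (alternate n m' α) = alternate n m (form α)
  form_star : ∀ α, form (W.star m' α) = V.star m (form α)
  form_const : ∀ r, form (const n m' r) = const n m (param r)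
  form_intConst : ∀ z, form (intConst n m' z) = intConst n m z

/-- The pullback along a morphism of coordinate patches and a map of parameter spaces. -/
def transport {σ : Signature} {n : ℕ} {V W : PatchCat σ n} (f : V ⟶ W) {X Y : CartSp}
    (g : X ⟶ Y) : Transport (σ := σ) (n := n) V W X.dim Y.dim where
  form := (pullback (Patch.contDiff_toFun f) g.2).toAddMonoidHom
  param := (pullbackParam g.2).toAddMonoidHom
  form_mem _ _ h := pullback_mem_formsIn (Patch.contDiff_toFun f) g.2 h
  form_smul c α := map_smul (pullback (Patch.contDiff_toFun f) g.2) c α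
  form_dForms α := pullback_dForms (Patch.contDiff_toFun f) g.2 α
  form_keep P _ α := pullback_keep (Patch.contDiff_toFun f) g.2 P α
  form_alternate α := pullback_alternate (Patch.contDiff_toFun f) g.2 α
  form_star α := pullback_star (Patch.contDiff_toFun f) g.2 (Patch.isOrientedIsometryOn f) α
  form_const r := pullback_const (Patch.contDiff_toFun f) g.2 r
  form_intConst z := pullback_intConst (Patch.contDiff_toFun f) g.2 z

section Functors

variable {σ : Signature} {n : ℕ}

theorem transport_form_id (V : PatchCat σ n) (X : CartSp) :
    (transport (𝟙 V) (𝟙 X)).form = AddMonoidHom.id _ :=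
  AddMonoidHom.ext fun α => pullback_id α

theorem transport_param_id (V : PatchCat σ n) (X : CartSp) :
    (transport (𝟙 V) (𝟙 X)).param = AddMonoidHom.id _ := rfl

theorem transport_form_comp {U V W : PatchCat σ n} (f' : U ⟶ V) (f : V ⟶ W) {X Y Z : CartSp}
    (g' : X ⟶ Y) (g : Y ⟶ Z) :
    (transport (f' ≫ f) (g' ≫ g)).form = (transport f' g').form.comp (transport f g).form :=
  AddMonoidHom.ext fun α =>
    (pullback_pullback (Patch.contDiff_toFun f) g.2 (Patch.contDiff_toFun f') g'.2 α).symm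

theorem transport_param_comp {U V W : PatchCat σ n} (f' : U ⟶ V) (f : V ⟶ W) {X Y Z : CartSp}
    (g' : X ⟶ Y) (g : Y ⟶ Z) :
    (transport (f' ≫ f) (g' ≫ g)).param = (transport f' g').param.comp (transport f g).param := rfl

section

variable {V W : Patch σ n} {m m' : ℕ} (T : Transport V W m m') (p : ℕ) (κ : ℝ)

/-- The map of `p`-form Maxwell theories given by pullback. -/
def Transport.maxwell : maxwellPatch W m' p κ ⟶ maxwellPatch V m p κ where
  map := (AddMonoidHom.id ℤ).prodMap (T.form.prodMap T.form)
  map_mem _ _ h := ⟨h.1, T.form_mem _ _ h.2.1, T.form_mem _ _ h.2.2⟩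
  map_diff := by
    rintro ⟨z, A, β⟩
    refine Prod.ext rfl (Prod.ext ?_ ?_)
    · change T.form (keep n m' (· ≤ p) (dForms n m' A) + intConst n m' z) =
        keep n m (· ≤ p) (dForms n m (T.form A)) + intConst n m z
      rw [map_add, T.form_keep, T.form_dForms, T.form_intConst]
    · change T.form (κ • dForms n m' (W.star m' (dForms n m' (keep n m' (· = p) A))) +
          dForms n m' β) =
        κ • dForms n m (V.star m (dForms n m (keep n m (· = p) (T.form A)))) +
          dForms n m (T.form β)
      rw [map_add, T.form_smul, T.form_dForms, T.form_star, T.form_dForms, T.form_keep,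
        T.form_dForms]

variable (hp : p + 2 ≤ n)

/-- The map of second presentations of `p`-form Maxwell theories given by pullback. -/
def Transport.maxwellTilde : maxwellTildePatch W m' p κ hp ⟶ maxwellTildePatch V m p κ hp where
  map := (AddMonoidHom.id ℤ).prodMap <| T.form.prodMap <| T.param.prodMap <| T.form.prodMap T.form
  map_mem _ _ h :=
    ⟨h.1, T.form_mem _ _ h.2.1, map_mem_onlyIf T.param h.2.2.1, T.form_mem _ _ h.2.2.2.1,
      T.form_mem _ _ h.2.2.2.2⟩
  map_diff := by
    rintro ⟨z, A, r, C, ρ⟩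
    refine Prod.ext rfl (Prod.ext ?_ (Prod.ext (map_zero T.param) (Prod.ext ?_ ?_)))
    · change T.form (keep n m' (· ≤ p) (dForms n m' A) + intConst n m' z) =
        keep n m (· ≤ p) (dForms n m (T.form A)) + intConst n m z
      rw [map_add, T.form_keep, T.form_dForms, T.form_intConst]
    · change T.form (keep n m' (· ≤ n - p - 2) (dForms n m' C) + const n m' r) =
        keep n m (· ≤ n - p - 2) (dForms n m (T.form C)) + const n m (T.param r)
      rw [map_add, T.form_keep, T.form_dForms, T.form_const]
    · change T.form (W.star m' (dForms n m' (keep n m' (· = p) A)) +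
          (-κ) • dForms n m' (keep n m' (· = n - p - 2) C)) =
        V.star m (dForms n m (keep n m (· = p) (T.form A))) +
          (-κ) • dForms n m (keep n m (· = n - p - 2) (T.form C))
      rw [map_add, T.form_star, T.form_dForms, T.form_keep, T.form_smul, T.form_dForms,
        T.form_keep]

/-- The map of coupled theories given by pullback. -/
def Transport.maxwellBF : maxwellBFPatch W m' p κ hp ⟶ maxwellBFPatch V m p κ hp where
  map := (AddMonoidHom.id ℤ).prodMap <| T.form.prodMap <| (AddMonoidHom.id ℤ).prodMap <|
    T.form.prodMap <| T.form.prodMap <| T.param.prodMap <| T.form.prodMap <|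
    (AddMonoidHom.id ℤ).prodMap T.form
  map_mem _ _ h :=
    ⟨h.1, T.form_mem _ _ h.2.1, h.2.2.1, T.form_mem _ _ h.2.2.2.1, T.form_mem _ _ h.2.2.2.2.1,
      map_mem_onlyIf T.param h.2.2.2.2.2.1, T.form_mem _ _ h.2.2.2.2.2.2.1, h.2.2.2.2.2.2.2.1,
      T.form_mem _ _ h.2.2.2.2.2.2.2.2⟩
  map_diff := by
    rintro ⟨y, B, z, A, ρ, r, C, w, E⟩
    refine Prod.ext rfl (Prod.ext ?_ (Prod.ext rfl (Prod.ext ?_ (Prod.ext ?_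
      (Prod.ext (map_zero T.param) (Prod.ext ?_ (Prod.ext rfl ?_)))))))
    · change T.form (dForms n m' B + intConst n m' y) = dForms n m (T.form B) + intConst n m y
      rw [map_add, T.form_dForms, T.form_intConst]
    · change T.form (keep n m' (· ≤ p) (dForms n m' A) + intConst n m' z +
          keep n m' (· ≤ p) (alternate n m' B)) =
        keep n m (· ≤ p) (dForms n m (T.form A)) + intConst n m z +
          keep n m (· ≤ p) (alternate n m (T.form B))
      rw [map_add, map_add, T.form_keep, T.form_dForms, T.form_intConst, T.form_keep,
        T.form_alternate]
    · change T.form (W.star m' (dForms n m' (keep n m' (· = p) A)) +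
          (-κ) • dForms n m' (keep n m' (· = n - p - 2) C) +
          ((-1 : ℝ) ^ (p + 1)) • W.star m' (keep n m' (· = p + 1) B)) =
        V.star m (dForms n m (keep n m (· = p) (T.form A))) +
          (-κ) • dForms n m (keep n m (· = n - p - 2) (T.form C)) +
          ((-1 : ℝ) ^ (p + 1)) • V.star m (keep n m (· = p + 1) (T.form B))
      rw [map_add, map_add, T.form_star, T.form_dForms, T.form_keep, T.form_smul, T.form_dForms,
        T.form_keep, T.form_smul, T.form_star, T.form_keep]
    · change T.form (keep n m' (· ≤ n - p - 2) (dForms n m' C) + const n m' r +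
          intConst n m' (-w)) =
        keep n m (· ≤ n - p - 2) (dForms n m (T.form C)) + const n m (T.param r) +
          intConst n m (-w)
      rw [map_add, map_add, T.form_keep, T.form_dForms, T.form_const, T.form_intConst]
    · change T.form (dForms n m' E + const n m' r + intConst n m' w) =
        dForms n m (T.form E) + const n m (T.param r) + intConst n m w
      rw [map_add, map_add, T.form_dForms, T.form_const, T.form_intConst]

end

/-- `p`-form Maxwell theory on coordinate patches, with smooth families parametrised by Cartesian
spaces. -/
def maxwellDiff (σ : Signature) (n p : ℕ) (κ : ℝ) : (PatchCat σ n)ᵒᵖ × CartSpᵒᵖ ⥤ DiffGroup where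
  obj VX := maxwellPatch (σ := σ) (n := n) VX.1.unop VX.2.unop.dim p κ
  map u := (transport u.1.unop u.2.unop).maxwell p κ
  map_id VX := DiffGroup.Hom.ext <| by
    change (AddMonoidHom.id ℤ).prodMap ((transport (𝟙 VX.1.unop) (𝟙 VX.2.unop)).form.prodMap
      (transport (𝟙 VX.1.unop) (𝟙 VX.2.unop)).form) = _
    rw [transport_form_id]
    rfl
  map_comp u v := DiffGroup.Hom.ext <| by
    change (AddMonoidHom.id ℤ).prodMap
      ((transport (v.1.unop ≫ u.1.unop) (v.2.unop ≫ u.2.unop)).form.prodMap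
        (transport (v.1.unop ≫ u.1.unop) (v.2.unop ≫ u.2.unop)).form) = _
    rw [transport_form_comp]
    rfl

/-- The second presentation of `p`-form Maxwell theory on coordinate patches, with smooth families
parametrised by Cartesian spaces. -/
def maxwellTildeDiff (σ : Signature) (n p : ℕ) (κ : ℝ) (hp : p + 2 ≤ n) :
    (PatchCat σ n)ᵒᵖ × CartSpᵒᵖ ⥤ DiffGroup where
  obj VX := maxwellTildePatch (σ := σ) (n := n) VX.1.unop VX.2.unop.dim p κ hp
  map u := (transport u.1.unop u.2.unop).maxwellTilde p κ hp
  map_id VX := DiffGroup.Hom.ext <| by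
    change (AddMonoidHom.id ℤ).prodMap ((transport (𝟙 VX.1.unop) (𝟙 VX.2.unop)).form.prodMap
      ((transport (𝟙 VX.1.unop) (𝟙 VX.2.unop)).param.prodMap
      ((transport (𝟙 VX.1.unop) (𝟙 VX.2.unop)).form.prodMap
      (transport (𝟙 VX.1.unop) (𝟙 VX.2.unop)).form))) = _
    rw [transport_form_id, transport_param_id]
    rfl
  map_comp u v := DiffGroup.Hom.ext <| by
    change (AddMonoidHom.id ℤ).prodMap
      ((transport (v.1.unop ≫ u.1.unop) (v.2.unop ≫ u.2.unop)).form.prodMap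
      ((transport (v.1.unop ≫ u.1.unop) (v.2.unop ≫ u.2.unop)).param.prodMap
      ((transport (v.1.unop ≫ u.1.unop) (v.2.unop ≫ u.2.unop)).form.prodMap
        (transport (v.1.unop ≫ u.1.unop) (v.2.unop ≫ u.2.unop)).form))) = _
    rw [transport_form_comp, transport_param_comp]
    rfl

/-- `p`-form Maxwell theory coupled to a topological `BF` theory on coordinate patches, with smooth
families parametrised by Cartesian spaces. -/
def maxwellBFDiff (σ : Signature) (n p : ℕ) (κ : ℝ) (hp : p + 2 ≤ n) :
    (PatchCat σ n)ᵒᵖ × CartSpᵒᵖ ⥤ DiffGroup where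
  obj VX := maxwellBFPatch (σ := σ) (n := n) VX.1.unop VX.2.unop.dim p κ hp
  map u := (transport u.1.unop u.2.unop).maxwellBF p κ hp
  map_id VX := DiffGroup.Hom.ext <| by
    have h := transport_form_id VX.1.unop VX.2.unop
    have h' := transport_param_id VX.1.unop VX.2.unop
    change (AddMonoidHom.id ℤ).prodMap ((transport (𝟙 VX.1.unop) (𝟙 VX.2.unop)).form.prodMap
      ((AddMonoidHom.id ℤ).prodMap ((transport (𝟙 VX.1.unop) (𝟙 VX.2.unop)).form.prodMap
      ((transport (𝟙 VX.1.unop) (𝟙 VX.2.unop)).form.prodMap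
      ((transport (𝟙 VX.1.unop) (𝟙 VX.2.unop)).param.prodMap
      ((transport (𝟙 VX.1.unop) (𝟙 VX.2.unop)).form.prodMap
      ((AddMonoidHom.id ℤ).prodMap (transport (𝟙 VX.1.unop) (𝟙 VX.2.unop)).form))))))) = _
    rw [h, h']
    rfl
  map_comp u v := DiffGroup.Hom.ext <| by
    have h := transport_form_comp v.1.unop u.1.unop v.2.unop u.2.unop
    have h' := transport_param_comp v.1.unop u.1.unop v.2.unop u.2.unop
    change (AddMonoidHom.id ℤ).prodMap
      ((transport (v.1.unop ≫ u.1.unop) (v.2.unop ≫ u.2.unop)).form.prodMap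
      ((AddMonoidHom.id ℤ).prodMap
      ((transport (v.1.unop ≫ u.1.unop) (v.2.unop ≫ u.2.unop)).form.prodMap
      ((transport (v.1.unop ≫ u.1.unop) (v.2.unop ≫ u.2.unop)).form.prodMap
      ((transport (v.1.unop ≫ u.1.unop) (v.2.unop ≫ u.2.unop)).param.prodMap
      ((transport (v.1.unop ≫ u.1.unop) (v.2.unop ≫ u.2.unop)).form.prodMap
      ((AddMonoidHom.id ℤ).prodMap
        (transport (v.1.unop ≫ u.1.unop) (v.2.unop ≫ u.2.unop)).form))))))) = _
    rw [h, h']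
    rfl

end Functors

/-! ### Smooth rings -/

/-- The `i`-th coordinate function `ℝᵐ → ℝ`. -/
def coordFn {m : ℕ} (i : Fin m) : CartSp.mk m ⟶ CartSp.mk 1 :=
  ⟨fun x _ => x i, contDiff_pi.2 fun _ => contDiff_apply ℝ ℝ i⟩

/-- A `C^∞`-ring: a functor from Cartesian spaces to sets that preserves finite products, that is,
such that `F ℝᵐ → (F ℝ)ᵐ` is bijective for all `m`. -/
def IsSmoothRing : ObjectProperty (CartSp ⥤ Type) := fun F =>
  ∀ m : ℕ, Function.Bijective fun (x : F.obj ⟨m⟩) (i : Fin m) => F.map (coordFn i) x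

/-- The category of `C^∞`-rings. -/
abbrev SmoothRing : Type 1 := IsSmoothRing.FullSubcategory

theorem isSmoothRing_coyoneda (X : CartSpᵒᵖ) : IsSmoothRing (coyoneda.obj X) := by
  intro m
  constructor
  · intro f g h
    refine Subtype.ext (funext fun x => funext fun i => ?_)
    exact congrFun (congrFun (congrArg Subtype.val (congrFun h i)) x) 0
  · intro f
    refine ⟨⟨fun x i => (f i).1 x 0, contDiff_pi.2 fun i => contDiff_pi.1 (f i).2 0⟩, ?_⟩
    refine funext fun i => Subtype.ext (funext fun x => funext fun a => ?_)
    rw [Subsingleton.elim a 0]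
    rfl

/-- The `C^∞`-ring of smooth functions on a Cartesian space. -/
def functions : CartSpᵒᵖ ⥤ SmoothRing :=
  IsSmoothRing.lift coyoneda isSmoothRing_coyoneda

/-- Smooth maps from the punctured line to `ℝᵐ`. -/
def PuncturedMap (m : ℕ) : Type :=
  {f : {x : Coord 1 // x 0 ≠ 0} → Coord m //
    ContDiffOn ℝ ∞ (Function.extend Subtype.val f 0) {x | x 0 ≠ 0}}

theorem extend_comp {m m' : ℕ} (g : Coord m → Coord m') (f : {x : Coord 1 // x 0 ≠ 0} → Coord m) :
    Set.EqOn (Function.extend Subtype.val (g ∘ f) 0) (g ∘ Function.extend Subtype.val f 0)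
      {x | x 0 ≠ 0} := by
  intro x hx
  have h := Subtype.val_injective (p := fun x : Coord 1 => x 0 ≠ 0)
  have h1 := h.extend_apply (g ∘ f) 0 ⟨x, hx⟩
  have h2 := h.extend_apply f 0 ⟨x, hx⟩
  simp only [Function.comp_apply] at h1 ⊢
  rw [h1, h2]

/-- The functor `X ↦ C^∞(ℝ ∖ 0, X)`. -/
def puncturedFunctor : CartSp ⥤ Type where
  obj X := PuncturedMap X.dim
  map g := TypeCat.ofHom fun f =>
    ⟨g.1 ∘ f.1, (g.2.comp_contDiffOn f.2).congr (extend_comp g.1 f.1)⟩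

theorem isSmoothRing_punctured : IsSmoothRing puncturedFunctor := by
  intro m
  constructor
  · intro f g h
    refine Subtype.ext (funext fun x => funext fun i => ?_)
    exact congrFun (congrFun (congrArg Subtype.val (congrFun h i)) x) 0
  · intro f
    refine ⟨⟨fun x i => (f i).1 x 0, contDiffOn_pi.2 fun i => ?_⟩, ?_⟩
    · refine (contDiffOn_pi.1 (f i).2 0).congr fun x hx => ?_
      have h := Subtype.val_injective (p := fun x : Coord 1 => x 0 ≠ 0)
      exact (congrFun (h.extend_apply _ 0 ⟨x, hx⟩) i).trans
        (congrFun (h.extend_apply (f i).1 0 ⟨x, hx⟩) 0).symm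
    · refine funext fun i => Subtype.ext (funext fun x => funext fun a => ?_)
      rw [Subsingleton.elim a 0]
      rfl

/-- The `C^∞`-ring of smooth functions on the punctured line. -/
def punctured : SmoothRing := ⟨puncturedFunctor, isSmoothRing_punctured⟩

/-- The restriction of smooth functions from the line to the punctured line. -/
def restriction : functions.obj (op ⟨1⟩) ⟶ punctured :=
  ObjectProperty.homMk
    { app := fun X => TypeCat.ofHom fun f => ⟨f.1 ∘ Subtype.val, by
        refine (f.2.contDiffOn (s := {x : Coord 1 | x 0 ≠ 0})).congr fun x hx => ?_
        have h := Subtype.val_injective (p := fun x : Coord 1 => x 0 ≠ 0)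
        exact h.extend_apply _ 0 ⟨x, hx⟩⟩ }

/-! ### Derived smooth rings and derived manifolds -/

/-- Simplicial `C^∞`-rings, with which derived `C^∞`-rings are presented. -/
abbrev SimplicialSmoothRing : Type 1 := SimplicialObject SmoothRing

/-- A `C^∞`-ring as a constant simplicial `C^∞`-ring. -/
abbrev constant : SmoothRing ⥤ SimplicialSmoothRing := SimplicialObject.const SmoothRing

namespace SimplicialSmoothRing

/-- The underlying simplicial set of a simplicial `C^∞`-ring. -/
def underlying : SimplicialSmoothRing ⥤ SSet.{0} :=
  (SimplicialObject.whiskering SmoothRing Type).obj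
    (IsSmoothRing.ι ⋙ (evaluation CartSp Type).obj ⟨1⟩)

/-- The maps whose underlying map of simplicial sets is a Kan fibration. -/
def fibrations : MorphismProperty SimplicialSmoothRing :=
  SSet.modelCategoryQuillen.J.{0}.rlp.inverseImage underlying

/-- The maps whose underlying map of simplicial sets is a trivial Kan fibration. -/
def trivialFibrations : MorphismProperty SimplicialSmoothRing :=
  SSet.modelCategoryQuillen.I.{0}.rlp.inverseImage underlying

/-- The cofibrations. -/
def cofibrations : MorphismProperty SimplicialSmoothRing := trivialFibrations.llp

/-- The trivial cofibrations. -/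
def trivialCofibrations : MorphismProperty SimplicialSmoothRing := fibrations.llp

/-- The weak equivalences. -/
def weakEquivalences : MorphismProperty SimplicialSmoothRing := fun A B f =>
  ∃ (C : SimplicialSmoothRing) (i : A ⟶ C) (q : C ⟶ B),
    trivialCofibrations i ∧ trivialFibrations q ∧ i ≫ q = f

/-- The ring of functions on `ℝᵐ` as a simplicial `C^∞`-ring. -/
def cartesian (m : ℕ) : SimplicialSmoothRing := constant.obj (functions.obj (op ⟨m⟩))

/-- The cofibrant simplicial `C^∞`-rings; functions on `ℝ⁰` are the initial `C^∞`-ring. -/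
def IsCofibrant (A : SimplicialSmoothRing) : Prop := ∃ f : cartesian 0 ⟶ A, cofibrations f

/-- The simplicial `C^∞`-rings of functions on derived manifolds: the smallest class that contains
the functions on Cartesian spaces and is closed under weak equivalences, homotopy pushouts (dual to
fiber products of derived manifolds) and retracts. -/
inductive IsDerivedManifold : SimplicialSmoothRing → Prop
  | cartesian (m : ℕ) : IsDerivedManifold (cartesian m)
  | of_weakEquivalence {A B : SimplicialSmoothRing} (f : A ⟶ B) (hf : weakEquivalences f)
      (hA : IsDerivedManifold A) : IsDerivedManifold B
  | of_weakEquivalence_symm {A B : SimplicialSmoothRing} (f : A ⟶ B) (hf : weakEquivalences f)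
      (hB : IsDerivedManifold B) : IsDerivedManifold A
  | pushout {A B C D : SimplicialSmoothRing} (f : A ⟶ B) (g : A ⟶ C) (h : B ⟶ D) (k : C ⟶ D)
      (sq : IsPushout f g h k) (hf : cofibrations f) (hcA : IsCofibrant A) (hcC : IsCofibrant C)
      (hA : IsDerivedManifold A) (hB : IsDerivedManifold B) (hC : IsDerivedManifold C) :
      IsDerivedManifold D
  | retract {A B : SimplicialSmoothRing} (r : Retract A B) (hB : IsDerivedManifold B) :
      IsDerivedManifold A

/-- The map `j : A ⟶ B` is a cofibration that exhibits `B` as the derived `C^∞`-localization of `A`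
at an element `f`, that is, `j` presents the open embedding of the locus where `f` does not vanish:
`B` is the homotopy pushout of `A ← C^∞(ℝ) → C^∞(ℝ ∖ 0)`, where the second map is replaced by a
cofibration `l`. -/
def IsOpenLocalization {A B : SimplicialSmoothRing} (j : A ⟶ B) : Prop :=
  cofibrations j ∧
  ∃ (f : cartesian 1 ⟶ A) (L : SimplicialSmoothRing) (l : cartesian 1 ⟶ L)
    (w : L ⟶ constant.obj punctured) (P : SimplicialSmoothRing) (u : A ⟶ P) (v : L ⟶ P)
    (e : P ⟶ B),
    cofibrations l ∧ weakEquivalences w ∧ l ≫ w = constant.map restriction ∧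
      IsPushout f l u v ∧ weakEquivalences e ∧ u ≫ e = j

end SimplicialSmoothRing

open SimplicialSmoothRing

/-- The cofibrant simplicial `C^∞`-rings of functions on derived manifolds. -/
def IsTestRing : ObjectProperty SimplicialSmoothRing := fun A =>
  IsCofibrant A ∧ SimplicialSmoothRing.IsDerivedManifold A

/-- Derived manifolds, as the opposite of a category of simplicial `C^∞`-rings. -/
abbrev DerMfld : Type 1 := (IsTestRing.FullSubcategory)ᵒᵖ

/-- The covers of derived manifolds: jointly surjective families of open embeddings given by
localization. Points of a derived manifold are the maps from its ring of functions to `ℝ`. -/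
def derMfldCoverage : Precoverage DerMfld where
  coverings X := {R | (∀ ⦃U : DerMfld⦄ (f : U ⟶ X), R f → IsOpenLocalization f.unop.hom) ∧
    ∀ x : X.unop.obj ⟶ cartesian 0, ∃ (U : DerMfld) (f : U ⟶ X), R f ∧
      ∃ y : U.unop.obj ⟶ cartesian 0, f.unop.hom ≫ y = x}

/-! ### Sheaves of complexes on spacetimes -/

/-- Cochain complexes of abelian groups. -/
abbrev Complexes : Type 1 := CochainComplex AddCommGrpCat.{0} ℤ

section Local

variable {C : Type 1} [Category.{0} C] (J : GrothendieckTopology C)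

/-- The maps of presheaves of abelian groups that are isomorphisms locally. -/
def locallyBijective : MorphismProperty (Cᵒᵖ ⥤ AddCommGrpCat.{0}) := fun _ _ f =>
  Presheaf.IsLocallyInjective J f ∧ Presheaf.IsLocallySurjective J f

/-- The maps of presheaves of complexes that are quasi-isomorphisms locally. -/
def localQuasiIso : MorphismProperty (Cᵒᵖ ⥤ Complexes) := fun _ _ f =>
  ∀ i : ℤ, locallyBijective J
    (Functor.whiskerRight f (HomologicalComplex.homologyFunctor AddCommGrpCat.{0} _ i))

/-- The maps of presheaves of simplicial abelian groups that are weak equivalences locally. -/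
def localWeakEquivalence : MorphismProperty (Cᵒᵖ ⥤ SimplicialObject AddCommGrpCat.{0}) :=
  fun _ _ f => ∀ i : ℕ, locallyBijective J
    (Functor.whiskerRight f (Abelian.DoldKan.N ⋙
      HomologicalComplex.homologyFunctor AddCommGrpCat.{0} _ i))

/-- Truncation to nonpositive cohomological degrees. -/
def truncation : Complexes ⥤ ChainComplex AddCommGrpCat.{0} ℕ :=
  ComplexShape.embeddingDownNat.truncLE'Functor AddCommGrpCat.{0}

/-- The presheaf of simplicial abelian groups presented by a presheaf of complexes, by truncation
and the Dold-Kan correspondence. -/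
def truncateDoldKan : (Cᵒᵖ ⥤ Complexes) ⥤ (Cᵒᵖ ⥤ SimplicialObject AddCommGrpCat.{0}) :=
  (Functor.whiskeringRight _ _ _).obj (truncation ⋙ Abelian.DoldKan.Γ)

end Local

/-- The complexes of functions extended from `C^∞`-rings to simplicial `C^∞`-rings: the total
complex of the complexes of the levels. -/
def simplicialExtension : (SmoothRing ⥤ Complexes) ⥤ (SimplicialSmoothRing ⥤ Complexes) :=
  SimplicialObject.whiskering SmoothRing Complexes ⋙
    (Functor.whiskeringRight _ _ _).obj
      (AlgebraicTopology.alternatingFaceMapComplex Complexes ⋙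
        ComplexShape.embeddingDownNat.extendFunctor Complexes ⋙
        HomologicalComplex₂.totalFunctor AddCommGrpCat.{0} (ComplexShape.up ℤ) (ComplexShape.up ℤ)
          (ComplexShape.up ℤ))

/-- Smooth families parametrised by Cartesian spaces extended to families parametrised by derived
manifolds: by left Kan extension to `C^∞`-rings, and then to simplicial `C^∞`-rings. -/
def derivedExtension : (CartSpᵒᵖ ⥤ Complexes) ⥤ (DerMfldᵒᵖ ⥤ Complexes) :=
  functions.lan ⋙ simplicialExtension ⋙
    (Functor.whiskeringLeft _ _ _).obj (unopUnop _ ⋙ IsTestRing.ι)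

section Theory

variable (σ : Signature) (n : ℕ)

/-- A theory on coordinate patches, in smooth families. -/
abbrev PatchTheory : Type 1 := (PatchCat σ n)ᵒᵖ ⥤ CartSpᵒᵖ ⥤ Complexes

variable {σ n}

/-- The presheaf of complexes on all spacetimes given locally, on coordinate patches, by a theory
(without families): its sections on `M` are the limit over the patches in `M`. -/
def onSpacetimes (K : PatchTheory σ n) : (Spacetime σ n)ᵒᵖ ⥤ Complexes :=
  (patchInclusion σ n).op.ran.obj (K ⋙ (evaluation CartSpᵒᵖ Complexes).obj (op ⟨0⟩))

/-- The presheaf of complexes on spacetimes and derived manifolds given locally, on coordinate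
patches, by a theory. -/
def inFamilies (K : PatchTheory σ n) : (Spacetime σ n × DerMfld)ᵒᵖ ⥤ Complexes :=
  (prodOpEquiv (Spacetime σ n)).functor ⋙
    Functor.uncurry.obj ((patchInclusion σ n).op.ran.obj (K ⋙ derivedExtension))

variable (σ n)

/-- The topology on spacetimes. -/
def spacetimeTopology : GrothendieckTopology (Spacetime σ n) :=
  (Spacetime.coverage σ n).toGrothendieck

/-- The topology on pairs of a spacetime and a derived manifold that is generated by the covers of
spacetimes and the covers of derived manifolds. -/
def familyTopology : GrothendieckTopology (Spacetime σ n × DerMfld) :=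
  Precoverage.toGrothendieck
    { coverings := fun X => {R |
        (∃ S ∈ Spacetime.coverage σ n X.1,
          R = Presieve.map (Prod.sectL (Spacetime σ n) X.2) S) ∨
        ∃ S ∈ derMfldCoverage X.2, R = Presieve.map (Prod.sectR X.1 DerMfld) S} }

/-- Sheaves on spacetimes valued in the derived category of abelian groups. -/
abbrev DerivedSheaves : Type 1 := (localQuasiIso (spacetimeTopology σ n)).Localization

/-- Sheaves on spacetimes and derived manifolds valued in simplicial abelian groups up to weak
equivalence. -/
abbrev Stacks : Type 1 := (localWeakEquivalence (familyTopology σ n)).Localization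

variable {σ n}

/-- The sheaf on spacetimes, valued in the derived category, that is given locally by a theory. -/
def PatchTheory.sheaf (K : PatchTheory σ n) : DerivedSheaves σ n :=
  (localQuasiIso (spacetimeTopology σ n)).Q.obj (onSpacetimes K)

/-- The moduli stack presented by a theory. -/
def PatchTheory.moduliStack (K : PatchTheory σ n) : Stacks σ n :=
  (localWeakEquivalence (familyTopology σ n)).Q.obj (truncateDoldKan.obj (inFamilies K))

end Theory

/-- `p`-form Maxwell theory. -/
def Maxwell (σ : Signature) (n p : ℕ) (κ : ℝ) : PatchTheory σ n :=
  Functor.curry.obj (maxwellDiff σ n p κ ⋙ DiffGroup.toComplex)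

/-- The second presentation of `p`-form Maxwell theory. -/
def MaxwellTilde (σ : Signature) (n p : ℕ) (κ : ℝ) (hp : p + 2 ≤ n) : PatchTheory σ n :=
  Functor.curry.obj (maxwellTildeDiff σ n p κ hp ⋙ DiffGroup.toComplex)

/-- `p`-form Maxwell theory coupled to a charge-discretized topological `BF` theory. -/
def MaxwellBF (σ : Signature) (n p : ℕ) (κ : ℝ) (hp : p + 2 ≤ n) : PatchTheory σ n :=
  Functor.curry.obj (maxwellBFDiff σ n p κ hp ⋙ DiffGroup.toComplex)

end HigherMaxwell
end

/-!
All three theories are compared on a single coordinate patch, where explicit homotopy equivalences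
of complexes exist, and these are then carried through the constructions of sheaves and moduli
stacks.

*Passage to sheaves and stacks.* A map of theories that has, on each coordinate patch, a homotopy
inverse natural in the Cartesian parameter space (`IsPatchwiseHomotopyEquiv`) induces isomorphisms
of sheaves and of moduli stacks. Naturality in the parameter space suffices because the extension to
derived manifolds is additive: a left Kan extension, which is computed degreewise in complexes,
followed by a total complex. Hence it preserves natural homotopies
(`NaturalHomotopy.derivedExtension`), and truncation and the Dold-Kan correspondence turn the
resulting quasi-isomorphisms into weak equivalences. The homotopy inverses need not be natural in
the patch. Every point of a spacetime lies in a patch (`exists_patch`), and on a patch the right Kan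
extension to spacetimes is the given theory, so quasi-isomorphisms on patches are local
quasi-isomorphisms.

*The maps.* With `p + q + 2 = n`, the second presentation of `q`-form Maxwell theory with coupling
`1/κ` maps to the coupled theory by `tildeToBF`: the integers go to the fourth row and, negated, to
the constants of the third row, the row of `A` goes to the third row of the coupled theory, the top
form `C` of the other row goes to `dC` in the first row, and `ρ` goes to `⋆ρ`. In the coupled theory
the first row cancels the second in degrees at most `p`, and what is left of the first row are the
forms of degree greater than `p`, which the Poincaré lemma contracts onto closed, hence exact,
`p+1`-forms; the fourth row cancels against the constants of the third row except for the integers.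
The maps and homotopies are built from the operator `cone` of integration along rays, the evaluation
`atOrigin`, and the fact that `⋆⋆` is a nonzero constant on forms of given degree that depends only
on the signature (`exists_star_star`). The second presentation maps to the first by `ρ ↦ κ dρ`
(`tildeToMaxwell`), and again the Poincaré lemma provides a homotopy inverse. All the operations are
natural in the parameter space, while only `cone` and `atOrigin` depend on the coordinates of the
patch, and they enter the homotopy inverses and the homotopies but not the two maps.
-/

noncomputable section
namespace HigherMaxwell

/-! ### Natural homotopy equivalences -/

section NaturalHomotopy

variable {J J' C D A : Type*} [Category* J] [Category* J'] [Category* C] [Category* D]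
  [Category* A] [Preadditive A]

/-- A chain homotopy between two maps of functors valued in cochain complexes that is natural in
the argument of the functors. Only the components `hom i j` with `j + 1 = i` matter. -/
structure NaturalHomotopy {K L : J ⥤ CochainComplex A ℤ} (f g : K ⟶ L) where
  hom (i j : ℤ) (X : J) : (K.obj X).X i ⟶ (L.obj X).X j
  naturality (i j : ℤ) {X Y : J} (u : X ⟶ Y) :
    (K.map u).f i ≫ hom i j Y = hom i j X ≫ (L.map u).f j
  comm (X : J) {i j k : ℤ} (hij : i + 1 = j) (hjk : j + 1 = k) :
    (f.app X).f j = (K.obj X).d j k ≫ hom k j X + hom j i X ≫ (L.obj X).d i j + (g.app X).f j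

/-- A map of functors valued in cochain complexes that has a natural homotopy inverse. -/
def IsNaturalHomotopyEquiv {K L : J ⥤ CochainComplex A ℤ} (f : K ⟶ L) : Prop :=
  ∃ g : L ⟶ K, Nonempty (NaturalHomotopy (f ≫ g) (𝟙 K)) ∧ Nonempty (NaturalHomotopy (g ≫ f) (𝟙 L))

/-- The differential of a functor valued in cochain complexes, as a natural transformation. -/
def naturalDiff (K : J ⥤ CochainComplex A ℤ) (i j : ℤ) :
    K ⋙ HomologicalComplex.eval A _ i ⟶ K ⋙ HomologicalComplex.eval A _ j where
  app X := (K.obj X).d i j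
  naturality _ _ f := (K.map f).comm i j

namespace NaturalHomotopy

/-- The components of a natural homotopy as natural transformations. -/
def natTrans {K L : J ⥤ CochainComplex A ℤ} {f g : K ⟶ L} (H : NaturalHomotopy f g) (i j : ℤ) :
    K ⋙ HomologicalComplex.eval A _ i ⟶ L ⋙ HomologicalComplex.eval A _ j where
  app X := H.hom i j X
  naturality _ _ u := H.naturality i j u

/-- The restriction of a natural homotopy along a functor. -/
def whiskerLeft {K L : J ⥤ CochainComplex A ℤ} {f g : K ⟶ L} (H : NaturalHomotopy f g)
    (F : J' ⥤ J) : NaturalHomotopy (Functor.whiskerLeft F f) (Functor.whiskerLeft F g) where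
  hom i j X := H.hom i j (F.obj X)
  naturality i j _ _ u := H.naturality i j (F.map u)
  comm X _ _ _ hij hjk := H.comm (F.obj X) hij hjk

/-- The homotopy at an object. -/
def app {K L : J ⥤ CochainComplex A ℤ} {f g : K ⟶ L} (H : NaturalHomotopy f g) (X : J) :
    Homotopy (f.app X) (g.app X) where
  hom i j := if j + 1 = i then H.hom i j X else 0
  zero i j h := if_neg h
  comm i := by
    rw [dNext_eq _ (show (ComplexShape.up ℤ).Rel i (i + 1) from rfl),
      prevD_eq _ (show (ComplexShape.up ℤ).Rel (i - 1) i from sub_add_cancel i 1), if_pos rfl,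
      if_pos (sub_add_cancel i 1)]
    exact H.comm X (sub_add_cancel i 1) rfl

end NaturalHomotopy

/-- The components of a natural homotopy, extended along a functor. -/
def NaturalHomotopy.lanNatTrans (F : C ⥤ D)
    [∀ K : C ⥤ CochainComplex A ℤ, F.HasLeftKanExtension K]
    [∀ (i : ℤ) (K : C ⥤ CochainComplex A ℤ),
      (HomologicalComplex.eval A (ComplexShape.up ℤ) i).PreservesLeftKanExtension K F]
    {K L : C ⥤ CochainComplex A ℤ} {f g : K ⟶ L} (H : NaturalHomotopy f g) (i j : ℤ) :
    F.lan.obj K ⋙ HomologicalComplex.eval A _ i ⟶ F.lan.obj L ⋙ HomologicalComplex.eval A _ j :=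
  (F.lan.obj K ⋙ HomologicalComplex.eval A _ i).descOfIsLeftKanExtension
    (Functor.whiskerRight (F.lanUnit.app K) _ ≫ (Functor.associator _ _ _).hom) _
    (H.natTrans i j ≫ Functor.whiskerRight (F.lanUnit.app L) (HomologicalComplex.eval A _ j) ≫
      (Functor.associator _ _ _).hom)

/-- Left Kan extension preserves natural homotopies, because it is computed degreewise. -/
def NaturalHomotopy.lan (F : C ⥤ D) [∀ K : C ⥤ CochainComplex A ℤ, F.HasLeftKanExtension K]
    [∀ (i : ℤ) (K : C ⥤ CochainComplex A ℤ),
      (HomologicalComplex.eval A (ComplexShape.up ℤ) i).PreservesLeftKanExtension K F]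
    {K L : C ⥤ CochainComplex A ℤ} {f g : K ⟶ L} (H : NaturalHomotopy f g) :
    NaturalHomotopy (F.lan.map f) (F.lan.map g) where
  hom i j X := (H.lanNatTrans F i j).app X
  naturality i j _ _ u := (H.lanNatTrans F i j).naturality u
  comm := by
    intro X i j k hij hjk
    let e (i : ℤ) := HomologicalComplex.eval A (ComplexShape.up ℤ) i
    let u (K : C ⥤ CochainComplex A ℤ) (i : ℤ) :
        K ⋙ e i ⟶ F ⋙ F.lan.obj K ⋙ e i :=
      Functor.whiskerRight (F.lanUnit.app K) (e i) ≫ (Functor.associator _ _ _).hom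
    let t (K : C ⥤ CochainComplex A ℤ) (i : ℤ) (c : C) :
        (K.obj c).X i ⟶ ((F.lan.obj K).obj (F.obj c)).X i := ((F.lanUnit.app K).app c).f i
    have hu (K : C ⥤ CochainComplex A ℤ) (i : ℤ) (c : C) :
      (u K i).app c = t K i c := Category.comp_id _
    let h' (i j : ℤ) (Y : D) : ((F.lan.obj K).obj Y).X i ⟶ ((F.lan.obj L).obj Y).X j :=
      (H.lanNatTrans F i j).app Y
    have hh' (i j : ℤ) (c : C) : t K i c ≫ h' i j (F.obj c) =
        H.hom i j c ≫ t L j c :=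
      (congrArg (· ≫ h' i j (F.obj c)) (hu K i c)).symm.trans
        (((F.lan.obj K ⋙ e i).descOfIsLeftKanExtension_fac_app (u K i) _
          (H.natTrans i j ≫ u L j) c).trans (congrArg (H.hom i j c ≫ ·) (hu L j c)))
    suffices hs : Functor.whiskerRight (F.lan.map f) (e j) =
        naturalDiff (F.lan.obj K) j k ≫ H.lanNatTrans F k j +
          H.lanNatTrans F j i ≫ naturalDiff (F.lan.obj L) i j +
          Functor.whiskerRight (F.lan.map g) (e j) by
      exact NatTrans.congr_app hs X
    refine (F.lan.obj K ⋙ e j).hom_ext_of_isLeftKanExtension (u K j) _ _ ?_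
    ext c
    have nat (f : K ⟶ L) : t K j c ≫ ((F.lan.map f).app (F.obj c)).f j =
        (f.app c).f j ≫ t L j c := by
      have := congrArg (fun t => (t.app c).f j) (F.lanUnit.naturality f)
      exact this.symm
    refine ((congrArg (· ≫ ((F.lan.map f).app (F.obj c)).f j) (hu K j c)).trans ?_).trans
      (congrArg (· ≫ (((F.lan.obj K).obj (F.obj c)).d j k ≫ h' k j (F.obj c) +
        h' j i (F.obj c) ≫ ((F.lan.obj L).obj (F.obj c)).d i j +
        ((F.lan.map g).app (F.obj c)).f j)) (hu K j c)).symm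
    change t K j c ≫ ((F.lan.map f).app (F.obj c)).f j = t K j c ≫
      (((F.lan.obj K).obj (F.obj c)).d j k ≫ h' k j (F.obj c) +
        h' j i (F.obj c) ≫ ((F.lan.obj L).obj (F.obj c)).d i j +
        ((F.lan.map g).app (F.obj c)).f j)
    rw [Preadditive.comp_add, Preadditive.comp_add, nat, nat, H.comm c hij hjk,
      Preadditive.add_comp, Preadditive.add_comp]
    congr 2
    · rw [Category.assoc, ← hh', ← Category.assoc, ← Category.assoc]
      exact congrArg (· ≫ h' k j (F.obj c)) (((F.lanUnit.app K).app c).comm j k).symm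
    · rw [← Category.assoc, hh', Category.assoc, Category.assoc]
      exact congrArg (H.hom j i c ≫ ·) (((F.lanUnit.app L).app c).comm i j).symm

theorem IsNaturalHomotopyEquiv.lan (F : C ⥤ D)
    [∀ K : C ⥤ CochainComplex A ℤ, F.HasLeftKanExtension K]
    [∀ (i : ℤ) (K : C ⥤ CochainComplex A ℤ),
      (HomologicalComplex.eval A (ComplexShape.up ℤ) i).PreservesLeftKanExtension K F]
    {K L : C ⥤ CochainComplex A ℤ} {f : K ⟶ L} (hf : IsNaturalHomotopyEquiv f) :
    IsNaturalHomotopyEquiv (F.lan.map f) := by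
  obtain ⟨g, ⟨H⟩, ⟨H'⟩⟩ := hf
  refine ⟨F.lan.map g, ⟨?_⟩, ⟨?_⟩⟩
  · rw [← F.lan.map_comp, ← F.lan.map_id]
    exact H.lan F
  · rw [← F.lan.map_comp, ← F.lan.map_id]
    exact H'.lan F

end NaturalHomotopy

section Bicomplex

variable {A : Type*} [Category* A] [Preadditive A] {ι ι' : Type*} {c : ComplexShape ι}
  {c' : ComplexShape ι'}

/-- A homotopy between two maps of bicomplexes that is a chain homotopy in each column and that
commutes with the differential in the other direction. -/
structure ColumnHomotopy {K L : HomologicalComplex (CochainComplex A ℤ) c} (f g : K ⟶ L) where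
  hom (p : ι) (i j : ℤ) : (K.X p).X i ⟶ (L.X p).X j
  naturality (p q : ι) (i j : ℤ) : (K.d p q).f i ≫ hom q i j = hom p i j ≫ (L.d p q).f j
  comm (p : ι) {i j k : ℤ} (hij : i + 1 = j) (hjk : j + 1 = k) :
    (f.f p).f j = (K.X p).d j k ≫ hom p k j + hom p j i ≫ (L.X p).d i j + (g.f p).f j

/-- The homotopy of bicomplexes given by a natural homotopy of simplicial complexes. -/
def NaturalHomotopy.alternatingFaceMap {K L : SimplexCategoryᵒᵖ ⥤ CochainComplex A ℤ}
    {f g : K ⟶ L} (H : NaturalHomotopy f g) :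
    ColumnHomotopy ((AlgebraicTopology.alternatingFaceMapComplex _).map f)
      ((AlgebraicTopology.alternatingFaceMapComplex _).map g) where
  hom p i j := H.hom i j (op (SimplexCategory.mk p))
  naturality p q i j := by
    by_cases h : q + 1 = p
    · subst h
      have hd (M : SimplexCategoryᵒᵖ ⥤ CochainComplex A ℤ) (m : ℤ) :
          (((AlgebraicTopology.alternatingFaceMapComplex _).obj M).d (q + 1) q).f m =
            ∑ l : Fin (q + 2), (-1 : ℤ) ^ (l : ℕ) • (M.map (SimplexCategory.δ l).op).f m := by
        rw [AlgebraicTopology.alternatingFaceMapComplex_obj_d]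
        exact map_sum (HomologicalComplex.Hom.fAddMonoidHom m) _ _
      refine (congrArg (· ≫ H.hom i j _) (hd K i)).trans
        (Eq.trans ?_ (congrArg (H.hom i j _ ≫ ·) (hd L j)).symm)
      change (∑ l : Fin (q + 2), _) ≫ _ = _ ≫ (∑ l : Fin (q + 2), _)
      rw [Preadditive.sum_comp, Preadditive.comp_sum]
      refine Finset.sum_congr rfl fun l _ => ?_
      rw [Preadditive.zsmul_comp, Preadditive.comp_zsmul, H.naturality]
    · rw [HomologicalComplex.shape _ _ _ (show ¬ (ComplexShape.down ℕ).Rel p q from h),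
        HomologicalComplex.shape _ _ _ (show ¬ (ComplexShape.down ℕ).Rel p q from h)]
      exact zero_comp.trans comp_zero.symm
  comm p _ _ _ hij hjk := H.comm _ hij hjk

open Classical in
/-- The extension of a homotopy of bicomplexes along an embedding of complex shapes. -/
def ColumnHomotopy.extend [HasZeroObject A] {K L : HomologicalComplex (CochainComplex A ℤ) c}
    {f g : K ⟶ L} (H : ColumnHomotopy f g) (e : c.Embedding c') :
    ColumnHomotopy (HomologicalComplex.extendMap f e) (HomologicalComplex.extendMap g e) where
  hom p i j := if h : ∃ n, e.f n = p then
    (K.extendXIso e h.choose_spec).hom.f i ≫ H.hom _ i j ≫ (L.extendXIso e h.choose_spec).inv.f j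
    else 0
  naturality p q i j := by
    by_cases hp : ∃ n, e.f n = p
    · by_cases hq : ∃ n, e.f n = q
      · rw [dif_pos hp, dif_pos hq, K.extend_d_eq e hp.choose_spec hq.choose_spec,
          L.extend_d_eq e hp.choose_spec hq.choose_spec]
        have hI {X Y : CochainComplex A ℤ} (t : X ≅ Y) (m : ℤ) {Z : A} (w : Y.X m ⟶ Z) :
            t.inv.f m ≫ t.hom.f m ≫ w = w := by
          rw [← Category.assoc, ← HomologicalComplex.comp_f, t.inv_hom_id, HomologicalComplex.id_f,
            Category.id_comp]
        simp only [HomologicalComplex.comp_f, Category.assoc, hI]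
        rw [← Category.assoc ((K.d _ _).f _), H.naturality, Category.assoc]
      · rw [dif_neg hq,
          (L.isZero_extend_X e q fun n hn => hq ⟨n, hn⟩).eq_of_tgt ((L.extend e).d p q) 0]
        exact comp_zero.trans comp_zero.symm
    · rw [dif_neg hp,
        (K.isZero_extend_X e p fun n hn => hp ⟨n, hn⟩).eq_of_src ((K.extend e).d p q) 0]
      exact zero_comp.trans zero_comp.symm
  comm p i j k hij hjk := by
    by_cases hp : ∃ n, e.f n = p
    · rw [dif_pos hp, dif_pos hp, HomologicalComplex.extendMap_f _ e hp.choose_spec,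
        HomologicalComplex.extendMap_f _ e hp.choose_spec]
      simp only [HomologicalComplex.comp_f, Category.assoc]
      rw [H.comm _ hij hjk]
      simp only [Preadditive.comp_add, Preadditive.add_comp, Category.assoc]
      rw [HomologicalComplex.Hom.comm_assoc, HomologicalComplex.Hom.comm]
    · have h := K.isZero_extend_X e p fun n hn => hp ⟨n, hn⟩
      have h' : IsZero (((K.extend e).X p).X j) :=
        (HomologicalComplex.eval A (ComplexShape.up ℤ) j).map_isZero h
      exact h'.eq_of_src _ _

section Total

variable {K L : HomologicalComplex₂ A (ComplexShape.up ℤ) (ComplexShape.up ℤ)}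
  [K.HasTotal (ComplexShape.up ℤ)] [L.HasTotal (ComplexShape.up ℤ)] {f g : K ⟶ L}

/-- The components of the homotopy of total complexes given by a homotopy of columns; the sign makes
them anticommute with the differential between columns. -/
def ColumnHomotopy.totalHom (H : ColumnHomotopy f g) (m n : ℤ) (h : n + 1 = m) :
    (K.total (ComplexShape.up ℤ)).X m ⟶ (L.total (ComplexShape.up ℤ)).X n :=
  HomologicalComplex₂.totalDesc K fun p i hpi =>
    (p.negOnePow • H.hom p i (i - 1)) ≫ L.ιTotal (ComplexShape.up ℤ) p (i - 1) n
      (by change p + i = m at hpi; change p + (i - 1) = n; omega)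

theorem ColumnHomotopy.ι_totalHom (H : ColumnHomotopy f g) (m n : ℤ) (h : n + 1 = m)
    (p i j : ℤ) (hpi : p + i = m) (hji : j + 1 = i) :
    K.ιTotal (ComplexShape.up ℤ) p i m hpi ≫ H.totalHom m n h =
      p.negOnePow • H.hom p i j ≫ L.ιTotal (ComplexShape.up ℤ) p j n
        (by change p + j = n; omega) := by
  obtain rfl : j = i - 1 := by omega
  rw [ColumnHomotopy.totalHom, HomologicalComplex₂.ι_totalDesc, Linear.units_smul_comp]

/-- The differential of a total complex on the component of bidegree `(p, i)`. -/
theorem ι_total_d (K : HomologicalComplex₂ A (ComplexShape.up ℤ) (ComplexShape.up ℤ))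
    [K.HasTotal (ComplexShape.up ℤ)] (p i n : ℤ) (hpi : p + i = n) :
    K.ιTotal (ComplexShape.up ℤ) p i n hpi ≫ (K.total (ComplexShape.up ℤ)).d n (n + 1) =
      (K.d p (p + 1)).f i ≫ K.ιTotal (ComplexShape.up ℤ) (p + 1) i (n + 1)
          (by change p + 1 + i = _; omega) +
        p.negOnePow • (K.X p).d i (i + 1) ≫ K.ιTotal (ComplexShape.up ℤ) p (i + 1) (n + 1)
          (by change p + (i + 1) = _; omega) := by
  rw [HomologicalComplex₂.total_d, Preadditive.comp_add, HomologicalComplex₂.ι_D₁,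
    HomologicalComplex₂.ι_D₂,
    K.d₁_eq (ComplexShape.up ℤ) (show (ComplexShape.up ℤ).Rel p (p + 1) from rfl) i (n + 1)
      (by change p + 1 + i = _; omega),
    K.d₂_eq (ComplexShape.up ℤ) p (show (ComplexShape.up ℤ).Rel i (i + 1) from rfl) (n + 1)
      (by change p + (i + 1) = _; omega)]
  congr 1
  exact one_smul _ _

/-- A homotopy of columns gives a homotopy between the maps of total complexes. -/
def ColumnHomotopy.total (H : ColumnHomotopy f g) :
    Homotopy (HomologicalComplex₂.total.map f (ComplexShape.up ℤ))
      (HomologicalComplex₂.total.map g (ComplexShape.up ℤ)) where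
  hom m n := if h : n + 1 = m then H.totalHom m n h else 0
  zero m n h := dif_neg h
  comm n := by
    rw [dNext_eq _ (show (ComplexShape.up ℤ).Rel n (n + 1) from rfl),
      prevD_eq _ (show (ComplexShape.up ℤ).Rel (n - 1) n from sub_add_cancel n 1), dif_pos rfl,
      dif_pos (sub_add_cancel n 1)]
    refine HomologicalComplex₂.total.hom_ext _ fun p i hpi => ?_
    change p + i = n at hpi
    obtain ⟨j, rfl⟩ : ∃ j, i = j + 1 := ⟨i - 1, by omega⟩
    obtain ⟨l, rfl⟩ : ∃ l, n = l + 1 := ⟨n - 1, by omega⟩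
    have hpj : p + j = l := by omega
    have e2 (l' : ℤ) (h : l' + 1 = l + 1) : K.ιTotal (ComplexShape.up ℤ) p (j + 1) (l + 1) hpi ≫
          H.totalHom (l + 1) l' h ≫ (L.total (ComplexShape.up ℤ)).d l' (l + 1) =
        p.negOnePow • (H.hom p (j + 1) j ≫ L.ιTotal (ComplexShape.up ℤ) p j l hpj) ≫
          (L.total (ComplexShape.up ℤ)).d l (l + 1) := by
      obtain rfl : l' = l := by omega
      rw [← Category.assoc, H.ι_totalHom _ _ _ p (j + 1) j hpi rfl, Linear.units_smul_comp]
    rw [Preadditive.comp_add, Preadditive.comp_add, e2, ← Category.assoc, ι_total_d K p _ _ hpi,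
      Category.assoc, ι_total_d L p j l hpj, Preadditive.add_comp, Category.assoc,
      Linear.units_smul_comp, Category.assoc,
      H.ι_totalHom _ _ rfl (p + 1) (j + 1) j (by omega) rfl,
      H.ι_totalHom _ _ rfl p (j + 1 + 1) (j + 1) (by omega) rfl,
      HomologicalComplex₂.ιTotal_map, HomologicalComplex₂.ιTotal_map, H.comm p rfl rfl,
      Linear.comp_units_smul, Linear.comp_units_smul, smul_smul, Int.units_mul_self, one_smul,
      Preadditive.comp_add, smul_add, Linear.comp_units_smul, smul_smul, Int.units_mul_self,
      one_smul, Int.negOnePow_succ, Units.neg_smul, ← Category.assoc ((K.d _ _).f _),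
      H.naturality]
    simp only [Preadditive.add_comp, Category.assoc]
    abel

end Total

end Bicomplex

section DerivedExtension

/-- A natural homotopy of theories in smooth families gives homotopies of the derived extensions. -/
def NaturalHomotopy.derivedExtension {K L : CartSpᵒᵖ ⥤ Complexes} {f g : K ⟶ L}
    (H : NaturalHomotopy f g) (X : DerMfldᵒᵖ) :
    Homotopy ((HigherMaxwell.derivedExtension.map f).app X)
      ((HigherMaxwell.derivedExtension.map g).app X) :=
  (((H.lan functions).whiskerLeft X.unop.unop.obj).alternatingFaceMap.extend
    ComplexShape.embeddingDownNat).total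

theorem IsNaturalHomotopyEquiv.quasiIso_app {J : Type*} [Category* J] {K L : J ⥤ Complexes}
    {f : K ⟶ L} (hf : IsNaturalHomotopyEquiv f) (X : J) : QuasiIso (f.app X) := by
  obtain ⟨g, ⟨H⟩, ⟨H'⟩⟩ := hf
  let e : HomotopyEquiv (K.obj X) (L.obj X) := ⟨f.app X, g.app X, H.app X, H'.app X⟩
  exact e.quasiIso_hom

/-- The derived extension of a natural homotopy equivalence is a quasi-isomorphism on each derived
manifold. -/
theorem IsNaturalHomotopyEquiv.quasiIso_derivedExtension {K L : CartSpᵒᵖ ⥤ Complexes} {f : K ⟶ L}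
    (hf : IsNaturalHomotopyEquiv f) (X : DerMfldᵒᵖ) :
    QuasiIso ((derivedExtension.map f).app X) := by
  obtain ⟨g, ⟨H⟩, ⟨H'⟩⟩ := hf
  let e : HomotopyEquiv ((derivedExtension.obj K).obj X) ((derivedExtension.obj L).obj X) :=
    { hom := (derivedExtension.map f).app X
      inv := (derivedExtension.map g).app X
      homotopyHomInvId := (Homotopy.ofEq (by rw [derivedExtension.map_comp]; rfl)).trans
        ((H.derivedExtension X).trans (Homotopy.ofEq (by rw [derivedExtension.map_id]; rfl)))
      homotopyInvHomId := (Homotopy.ofEq (by rw [derivedExtension.map_comp]; rfl)).trans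
        ((H'.derivedExtension X).trans (Homotopy.ofEq (by rw [derivedExtension.map_id]; rfl))) }
  exact e.quasiIso_hom

/-- Truncation and the Dold-Kan correspondence turn quasi-isomorphisms into weak equivalences. -/
theorem isIso_homology_truncation {K L : Complexes} (f : K ⟶ L) [QuasiIso f] (i : ℕ) :
    IsIso ((truncation ⋙ Abelian.DoldKan.Γ ⋙ Abelian.DoldKan.N ⋙
      HomologicalComplex.homologyFunctor AddCommGrpCat.{0} _ i).map f) := by
  have h1 : QuasiIso (truncation.map f) := by
    have h2 : QuasiIso (HomologicalComplex.truncGE'Map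
        ((HomologicalComplex.opFunctor _ _).map f.op) ComplexShape.embeddingDownNat.op) := by
      rw [← HomologicalComplex.quasiIso_extendMap_iff _ ComplexShape.embeddingDownNat.op]
      exact HomologicalComplex.quasiIso_truncGEMap_iff _ _ |>.2 fun _ _ _ => inferInstance
    change QuasiIso ((HomologicalComplex.unopFunctor _ _).map (HomologicalComplex.truncGE'Map
      ((HomologicalComplex.opFunctor _ _).map f.op) ComplexShape.embeddingDownNat.op).op)
    rw [HomologicalComplex.quasiIso_unopFunctor_map_iff]
    exact h2
  have h3 : IsIso ((HomologicalComplex.homologyFunctor AddCommGrpCat.{0} _ i).map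
      (truncation.map f)) := by
    change IsIso (HomologicalComplex.homologyMap _ i)
    infer_instance
  let e : Abelian.DoldKan.Γ ⋙ Abelian.DoldKan.N ≅ 𝟭 (ChainComplex AddCommGrpCat.{0} ℕ) :=
    Abelian.DoldKan.equivalence.counitIso
  have h4 := (NatIso.isIso_map_iff (Functor.isoWhiskerRight e
    (HomologicalComplex.homologyFunctor AddCommGrpCat.{0} _ i)) (truncation.map f)).2 h3
  exact h4

end DerivedExtension

/-! ### Theories that are homotopy equivalent on coordinate patches -/

section Cube

/-- A diffeomorphism from the line to the interval of radius `r` around `c`. -/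
def intervalMap (c r t : ℝ) : ℝ := c + 2 * r / Real.pi * Real.arctan t

theorem contDiff_intervalMap (c r : ℝ) : ContDiff ℝ ∞ (intervalMap c r) :=
  contDiff_const.add (contDiff_const.mul Real.contDiff_arctan)

theorem hasDerivAt_intervalMap (c r t : ℝ) :
    HasDerivAt (intervalMap c r) (2 * r / Real.pi * (1 / (1 + t ^ 2))) t :=
  ((Real.hasDerivAt_arctan t).const_mul _).const_add _

theorem isOpenEmbedding_intervalMap (c : ℝ) {r : ℝ} (hr : 0 < r) :
    IsOpenEmbedding (intervalMap c r) := by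
  have h : IsOpenEmbedding Real.arctan :=
    Real.tanPartialHomeomorph.symm.isOpenEmbedding rfl
  have hr' : 2 * r / Real.pi ≠ 0 := by positivity
  exact ((Homeomorph.mulLeft₀ _ hr').trans (Homeomorph.addLeft c)).isOpenEmbedding.comp h

theorem abs_intervalMap_sub_lt (c : ℝ) {r : ℝ} (hr : 0 < r) (t : ℝ) :
    |intervalMap c r t - c| < r := by
  have h1 := Real.arctan_lt_pi_div_two t
  have h2 := Real.neg_pi_div_two_lt_arctan t
  have h3 : |Real.arctan t| < Real.pi / 2 := abs_lt.2 ⟨by linarith, h1⟩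
  have hpi := Real.pi_pos
  rw [intervalMap, add_sub_cancel_left, abs_mul, abs_of_pos (by positivity)]
  calc 2 * r / Real.pi * |Real.arctan t| < 2 * r / Real.pi * (Real.pi / 2) := by gcongr
    _ = r := by field_simp

/-- A diffeomorphism from Cartesian space to the cube of radius `r` around `c`. -/
def cubeMap {n : ℕ} (c : Coord n) (r : ℝ) (y : Coord n) : Coord n := fun i =>
  intervalMap (c i) r (y i)

variable {n : ℕ} (c : Coord n)

theorem contDiff_cubeMap (r : ℝ) : ContDiff ℝ ∞ (cubeMap c r) :=
  contDiff_pi.2 fun i => (contDiff_intervalMap (c i) r).comp (contDiff_apply ℝ ℝ i)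

theorem cubeMap_zero (r : ℝ) : cubeMap c r 0 = c := by
  funext i
  simp [cubeMap, intervalMap]

theorem isOpenEmbedding_cubeMap {r : ℝ} (hr : 0 < r) : IsOpenEmbedding (cubeMap c r) :=
  IsOpenEmbedding.piMap fun i => isOpenEmbedding_intervalMap (c i) hr

theorem cubeMap_mem_ball {r : ℝ} (hr : 0 < r) (y : Coord n) : cubeMap c r y ∈ Metric.ball c r := by
  rw [Metric.mem_ball, dist_pi_lt_iff hr]
  intro i
  rw [Real.dist_eq]
  exact abs_intervalMap_sub_lt (c i) hr (y i)

theorem jacobian_cubeMap (r : ℝ) (y : Coord n) :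
    jacobian (cubeMap c r) y =
      Matrix.diagonal fun i => 2 * r / Real.pi * (1 / (1 + y i ^ 2)) := by
  have h : HasFDerivAt (cubeMap c r) (ContinuousLinearMap.pi fun i =>
      (2 * r / Real.pi * (1 / (1 + y i ^ 2))) •
        ContinuousLinearMap.proj (R := ℝ) (φ := fun _ => ℝ) i) y :=
    hasFDerivAt_pi.2 fun i =>
      (hasDerivAt_intervalMap (c i) r (y i)).comp_hasFDerivAt y (hasFDerivAt_apply i y)
  rw [jacobian, h.fderiv]
  ext i j
  simp [LinearMap.toMatrix'_apply, Matrix.diagonal_apply, Pi.single_apply]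

theorem det_jacobian_cubeMap_pos {r : ℝ} (hr : 0 < r) (y : Coord n) :
    0 < (jacobian (cubeMap c r) y).det := by
  rw [jacobian_cubeMap, Matrix.det_diagonal]
  exact Finset.prod_pos fun i _ => by have := Real.pi_pos; positivity

theorem contDiff_jacobian {τ : Coord n → Coord n} (hτ : ContDiff ℝ ∞ τ) (i j : Fin n) :
    ContDiff ℝ ∞ fun y => jacobian τ y i j := by
  simp only [jacobian, LinearMap.toMatrix'_apply]
  exact contDiff_pi.1 ((hτ.fderiv_right (m := ∞) (by simp)).clm_apply contDiff_const) i

end Cube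

theorem Signature.IsGram.congr {σ : Signature} {n : ℕ} {G : Matrix (Fin n) (Fin n) ℝ}
    (h : σ.IsGram G) {J : Matrix (Fin n) (Fin n) ℝ} (hJ : J.det ≠ 0) : σ.IsGram (Jᵀ * G * J) := by
  obtain ⟨P, hP, h⟩ := h
  have hJu : IsUnit J.det := isUnit_iff_ne_zero.2 hJ
  refine ⟨J⁻¹ * P, ?_, ?_⟩
  · rw [Matrix.det_mul]
    exact mul_ne_zero (by rw [Matrix.det_nonsing_inv]; exact (hJu.ringInverse).ne_zero) hP
  · rw [← h, Matrix.transpose_mul]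
    have h1 : (J⁻¹)ᵀ * Jᵀ = 1 := by
      rw [← Matrix.transpose_mul, Matrix.mul_nonsing_inv _ hJu, Matrix.transpose_one]
    calc Pᵀ * (J⁻¹)ᵀ * (Jᵀ * G * J) * (J⁻¹ * P) = Pᵀ * ((J⁻¹)ᵀ * Jᵀ) * G * (J * J⁻¹) * P := by
          simp only [Matrix.mul_assoc]
      _ = Pᵀ * G * P := by rw [h1, Matrix.mul_nonsing_inv _ hJu]; simp

/-- Every point of a spacetime lies in a coordinate patch: a small cube in a chart is diffeomorphic
to the whole of `ℝⁿ`, with the metric pulled back. -/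
theorem exists_patch {σ : Signature} {n : ℕ} (M : Spacetime σ n) (x : M.carrier) :
    ∃ (V : Patch σ n) (f : V.toSpacetime ⟶ M), x ∈ Set.range f.toFun := by
  let φ := chartAt (Coord n) x
  have hφ : φ ∈ atlas (Coord n) M.carrier := chart_mem_atlas _ _
  have hx : φ x ∈ φ.target := φ.map_source (mem_chart_source _ x)
  obtain ⟨r, hr, hball⟩ := Metric.isOpen_iff.1 φ.open_target _ hx
  let τ : Coord n → Coord n := cubeMap (φ x) r
  have hτ : ContDiff ℝ ∞ τ := contDiff_cubeMap _ r
  have hτt (y : Coord n) : τ y ∈ φ.target := hball (cubeMap_mem_ball _ hr y)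
  have hdet (y : Coord n) : 0 < (jacobian τ y).det := det_jacobian_cubeMap_pos _ hr y
  let V : Patch σ n :=
    { metric := fun y => (jacobian τ y)ᵀ * M.metric φ (τ y) * jacobian τ y
      contDiff_metric := fun i j => by
        simp only [Matrix.mul_apply, Matrix.transpose_apply]
        refine ContDiff.sum fun k _ => ContDiff.mul (ContDiff.sum fun l _ => ContDiff.mul ?_ ?_) ?_
        · exact contDiff_jacobian hτ _ _
        · exact contDiffOn_univ.1
            ((M.contDiffOn_metric φ hφ l k).comp hτ.contDiffOn fun y _ => hτt y)
        · exact contDiff_jacobian hτ _ _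
      isGram_metric := fun y => (M.isGram_metric φ hφ _ (hτt y)).congr (hdet y).ne' }
  have hemb : IsOpenEmbedding (φ.symm ∘ τ) := by
    refine IsOpenEmbedding.of_continuous_injective_isOpenMap ?_ ?_ ?_
    · exact φ.continuousOn_symm.comp_continuous hτ.continuous hτt
    · intro y z hyz
      exact (isOpenEmbedding_cubeMap _ hr).injective (φ.symm.injOn (hτt y) (hτt z) hyz)
    · intro U hU
      rw [Set.image_comp]
      refine φ.isOpen_image_symm_of_subset_target
        ((isOpenEmbedding_cubeMap _ hr).isOpenMap U hU) ?_
      rintro _ ⟨y, -, rfl⟩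
      exact hτt y
  refine ⟨V, ⟨φ.symm ∘ τ, hemb, ?_⟩, (0 : Coord n), ?_⟩
  · intro χ hχ ψ hψ
    obtain rfl : χ = OpenPartialHomeomorph.refl (Coord n) := chartedSpaceSelf_atlas.1 hχ
    have C := M.compatible φ hφ ψ hψ
    have main (y : Coord n) (hy : φ.symm (τ y) ∈ ψ.source) :
        ContDiffAt ℝ ∞ ((ψ ∘ φ.symm) ∘ τ) y ∧
        jacobian ((ψ ∘ φ.symm) ∘ τ) y = jacobian (ψ ∘ φ.symm) (τ y) * jacobian τ y ∧
        τ y ∈ φ.target ∩ φ.symm ⁻¹' ψ.source := by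
      have hmem : τ y ∈ φ.target ∩ φ.symm ⁻¹' ψ.source := ⟨hτt y, hy⟩
      have hC : ContDiffAt ℝ ∞ (ψ ∘ φ.symm) (τ y) :=
        C.contDiffOn.contDiffAt ((φ.isOpen_inter_preimage_symm ψ.open_source).mem_nhds hmem)
      exact ⟨hC.comp y hτ.contDiffAt, jacobian_comp (hC.differentiableAt (by simp))
        (hτ.differentiable (by simp) y), hmem⟩
    refine ⟨fun y hy => (main y hy.2).1.contDiffWithinAt, fun y hy => ?_, fun y hy => ?_⟩
    · obtain ⟨-, h2, h3⟩ := main y hy.2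
      change 0 < (jacobian ((ψ ∘ φ.symm) ∘ τ) y).det
      rw [h2, Matrix.det_mul]
      exact mul_pos (C.det_pos _ h3) (hdet y)
    · obtain ⟨-, h2, h3⟩ := main y hy.2
      change (jacobian ((ψ ∘ φ.symm) ∘ τ) y)ᵀ * M.metric ψ ((ψ ∘ φ.symm) (τ y)) *
        jacobian ((ψ ∘ φ.symm) ∘ τ) y = (jacobian τ y)ᵀ * M.metric φ (τ y) * jacobian τ y
      rw [h2, ← C.isometry _ h3, Matrix.transpose_mul]
      simp only [Matrix.mul_assoc]
  · change φ.symm (cubeMap (φ x) r 0) = x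
    rw [cubeMap_zero]
    exact φ.left_inv (mem_chart_source _ x)

section LocalBijectivity

variable {C : Type 1} [Category.{0} C] (J : GrothendieckTopology C)

/-- A map of presheaves that is an isomorphism on the members of a cover of every object is an
isomorphism locally. -/
theorem locallyBijective_of_cover {F G : Cᵒᵖ ⥤ AddCommGrpCat.{0}} (f : F ⟶ G)
    (R : ∀ X : C, Presieve X) (hR : ∀ X, Sieve.generate (R X) ∈ J X)
    (hf : ∀ (X Y : C) (u : Y ⟶ X), R X u → IsIso (f.app (op Y))) : locallyBijective J f := by
  constructor
  · refine ⟨fun {X} x y h => J.superset_covering ?_ (hR X.unop)⟩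
    rw [Sieve.generate_le_iff]
    intro Y u hu
    have := hf _ _ u hu
    refine ((ConcreteCategory.bijective_of_isIso (f.app (op Y))).1 ?_)
    rw [NatTrans.naturality_apply, NatTrans.naturality_apply, h]
  · refine ⟨fun {X} s => J.superset_covering ?_ (hR X)⟩
    rw [Sieve.generate_le_iff]
    intro Y u hu
    have := hf _ _ u hu
    exact (ConcreteCategory.bijective_of_isIso (f.app (op Y))).2 _

end LocalBijectivity

/-- The embeddings of coordinate patches in a spacetime. -/
def patchesIn {σ : Signature} {n : ℕ} (M : Spacetime σ n) : Presieve M :=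
  Presieve.ofArrows (fun i : Σ V : Patch σ n, V.toSpacetime ⟶ M => i.1.toSpacetime) fun i => i.2

theorem patchesIn_mem_coverage {σ : Signature} {n : ℕ} (M : Spacetime σ n) :
    patchesIn M ∈ Spacetime.coverage σ n M := by
  intro x
  obtain ⟨V, f, hx⟩ := exists_patch M x
  exact ⟨V.toSpacetime, f, Presieve.ofArrows.mk (⟨V, f⟩ : Σ V : Patch σ n, V.toSpacetime ⟶ M), hx⟩

theorem locallyBijective_of_patches {σ : Signature} {n : ℕ}
    {F G : (Spacetime σ n)ᵒᵖ ⥤ AddCommGrpCat.{0}} (f : F ⟶ G)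
    (hf : ∀ V : Patch σ n, IsIso (f.app (op V.toSpacetime))) :
    locallyBijective (spacetimeTopology σ n) f :=
  locallyBijective_of_cover _ f patchesIn
    (fun M => Precoverage.generate_mem_toGrothendieck (patchesIn_mem_coverage M)) <| by
      rintro M _ _ ⟨i⟩
      exact hf i.1

theorem locallyBijective_of_patches_families {σ : Signature} {n : ℕ}
    {F G : (Spacetime σ n × DerMfld)ᵒᵖ ⥤ AddCommGrpCat.{0}} (f : F ⟶ G)
    (hf : ∀ (V : Patch σ n) (X : DerMfld), IsIso (f.app (op (V.toSpacetime, X)))) :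
    locallyBijective (familyTopology σ n) f :=
  locallyBijective_of_cover _ f
    (fun X => Presieve.map (Prod.sectL (Spacetime σ n) X.2) (patchesIn X.1))
    (fun X => Precoverage.generate_mem_toGrothendieck
      (Or.inl ⟨_, patchesIn_mem_coverage X.1, rfl⟩)) <| by
      rintro X _ _ ⟨⟨i⟩⟩
      exact hf i.1 X.2

section Ran

variable {σ : Signature} {n : ℕ} {H : Type*} [Category* H]
  [∀ F : (PatchCat σ n)ᵒᵖ ⥤ H, (patchInclusion σ n).op.HasPointwiseRightKanExtension F]

/-- On coordinate patches, the extension of a map of presheaves to all spacetimes is the given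
map. -/
theorem nonempty_arrow_iso_ran {K L : (PatchCat σ n)ᵒᵖ ⥤ H} (f : K ⟶ L) (V : (PatchCat σ n)ᵒᵖ) :
    Nonempty (Arrow.mk (((patchInclusion σ n).op.ran.map f).app ((patchInclusion σ n).op.obj V)) ≅
      Arrow.mk (f.app V)) := by
  let c := (patchInclusion σ n).op.ranCounit (H := H)
  refine ⟨Arrow.isoMk (asIso ((c.app K).app V)) (asIso ((c.app L).app V)) ?_⟩
  exact (NatTrans.congr_app (c.naturality f) V).symm

end Ran

/-- A map of theories on coordinate patches that has, for each coordinate patch, a homotopy inverse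
natural in the parameter space. -/
def IsPatchwiseHomotopyEquiv {σ : Signature} {n : ℕ} {K L : PatchTheory σ n} (f : K ⟶ L) : Prop :=
  ∀ V : (PatchCat σ n)ᵒᵖ, IsNaturalHomotopyEquiv (f.app V)

/-- The coordinate patches cover every spacetime, and on a patch the extension to spacetimes is the
given theory, so only the quasi-isomorphisms on patches matter. -/
theorem IsPatchwiseHomotopyEquiv.sheaf {σ : Signature} {n : ℕ} {K L : PatchTheory σ n} {f : K ⟶ L}
    (hf : IsPatchwiseHomotopyEquiv f) : Nonempty (K.sheaf ≅ L.sheaf) := by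
  let g := (patchInclusion σ n).op.ran.map
    (Functor.whiskerRight f ((evaluation CartSpᵒᵖ Complexes).obj (op ⟨0⟩)))
  have hg : localQuasiIso (spacetimeTopology σ n) g := by
    intro i
    refine locallyBijective_of_patches _ fun V => ?_
    let V' : (PatchCat σ n)ᵒᵖ := op V
    obtain ⟨e⟩ := nonempty_arrow_iso_ran
      (Functor.whiskerRight f ((evaluation CartSpᵒᵖ Complexes).obj (op ⟨0⟩))) V'
    have h1 : QuasiIso ((f.app V').app (op ⟨0⟩)) := (hf V').quasiIso_app _
    have h2 : IsIso ((HomologicalComplex.homologyFunctor AddCommGrpCat.{0} _ i).map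
        ((f.app V').app (op ⟨0⟩))) := by
      change IsIso (HomologicalComplex.homologyMap _ i)
      infer_instance
    let e' := (HomologicalComplex.homologyFunctor AddCommGrpCat.{0} _ i).mapArrow.mapIso e
    exact ((MorphismProperty.isomorphisms _).arrow_mk_iso_iff e').2 h2
  exact ⟨Localization.isoOfHom (localQuasiIso (spacetimeTopology σ n)).Q
    (localQuasiIso (spacetimeTopology σ n)) g hg⟩

/-- A homotopy inverse for each patch is enough, because naturality in the parameter space is all
that the extension to derived manifolds needs. -/
theorem IsPatchwiseHomotopyEquiv.moduliStack {σ : Signature} {n : ℕ} {K L : PatchTheory σ n}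
    {f : K ⟶ L} (hf : IsPatchwiseHomotopyEquiv f) : Nonempty (K.moduliStack ≅ L.moduliStack) := by
  let g : inFamilies K ⟶ inFamilies L := Functor.whiskerLeft _
    (Functor.uncurry.map ((patchInclusion σ n).op.ran.map
      (Functor.whiskerRight f derivedExtension)))
  have hg : localWeakEquivalence (familyTopology σ n) (truncateDoldKan.map g) := by
    intro i
    refine locallyBijective_of_patches_families _ fun V X => ?_
    let V' : (PatchCat σ n)ᵒᵖ := op V
    obtain ⟨e⟩ := nonempty_arrow_iso_ran (Functor.whiskerRight f derivedExtension) V'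
    have h1 := (hf V').quasiIso_derivedExtension (op X)
    have h2 := isIso_homology_truncation ((derivedExtension.map (f.app V')).app (op X)) i
    let Φ := truncation ⋙ Abelian.DoldKan.Γ ⋙ Abelian.DoldKan.N ⋙
      HomologicalComplex.homologyFunctor AddCommGrpCat.{0} _ i
    let e' := ((evaluation DerMfldᵒᵖ Complexes).obj (op X) ⋙ Φ).mapArrow.mapIso e
    have h3 := ((MorphismProperty.isomorphisms _).arrow_mk_iso_iff e').2 h2
    have h4 : g.app (op (V.toSpacetime, X)) = (((patchInclusion σ n).op.ran.map
        (Functor.whiskerRight f derivedExtension)).app (op V.toSpacetime)).app (op X) := by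
      simp [g]
      rfl
    change IsIso (Φ.map (g.app (op (V.toSpacetime, X))))
    rw [h4]
    exact h3
  exact ⟨Localization.isoOfHom (localWeakEquivalence (familyTopology σ n)).Q
    (localWeakEquivalence (familyTopology σ n)) _ hg⟩

/-! ### The Poincaré lemma in families -/

section ParametricIntegral

variable {X F : Type} [NormedAddCommGroup X] [NormedSpace ℝ X] [ProperSpace X]
  [NormedAddCommGroup F] [NormedSpace ℝ F]

/-- Differentiation under the integral sign, for an integrand that is smooth in all variables. -/
theorem hasFDerivAt_intervalIntegral_of_contDiff {f : X × ℝ → F} (hf : ContDiff ℝ ∞ f) (x : X) :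
    HasFDerivAt (fun x => ∫ t in (0 : ℝ)..1, f (x, t))
      (∫ t in (0 : ℝ)..1, fderiv ℝ (fun y => f (y, t)) x) x := by
  have hcont : Continuous fun z : X × ℝ => fderiv ℝ (fun y => f (y, z.2)) z.1 := by
    have h2 : ContDiff ℝ ∞ (Function.uncurry fun (z : X × ℝ) y => f (y, z.2)) :=
      hf.comp (contDiff_snd.prodMk (contDiff_snd.comp contDiff_fst))
    have h3 : ContDiff ℝ ∞ fun z : X × ℝ => fderiv ℝ (fun y => f (y, z.2)) z.1 :=
      h2.fderiv (m := ∞) contDiff_fst (by simp)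
    exact h3.continuous
  obtain ⟨C, hC⟩ := ((isCompact_closedBall x 1).prod
    (isCompact_Icc (a := (0 : ℝ)) (b := 1))).exists_bound_of_continuousOn hcont.continuousOn
  refine intervalIntegral.hasFDerivAt_integral_of_dominated_of_fderiv_le
    (bound := fun _ => C) (F := fun y t => f (y, t))
    (F' := fun y t => fderiv ℝ (fun y => f (y, t)) y)
    (Metric.ball_mem_nhds x one_pos) ?_ ?_ ?_ ?_ ?_ ?_
  · exact Filter.Eventually.of_forall fun y => by
      have : Continuous fun t => f (y, t) := hf.continuous.comp (by fun_prop)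
      exact this.aestronglyMeasurable
  · have : Continuous fun t => f (x, t) := hf.continuous.comp (by fun_prop)
    exact this.intervalIntegrable _ _
  · have : Continuous fun t => fderiv ℝ (fun y => f (y, t)) x :=
      hcont.comp (g := fun z : X × ℝ => fderiv ℝ (fun y => f (y, z.2)) z.1)
        (f := fun t => (x, t)) (by fun_prop)
    exact this.aestronglyMeasurable
  · refine Filter.Eventually.of_forall fun t ht y hy => ?_
    rw [Set.uIoc_of_le zero_le_one] at ht
    exact hC (y, t) ⟨Metric.ball_subset_closedBall hy, ht.1.le, ht.2⟩
  · exact intervalIntegrable_const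
  · refine Filter.Eventually.of_forall fun t _ y _ => ?_
    have : ContDiff ℝ ∞ fun y => f (y, t) := hf.comp (contDiff_id.prodMk contDiff_const)
    exact (this.differentiable (by simp) y).hasFDerivAt

theorem contDiff_nat_intervalIntegral (N : ℕ) : ∀ {F : Type} [NormedAddCommGroup F]
    [NormedSpace ℝ F] {f : X × ℝ → F} (_ : ContDiff ℝ ∞ f),
    ContDiff ℝ N fun x => ∫ t in (0 : ℝ)..1, f (x, t) := by
  induction N with
  | zero =>
    intro F _ _ f hf
    exact contDiff_zero.2 (intervalIntegral.continuous_parametric_intervalIntegral_of_continuous'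
      (f := fun x t => f (x, t)) hf.continuous 0 1)
  | succ N ih =>
    intro F _ _ f hf
    have h1 := fun x => hasFDerivAt_intervalIntegral_of_contDiff hf x
    have h2 : ContDiff ℝ ∞ fun z : X × ℝ => fderiv ℝ (fun y => f (y, z.2)) z.1 := by
      have h2 : ContDiff ℝ ∞ (Function.uncurry fun (z : X × ℝ) y => f (y, z.2)) :=
        hf.comp (contDiff_snd.prodMk (contDiff_snd.comp contDiff_fst))
      exact h2.fderiv (m := ∞) contDiff_fst (by simp)
    rw [Nat.cast_add, Nat.cast_one, contDiff_succ_iff_fderiv]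
    refine ⟨fun x => (h1 x).differentiableAt, by simp, ?_⟩
    rw [show fderiv ℝ (fun x => ∫ t in (0 : ℝ)..1, f (x, t)) = _ from funext fun x => (h1 x).fderiv]
    exact ih h2

/-- The integral over an interval of a smooth function is smooth in the parameters. -/
theorem contDiff_intervalIntegral {f : X × ℝ → F} (hf : ContDiff ℝ ∞ f) :
    ContDiff ℝ ∞ fun x => ∫ t in (0 : ℝ)..1, f (x, t) :=
  contDiff_infty.2 fun N => contDiff_nat_intervalIntegral N hf

end ParametricIntegral

section Cone

variable {E F : Type} [NormedAddCommGroup E] [NormedSpace ℝ E]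
  [NormedAddCommGroup F] [NormedSpace ℝ F] {k : ℕ}

open ContinuousAlternatingMap

/-- Cartan's formula for constant vector fields, in linear algebra. -/
theorem alternatizeUncurryFin_add_curryLeft (B : E →L[ℝ] E [⋀^Fin (k + 1)]→L[ℝ] F) (x : E)
    (A : E →L[ℝ] E [⋀^Fin k]→L[ℝ] F) (hA : ∀ u, A u = (B u).curryLeft x) :
    alternatizeUncurryFin A + (alternatizeUncurryFin B).curryLeft x = B x := by
  ext v
  rw [ContinuousAlternatingMap.add_apply, curryLeft_apply_apply, alternatizeUncurryFin_apply,
    alternatizeUncurryFin_apply, Fin.sum_univ_succ (n := k + 1)]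
  have h (i : Fin (k + 1)) : Fin.removeNth i.succ (Matrix.vecCons x v) =
      Matrix.vecCons x (Fin.removeNth i v) := by
    funext j
    refine Fin.cases ?_ (fun j => ?_) j <;> simp [Fin.removeNth]
  simp only [hA, h, curryLeft_apply_apply, pow_succ, Matrix.cons_val_succ, Fin.val_succ,
    mul_neg_one, neg_smul, Finset.sum_neg_distrib]
  have h0 : Fin.removeNth 0 (Matrix.vecCons x v) = v := rfl
  rw [h0]
  simp

theorem curryLeft_alternatizeUncurryFin_zero (B : E →L[ℝ] E [⋀^Fin 0]→L[ℝ] F) (x : E) :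
    (alternatizeUncurryFin B).curryLeft x = B x := by
  ext v
  rw [curryLeft_apply_apply, alternatizeUncurryFin_apply]
  simp

/-- The derivative along the rays. -/
theorem hasDerivAt_ray {η : E → F} (hη : ContDiff ℝ ∞ η) (x : E) (t : ℝ) :
    HasDerivAt (fun t : ℝ => η (t • x)) (fderiv ℝ η (t • x) x) t := by
  have h : HasDerivAt (fun t : ℝ => t • x) x t := by simpa using (hasDerivAt_id t).smul_const x
  exact ((hη.differentiable (by simp) (t • x)).hasFDerivAt).comp_hasDerivAt t h

theorem continuous_fderiv_ray {η : E → F} (hη : ContDiff ℝ ∞ η) (x : E) :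
    Continuous fun t : ℝ => fderiv ℝ η (t • x) :=
  ((hη.fderiv_right (m := ∞) (by simp)).continuous).comp (continuous_id.smul continuous_const)

theorem contDiff_curryLeft_apply {X : Type} [NormedAddCommGroup X] [NormedSpace ℝ X]
    {η : X → E [⋀^Fin (k + 1)]→L[ℝ] F} (hη : ContDiff ℝ ∞ η) {ξ : X → E} (hξ : ContDiff ℝ ∞ ξ) :
    ContDiff ℝ ∞ fun z => (η z).curryLeft (ξ z) := by
  have h : ContDiff ℝ ∞ (curryLeftLI (𝕜 := ℝ) (E := E) (F := F) (n := k)) :=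
    LinearIsometry.contDiff _
  exact (h.comp hη).clm_apply hξ

theorem integral_curryLeft_extDeriv_zero [CompleteSpace F] {η : E → E [⋀^Fin 0]→L[ℝ] F}
    (hη : ContDiff ℝ ∞ η) (x : E) :
    ∫ t in (0 : ℝ)..1, t ^ 0 • (extDeriv η (t • x)).curryLeft x = η x - η 0 := by
  have h1 (t : ℝ) : t ^ 0 • (extDeriv η (t • x)).curryLeft x = fderiv ℝ η (t • x) x := by
    rw [pow_zero, one_smul, extDeriv, curryLeft_alternatizeUncurryFin_zero]
  simp only [h1]
  rw [intervalIntegral.integral_eq_sub_of_hasDerivAt (fun t _ => hasDerivAt_ray hη x t)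
    (((continuous_fderiv_ray hη x).clm_apply continuous_const).intervalIntegrable _ _)]
  simp

variable {G H : Type} [NormedAddCommGroup G] [NormedSpace ℝ G] [NormedAddCommGroup H]
  [NormedSpace ℝ H]

theorem fderiv_pow_smul_apply (L : G →L[ℝ] E →L[ℝ] H) {η : E → G} (hη : ContDiff ℝ ∞ η) (x : E)
    (t : ℝ) (k : ℕ) : fderiv ℝ (fun y => t ^ k • L (η (t • y)) y) x =
      t ^ (k + 1) • (L.flip x ∘L fderiv ℝ η (t • x)) + t ^ k • L (η (t • x)) := by
  have h1 : HasFDerivAt (fun y : E => t • y) (t • ContinuousLinearMap.id ℝ E) x :=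
    (hasFDerivAt_id x).const_smul t
  have h2 : HasFDerivAt (fun y => η (t • y)) _ x :=
    (hη.differentiable (by simp) (t • x)).hasFDerivAt.comp x h1
  have h3 : HasFDerivAt (fun y => L (η (t • y))) _ x := L.hasFDerivAt.comp x h2
  have h4 := (h3.clm_apply (hasFDerivAt_id x)).const_smul (t ^ k)
  refine h4.fderiv.trans ?_
  ext u
  simp [pow_succ, mul_smul, smul_add]
  rw [add_comm]

theorem intervalIntegral_clm_apply [CompleteSpace G] [CompleteSpace H] (L : G →L[ℝ] H) {D : ℝ → G}
    (hD : Continuous D) : ∫ t in (0 : ℝ)..1, L (D t) = L (∫ t in (0 : ℝ)..1, D t) :=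
  L.intervalIntegral_comp_comm (hD.intervalIntegrable _ _)

/-- The Poincaré lemma: integration along the rays is a homotopy operator. -/
theorem extDeriv_integral_curryLeft_add [ProperSpace E] [CompleteSpace F]
    {η : E → E [⋀^Fin (k + 1)]→L[ℝ] F} (hη : ContDiff ℝ ∞ η) (x : E) :
    extDeriv (fun y => ∫ t in (0 : ℝ)..1, t ^ k • (η (t • y)).curryLeft y) x +
      ∫ t in (0 : ℝ)..1, t ^ (k + 1) • (extDeriv η (t • x)).curryLeft x = η x := by
  let C := (curryLeftLI (𝕜 := ℝ) (E := E) (F := F) (n := k)).toContinuousLinearMap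
  let f : E × ℝ → E [⋀^Fin k]→L[ℝ] F := fun y => y.2 ^ k • (η (y.2 • y.1)).curryLeft y.1
  have hf : ContDiff ℝ ∞ f := (contDiff_snd.pow k).smul
    (contDiff_curryLeft_apply (hη.comp (contDiff_snd.smul contDiff_fst)) contDiff_fst)
  let A (t : ℝ) : E →L[ℝ] E [⋀^Fin k]→L[ℝ] F := C.flip x ∘L fderiv ℝ η (t • x)
  -- the derivative of the integrand
  let D (t : ℝ) : E →L[ℝ] E [⋀^Fin k]→L[ℝ] F := fderiv ℝ (fun y => f (y, t)) x
  have hD (t : ℝ) : D t = t ^ (k + 1) • A t + t ^ k • (η (t • x)).curryLeft := by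
    exact fderiv_pow_smul_apply C hη x t k
  have hDc : Continuous D := by
    have h2 : ContDiff ℝ ∞ (Function.uncurry fun (t : ℝ) y => f (y, t)) :=
      hf.comp (contDiff_snd.prodMk contDiff_fst)
    have h3 : ContDiff ℝ ∞ D := h2.fderiv (m := ∞) contDiff_const (by simp)
    exact h3.continuous
  have hd : extDeriv (fun y => ∫ t in (0 : ℝ)..1, f (y, t)) x =
      ∫ t in (0 : ℝ)..1, alternatizeUncurryFin (D t) := by
    rw [extDeriv, (hasFDerivAt_intervalIntegral_of_contDiff hf x).fderiv]
    exact (intervalIntegral_clm_apply (alternatizeUncurryFinCLM ℝ E F) (D := D) hDc).symm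
  have hDc' : Continuous fun t => alternatizeUncurryFin (D t) :=
    (alternatizeUncurryFinCLM ℝ E F).continuous.comp hDc
  have h0 : ContDiff ℝ ∞ (alternatizeUncurryFinCLM ℝ E F (n := k + 1)) :=
    ContinuousLinearMap.contDiff _
  have h1 : ContDiff ℝ ∞ (fderiv ℝ η) := hη.fderiv_right (m := ∞) (by simp)
  have hη' : ContDiff ℝ ∞ fun y => alternatizeUncurryFinCLM ℝ E F (fderiv ℝ η y) := h0.comp h1
  have hIc : Continuous fun t : ℝ => t ^ (k + 1) • (extDeriv η (t • x)).curryLeft x :=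
    (continuous_pow _).smul (contDiff_curryLeft_apply
      (hη'.comp (contDiff_id.smul contDiff_const)) contDiff_const).continuous
  refine (congrArg (· + _) hd).trans ?_
  rw [← intervalIntegral.integral_add (hDc'.intervalIntegrable _ _)
    (hIc.intervalIntegrable _ _)]
  -- by Cartan's formula, the integrand is the derivative of `t ↦ t ^ (k + 1) • η (t • x)`
  have hsum (t : ℝ) : alternatizeUncurryFin (D t) +
      t ^ (k + 1) • (extDeriv η (t • x)).curryLeft x =
      t ^ (k + 1) • fderiv ℝ η (t • x) x + (((k + 1 : ℕ) : ℝ) * t ^ k) • η (t • x) := by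
    have h := alternatizeUncurryFin_add_curryLeft (fderiv ℝ η (t • x)) x (A t) fun u => rfl
    rw [hD, alternatizeUncurryFin_add, alternatizeUncurryFin_smul, alternatizeUncurryFin_smul,
      alternatizeUncurryFin_curryLeft, ← h, extDeriv]
    module
  simp only [hsum]
  rw [intervalIntegral.integral_eq_sub_of_hasDerivAt
    (f := fun t => t ^ (k + 1) • η (t • x)) (fun t _ => ?_) (Continuous.intervalIntegrable ?_ _ _)]
  · simp
  · refine ((continuous_pow _).smul
      ((continuous_fderiv_ray hη x).clm_apply continuous_const)).add ?_
    exact (continuous_const.mul (continuous_pow _)).smul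
      (hη.continuous.comp (continuous_id.smul continuous_const))
  · exact (hasDerivAt_pow (k + 1) t).smul (hasDerivAt_ray hη x t)

end Cone

section PoincareLemma

variable {n m : ℕ}

/-- The contraction of a form with the radial vector field, rescaled by the homothety of ratio
`t`. -/
def coneIntegrand {k : ℕ} (α : Form n m (k + 1)) (z : (Coord n × Coord m) × ℝ) : Cov n k :=
  z.2 ^ k • (α.1 (z.2 • z.1.1, z.1.2)).curryLeft z.1.1

theorem contDiff_coneIntegrand {k : ℕ} (α : Form n m (k + 1)) :
    ContDiff ℝ ∞ (coneIntegrand α) := by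
  have h1 : ContDiff ℝ ∞ fun z : (Coord n × Coord m) × ℝ => α.1 (z.2 • z.1.1, z.1.2) :=
    (Form.smooth α).comp
      ((contDiff_snd.smul (contDiff_fst.comp contDiff_fst)).prodMk (contDiff_snd.comp contDiff_fst))
  exact (contDiff_snd.pow k).smul (contDiff_curryLeft_apply h1 (contDiff_fst.comp contDiff_fst))

/-- The homotopy operator of the Poincaré lemma, given by integration along the rays from the
origin. -/
def coneForm (n m k : ℕ) : Form n m (k + 1) →ₗ[ℝ] Form n m k where
  toFun α := ⟨fun z => ∫ t in (0 : ℝ)..1, coneIntegrand α (z, t),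
    contDiff_intervalIntegral (contDiff_coneIntegrand α)⟩
  map_add' α β := by
    ext1
    funext z
    have h (γ : Form n m (k + 1)) : Continuous fun t => coneIntegrand γ (z, t) :=
      (contDiff_coneIntegrand γ).continuous.comp (by fun_prop)
    refine Eq.trans ?_ (intervalIntegral.integral_add ((h α).intervalIntegrable _ _)
      ((h β).intervalIntegrable _ _))
    refine intervalIntegral.integral_congr fun t _ => ?_
    exact smul_add (t ^ k) ((α.1 (t • z.1, z.2)).curryLeft z.1) ((β.1 (t • z.1, z.2)).curryLeft z.1)
  map_smul' c α := by
    ext1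
    funext z
    refine Eq.trans ?_ (intervalIntegral.integral_smul c fun t => coneIntegrand α (z, t))
    refine intervalIntegral.integral_congr fun t _ => ?_
    exact smul_comm (t ^ k) c ((α.1 (t • z.1, z.2)).curryLeft z.1)

theorem coneForm_dForm_zero (α : Form n m 0) (z : Coord n × Coord m) :
    (coneForm n m 0 (dForm n m 0 α)).1 z = α.1 z - α.1 (0, z.2) :=
  integral_curryLeft_extDeriv_zero (Form.slice α z.2) z.1

theorem dForm_coneForm_add {k : ℕ} (α : Form n m (k + 1)) :
    dForm n m k (coneForm n m k α) + coneForm n m (k + 1) (dForm n m (k + 1) α) = α := by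
  ext1
  funext z
  exact extDeriv_integral_curryLeft_add (Form.slice α z.2) z.1

/-- The homotopy operator of the Poincaré lemma in all degrees. -/
def cone (n m : ℕ) : Forms n m →ₗ[ℝ] Forms n m :=
  LinearMap.pi fun k => coneForm n m k ∘ₗ LinearMap.proj (k + 1)

/-- The value at the origin of the component of degree `0`. -/
def atOrigin (n m : ℕ) : Forms n m →ₗ[ℝ] Param m where
  toFun α := ⟨fun s => (α 0).1 (0, s) Fin.elim0,
    (ContinuousAlternatingMap.apply ℝ (Coord n) ℝ (Fin.elim0 : Fin 0 → Coord n)).contDiff.comp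
      ((Form.smooth (α 0)).comp (contDiff_const.prodMk contDiff_id))⟩
  map_add' _ _ := rfl
  map_smul' _ _ := rfl

/-- The Poincaré lemma, in families. -/
theorem dForms_cone_add_cone_dForms (α : Forms n m) :
    dForms n m (cone n m α) + cone n m (dForms n m α) + const n m (atOrigin n m α) = α := by
  funext k
  match k with
  | 0 =>
    change 0 + coneForm n m 0 (dForm n m 0 (α 0)) + const n m (atOrigin n m α) 0 = α 0
    ext z v
    change 0 + ((coneForm n m 0 (dForm n m 0 (α 0))).1 z) v + (α 0).1 (0, z.2) Fin.elim0 = _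
    rw [coneForm_dForm_zero, Subsingleton.elim v Fin.elim0]
    change 0 + ((α 0).1 z Fin.elim0 - (α 0).1 (0, z.2) Fin.elim0) + _ = _
    ring
  | k + 1 => exact (add_zero _).trans (dForm_coneForm_add (α (k + 1)))

theorem cone_const (r : Param m) : cone n m (const n m r) = 0 :=
  funext fun k => map_zero (coneForm n m k)

theorem atOrigin_const (r : Param m) : atOrigin n m (const n m r) = r := rfl

theorem cone_mem {P Q : ℕ → Prop} (hPQ : ∀ k, P (k + 1) → Q k) {α : Forms n m}
    (h : α ∈ formsIn n m P) : cone n m α ∈ formsIn n m Q :=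
  mem_formsIn.2 fun k hk => (congrArg (coneForm n m k)
    (mem_formsIn.1 h (k + 1) fun hP => hk (hPQ k hP))).trans (map_zero _)

theorem atOrigin_mem {P : ℕ → Prop} {Q : Prop} (hPQ : P 0 → Q) {α : Forms n m}
    (h : α ∈ formsIn n m P) : atOrigin n m α ∈ onlyIf (Param m) Q :=
  mem_onlyIf.2 fun hQ => by
    have := mem_formsIn.1 h 0 fun hP => hQ (hPQ hP)
    ext s
    change (α 0).1 (0, s) Fin.elim0 = 0
    rw [this]
    rfl

variable {m' : ℕ} {θ : Coord m' → Coord m} (hθ : ContDiff ℝ ∞ θ)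

theorem pullback_id_apply {k : ℕ} (α : Forms n m) (z : Coord n × Coord m') :
    (pullback (contDiff_id : ContDiff ℝ ∞ (id : Coord n → Coord n)) hθ α k).1 z =
      (α k).1 (z.1, θ z.2) := by
  ext v
  change (α k).1 (z.1, θ z.2) (fderiv ℝ id z.1 ∘ v) = _
  rw [fderiv_id]
  rfl

theorem pullback_id_cone (α : Forms n m) :
    pullback (contDiff_id : ContDiff ℝ ∞ (id : Coord n → Coord n)) hθ (cone n m α) =
      cone n m' (pullback contDiff_id hθ α) := by
  funext k
  ext1
  funext z
  rw [pullback_id_apply]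
  change ∫ t in (0 : ℝ)..1, _ = ∫ t in (0 : ℝ)..1, _
  refine intervalIntegral.integral_congr fun t _ => ?_
  change t ^ k • ((α (k + 1)).1 (t • z.1, θ z.2)).curryLeft z.1 =
    t ^ k • ((pullback contDiff_id hθ α (k + 1)).1 (t • z.1, z.2)).curryLeft z.1
  rw [pullback_id_apply]

theorem pullback_id_atOrigin (α : Forms n m) :
    pullbackParam hθ (atOrigin n m α) =
      atOrigin n m' (pullback (contDiff_id : ContDiff ℝ ∞ (id : Coord n → Coord n)) hθ α) := by
  ext s
  change (α 0).1 (0, θ s) Fin.elim0 = _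
  exact (congrArg (· Fin.elim0) (pullback_id_apply hθ α (0, s))).symm

end PoincareLemma

/-! ### The square of the Hodge star -/

section DoubleStar

variable {n k l : ℕ}

theorem sign_mul_sign {ι : Type} [Fintype ι] [DecidableEq ι] (s : Equiv.Perm ι) :
    ((Equiv.Perm.sign s : ℤ) : ℝ) * ((Equiv.Perm.sign s : ℤ) : ℝ) = 1 := by
  rw [← Int.cast_mul, ← Units.val_mul, Int.units_mul_self, Units.val_one, Int.cast_one]

theorem append_comp_cast_injective_iff (h : k + l = n) (i : Fin k → Fin n) (j : Fin l → Fin n) :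
    Function.Injective (fun a : Fin n =>
        (Fin.append i j : Fin (k + l) → Fin n) (Fin.cast h.symm a)) ↔
      Function.Injective i ∧ Function.Injective j ∧ ∀ a b, i a ≠ j b := by
  subst h
  exact Fin.append_injective_iff

theorem detSplit_stdVec (h : k + l = n) (i : Fin k → Fin n) (j : Fin l → Fin n) :
    detSplit h (fun a => stdVec (i a)) (fun a => stdVec (j a)) =
      ((1 : Matrix (Fin n) (Fin n) ℝ).submatrix
        (fun a : Fin n => (Fin.append i j : Fin (k + l) → Fin n) (Fin.cast h.symm a)) id).det := by
  rw [detSplit_apply]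
  congr 1
  ext a b
  subst h
  simp only [Matrix.of_apply, Matrix.submatrix_apply, id, Fin.cast_refl, Matrix.one_apply, stdVec]
  refine Fin.addCases (fun c => ?_) (fun c => ?_) a
  · simp [Pi.single_apply, eq_comm]
  · simp [Pi.single_apply, eq_comm]

theorem detSplit_stdVec_eq_zero (h : k + l = n) {i : Fin k → Fin n} {j : Fin l → Fin n}
    (hij : ¬ (Function.Injective i ∧ Function.Injective j ∧ ∀ a b, i a ≠ j b)) :
    detSplit h (fun a => stdVec (i a)) (fun a => stdVec (j a)) = 0 := by
  rw [← append_comp_cast_injective_iff h, Function.Injective] at hij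
  push Not at hij
  obtain ⟨a, b, hab, hne⟩ := hij
  rw [detSplit_stdVec]
  refine Matrix.det_zero_of_row_eq hne ?_
  ext c
  exact congrArg (fun x => (1 : Matrix (Fin n) (Fin n) ℝ) x c) hab

theorem detSplit_stdVec_mul_self (h : k + l = n) {i : Fin k → Fin n} {j : Fin l → Fin n}
    (hij : Function.Injective i ∧ Function.Injective j ∧ ∀ a b, i a ≠ j b) :
    detSplit h (fun a => stdVec (i a)) (fun a => stdVec (j a)) *
      detSplit h (fun a => stdVec (i a)) (fun a => stdVec (j a)) = 1 := by
  rw [← append_comp_cast_injective_iff h] at hij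
  rw [detSplit_stdVec]
  have h1 := Matrix.det_permute (Equiv.ofBijective _ (Finite.injective_iff_bijective.1 hij))
    (1 : Matrix (Fin n) (Fin n) ℝ)
  rw [Matrix.det_one, mul_one] at h1
  change Matrix.det (Matrix.submatrix 1 _ id) = _ at h1
  rw [Equiv.coe_ofBijective] at h1
  rw [h1]
  exact sign_mul_sign _

theorem detSplit_comp_perm_left (h : k + l = n) (u : Fin k → Coord n) (w : Fin l → Coord n)
    (s : Equiv.Perm (Fin k)) :
    detSplit h (u ∘ s) w = (Equiv.Perm.sign s : ℤ) * detSplit h u w := by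
  subst h
  rw [detSplit_apply, detSplit_apply]
  have h1 := Matrix.det_permute (finSumFinEquiv.permCongr (s.sumCongr (Equiv.refl (Fin l))))
    (Matrix.of fun a : Fin (k + l) => (Fin.append u w : Fin (k + l) → Coord (k + l)) a)
  rw [Equiv.Perm.sign_permCongr, Equiv.Perm.sign_sumCongr, Equiv.Perm.sign_refl, mul_one] at h1
  refine Eq.trans ?_ h1
  congr 1
  ext a b
  simp only [Matrix.of_apply, Matrix.submatrix_apply, id, Fin.cast_refl]
  refine Fin.addCases (fun c => ?_) (fun c => ?_) a
  · simp
  · simp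

/-- Moving the last `l` rows of a determinant in front of the first `k` rows. -/
theorem exists_detSplit_swap (h : k + l = n) (h' : l + k = n) :
    ∃ δ : ℝ, δ * δ = 1 ∧ ∀ (u : Fin k → Coord n) (w : Fin l → Coord n),
      detSplit h' w u = δ * detSplit h u w := by
  subst h
  let s : Equiv.Perm (Fin (k + l)) :=
    ((finCongr h'.symm).trans (finSumFinEquiv.symm.trans (Equiv.sumComm _ _))).trans finSumFinEquiv
  refine ⟨(Equiv.Perm.sign s : ℤ), sign_mul_sign s, fun u w => ?_⟩
  rw [detSplit_apply, detSplit_apply]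
  refine Eq.trans ?_ (Matrix.det_permute s _)
  congr 1
  ext a b
  obtain ⟨a, rfl⟩ := (finCongr h').surjective a
  simp only [Matrix.of_apply, Matrix.submatrix_apply, id, Fin.cast_refl]
  refine Fin.addCases (fun c => ?_) (fun c => ?_) a
  · simp [s]
  · simp [s]

/-- A sum over multi-indices that is supported on those complementary to `j` is a sum over the
permutations of one of them. -/
theorem sum_complementary (h : k + l = n) {r : Fin k → Fin n} {j : Fin l → Fin n}
    (hrj : Function.Injective r ∧ Function.Injective j ∧ ∀ a b, r a ≠ j b) (f : (Fin k → Fin n) → ℝ)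
    (hf : ∀ i, ¬ (Function.Injective i ∧ Function.Injective j ∧ ∀ a b, i a ≠ j b) → f i = 0) :
    ∑ i, f i = ∑ s : Equiv.Perm (Fin k), f (r ∘ s) := by
  symm
  refine Fintype.sum_of_injective (fun s : Equiv.Perm (Fin k) => r ∘ s) ?_ _ _ ?_ fun _ => rfl
  · intro s t hst
    exact Equiv.ext fun a => hrj.1 (congrFun hst a)
  · intro i hi
    by_contra h0
    have hij := not_imp_comm.1 (hf i) h0
    have hsurj := (Finite.injective_iff_surjective.1 ((append_comp_cast_injective_iff h r j).2 hrj))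
    have h1 (a : Fin k) : ∃ b, r b = i a := by
      obtain ⟨c, hc⟩ := hsurj (i a)
      change Fin.append r j (Fin.cast h.symm c) = i a at hc
      generalize Fin.cast h.symm c = d at hc
      induction d using Fin.addCases with
      | left b => exact ⟨b, by simpa using hc⟩
      | right b => exact absurd (by simpa using hc.symm) (hij.2.2 a b)
    choose s hs using h1
    have hsi : Function.Injective s := fun a b hab => hij.1 (by rw [← hs, ← hs, hab])
    exact hi ⟨Equiv.ofBijective s (Finite.injective_iff_bijective.1 hsi), funext hs⟩

theorem exists_complementary (h : k + l = n) {r : Fin k → Fin n} (hr : Function.Injective r) :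
    ∃ j : Fin l → Fin n, Function.Injective r ∧ Function.Injective j ∧ ∀ a b, r a ≠ j b := by
  classical
  have hc : Fintype.card {x // x ∉ Set.range r} = Fintype.card (Fin l) := by
    rw [Fintype.card_subtype_compl, Fintype.card_fin, Fintype.card_fin]
    have : Fintype.card {x // x ∈ Set.range r} = k :=
      (Set.card_range_of_injective hr).trans (Fintype.card_fin k)
    omega
  obtain ⟨e⟩ := Fintype.card_eq.1 hc
  exact ⟨fun b => (e.symm b).1, hr, fun a b hab => e.symm.injective (Subtype.ext hab),
    fun a b hab => (e.symm b).2 ⟨a, hab⟩⟩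

theorem sum_cov_mul_detSplit (h : k + l = n) (α : Cov n k) {r : Fin k → Fin n}
    {j : Fin l → Fin n} (hrj : Function.Injective r ∧ Function.Injective j ∧ ∀ a b, r a ≠ j b) :
    ∑ i : Fin k → Fin n, (α fun a => stdVec (i a)) *
        detSplit h (fun a => stdVec (i a)) (fun a => stdVec (j a)) =
      k.factorial * ((α fun a => stdVec (r a)) *
        detSplit h (fun a => stdVec (r a)) (fun a => stdVec (j a))) := by
  rw [sum_complementary h hrj]
  · have hs (s : Equiv.Perm (Fin k)) : (α fun a => stdVec ((r ∘ s) a)) *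
        detSplit h (fun a => stdVec ((r ∘ s) a)) (fun a => stdVec (j a)) =
        (α fun a => stdVec (r a)) *
          detSplit h (fun a => stdVec (r a)) (fun a => stdVec (j a)) := by
      have h1 := detSplit_comp_perm_left h (fun a => stdVec (r a)) (fun a => stdVec (j a)) s
      have h2 : α (fun a => stdVec ((r ∘ s) a)) =
          (Equiv.Perm.sign s : ℤ) * α fun a => stdVec (r a) := by
        have := α.toAlternatingMap.map_perm (fun a => stdVec (r a)) s
        refine this.trans ?_
        rw [Units.smul_def, zsmul_eq_mul]
        rfl
      have h3 := sign_mul_sign s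
      rw [h2]
      refine (congrArg (_ * ·) h1).trans ?_
      linear_combination ((α fun a => stdVec (r a)) *
          detSplit h (fun a => stdVec (r a)) (fun a => stdVec (j a))) * h3
    simp only [hs, Finset.sum_const, Finset.card_univ, Fintype.card_perm, Fintype.card_fin,
      nsmul_eq_mul]
  · intro i hi
    rw [detSplit_stdVec_eq_zero h hi, mul_zero]

theorem sum_detSplit_mul_self (h : k + l = n) {r : Fin k → Fin n} (hr : Function.Injective r) :
    ∑ j : Fin l → Fin n, detSplit h (fun a => stdVec (r a)) (fun a => stdVec (j a)) *
      detSplit h (fun a => stdVec (r a)) (fun a => stdVec (j a)) = l.factorial := by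
  obtain ⟨j₀, hj₀⟩ := exists_complementary h hr
  have hsymm (j : Fin l → Fin n) : (Function.Injective j ∧ Function.Injective r ∧
      ∀ a b, j a ≠ r b) ↔ (Function.Injective r ∧ Function.Injective j ∧ ∀ a b, r a ≠ j b) :=
    ⟨fun H => ⟨H.2.1, H.1, fun a b => (H.2.2 b a).symm⟩,
      fun H => ⟨H.2.1, H.1, fun a b => (H.2.2 b a).symm⟩⟩
  rw [sum_complementary ((add_comm l k).trans h) ((hsymm j₀).2 hj₀)]
  · have hs (s : Equiv.Perm (Fin l)) :
        detSplit h (fun a => stdVec (r a)) (fun a => stdVec ((j₀ ∘ s) a)) *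
        detSplit h (fun a => stdVec (r a)) (fun a => stdVec ((j₀ ∘ s) a)) = 1 :=
      detSplit_stdVec_mul_self h ⟨hr, hj₀.2.1.comp s.injective, fun a b => hj₀.2.2 a (s b)⟩
    simp only [hs, Finset.sum_const, Finset.card_univ, Fintype.card_perm, Fintype.card_fin,
      nsmul_eq_mul, mul_one]
  · intro j hj
    rw [detSplit_stdVec_eq_zero h (fun H => hj ((hsymm j).2 H)), mul_zero]

/-- The Hodge star for the standard inner product squares, up to the normalisation by factorials and
the order of the arguments of the determinant, to the identity. -/
theorem sum_sum_detSplit (h : k + l = n) (α : Cov n k) (r : Fin k → Fin n) :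
    ∑ j : Fin l → Fin n, (∑ i : Fin k → Fin n, (α fun a => stdVec (i a)) *
        detSplit h (fun a => stdVec (i a)) (fun a => stdVec (j a))) *
      detSplit h (fun a => stdVec (r a)) (fun a => stdVec (j a)) =
      (k.factorial * l.factorial) * α fun a => stdVec (r a) := by
  by_cases hr : Function.Injective r
  · have hj (j : Fin l → Fin n) : (∑ i : Fin k → Fin n, (α fun a => stdVec (i a)) *
        detSplit h (fun a => stdVec (i a)) (fun a => stdVec (j a))) *
        detSplit h (fun a => stdVec (r a)) (fun a => stdVec (j a)) =
        (k.factorial * α fun a => stdVec (r a)) *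
          (detSplit h (fun a => stdVec (r a)) (fun a => stdVec (j a)) *
            detSplit h (fun a => stdVec (r a)) (fun a => stdVec (j a))) := by
      by_cases hrj : Function.Injective r ∧ Function.Injective j ∧ ∀ a b, r a ≠ j b
      · rw [sum_cov_mul_detSplit h α hrj]
        ring
      · rw [detSplit_stdVec_eq_zero h hrj]
        ring
    simp only [hj]
    rw [← Finset.mul_sum, sum_detSplit_mul_self h hr]
    ring
  · have h1 : (α fun a => stdVec (r a)) = 0 := by
      rw [Function.Injective] at hr
      push Not at hr
      obtain ⟨a, b, hab, hne⟩ := hr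
      exact α.map_eq_zero_of_eq _ (by rw [hab]) hne
    rw [h1, mul_zero]
    refine Finset.sum_eq_zero fun j _ => ?_
    rw [detSplit_stdVec_eq_zero h (fun H => hr H.1), mul_zero]

theorem Signature.IsGram.transpose_eq {σ : Signature} {G : Matrix (Fin n) (Fin n) ℝ}
    (hG : σ.IsGram G) : Gᵀ = G := by
  obtain ⟨P, hP, h⟩ := hG
  have hPu : IsUnit P.det := isUnit_iff_ne_zero.2 hP
  have h1 : Pᵀ * Gᵀ * P = Pᵀ * G * P := by
    have := congrArg Matrix.transpose h
    rw [Matrix.transpose_mul, Matrix.transpose_mul, Matrix.transpose_transpose, ← Matrix.mul_assoc,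
      Signature.flat, Matrix.diagonal_transpose] at this
    rw [this, h, Signature.flat]
  have h2 := congrArg (· * P⁻¹) h1
  simp only [Matrix.mul_assoc, Matrix.mul_nonsing_inv _ hPu, Matrix.mul_one] at h2
  have h3 := congrArg (Pᵀ⁻¹ * ·) h2
  have hPt : IsUnit Pᵀ.det := by rwa [Matrix.det_transpose]
  simpa only [← Matrix.mul_assoc, Matrix.nonsing_inv_mul _ hPt, Matrix.one_mul] using h3

theorem Signature.flat_det_mul_self (σ : Signature) (n : ℕ) :
    (σ.flat n).det * (σ.flat n).det = 1 := by
  rw [Signature.flat, Matrix.det_diagonal, ← Finset.prod_mul_distrib]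
  refine Finset.prod_eq_one fun i _ => ?_
  cases σ
  · simp
  · by_cases hi : i.val = 0 <;> simp [hi]

/-- The sign of the determinant of a Gram matrix is determined by the signature. -/
theorem Signature.IsGram.abs_det {σ : Signature} {G : Matrix (Fin n) (Fin n) ℝ}
    (hG : σ.IsGram G) : |G.det| = (σ.flat n).det * G.det := by
  have h0 := hG.det_ne_zero
  obtain ⟨P, hP, h⟩ := hG
  have h1 := congrArg Matrix.det h
  rw [Matrix.det_mul, Matrix.det_mul, Matrix.det_transpose] at h1
  have h2 := σ.flat_det_mul_self n
  have hP2 : 0 < P.det * P.det := mul_self_pos.2 hP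
  rcases mul_self_eq_one_iff.1 h2 with h3 | h3 <;> rw [h3] at h1 ⊢
  · rw [abs_of_pos (by nlinarith), one_mul]
  · rw [abs_of_neg (by nlinarith), neg_one_mul]

theorem hodgeStar_hodgeStar_of_swap {σ : Signature} (h : k + l = n) (h' : l + k = n) {δ : ℝ}
    (hδ : ∀ (u : Fin k → Coord n) (w : Fin l → Coord n),
      detSplit h' w u = δ * detSplit h u w) {G : Matrix (Fin n) (Fin n) ℝ} (hG : σ.IsGram G)
    (α : Cov n k) : hodgeStar h' G (hodgeStar h G α) = ((σ.flat n).det * δ) • α := by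
  have hGu : IsUnit G.det := isUnit_iff_ne_zero.2 hG.det_ne_zero
  have hcol (i : Fin n) : G⁻¹ i = G⁻¹ *ᵥ stdVec i := by
    ext b
    have : (G⁻¹)ᵀ = G⁻¹ := by rw [Matrix.transpose_nonsing_inv, hG.transpose_eq]
    rw [stdVec, Matrix.mulVec_single_one]
    exact congrFun (congrFun this.symm i) b
  -- the two inverse metrics cancel against the determinant
  have key (j : Fin l → Fin n) : ∑ i : Fin k → Fin n, (α fun a => G⁻¹ (i a)) *
      detSplit h (fun b => stdVec (i b)) (fun b => G⁻¹ (j b)) =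
      G.det⁻¹ * ∑ i : Fin k → Fin n, (α fun a => stdVec (i a)) *
        detSplit h (fun b => stdVec (i b)) (fun b => stdVec (j b)) := by
    have h1 (i : Fin k → Fin n) : (α fun a => G⁻¹ (i a)) =
        ∑ r : Fin k → Fin n, (∏ a, G⁻¹ (i a) (r a)) * α fun a => stdVec (r a) := cov_apply α _
    simp only [h1, Finset.sum_mul]
    rw [Finset.sum_comm, Finset.mul_sum]
    refine Finset.sum_congr rfl fun r _ => ?_
    have h2 : detSplit h (fun b => G⁻¹ *ᵥ stdVec (r b)) (fun b => G⁻¹ *ᵥ stdVec (j b)) =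
        G.det⁻¹ * detSplit h (fun b => stdVec (r b)) (fun b => stdVec (j b)) := by
      rw [detSplit_mul, Matrix.det_nonsing_inv, Ring.inverse_eq_inv']
    have h3 : (fun b => G⁻¹ *ᵥ stdVec (r b)) = fun b : Fin k => ∑ c, G⁻¹ c (r b) • stdVec c := by
      funext b
      rw [eq_sum_stdVec (G⁻¹ *ᵥ stdVec (r b))]
      refine Finset.sum_congr rfl fun c _ => ?_
      simp [stdVec]
    rw [h3, MultilinearMap.map_sum, sum_apply] at h2
    have h4 (i : Fin k → Fin n) : (detSplit h fun a => G⁻¹ (i a) (r a) • stdVec (i a))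
        (fun b => G⁻¹ *ᵥ stdVec (j b)) = (∏ a, G⁻¹ (i a) (r a)) *
          detSplit h (fun b => stdVec (i b)) (fun b => G⁻¹ (j b)) := by
      rw [MultilinearMap.map_smul_univ]
      simp only [hcol (j _)]
      rfl
    simp only [h4] at h2
    rw [mul_left_comm, ← h2, Finset.mul_sum]
    exact Finset.sum_congr rfl fun i _ => by ring
  ext w
  rw [hodgeStar_apply]
  simp only [hodgeStar_apply, key]
  rw [ContinuousAlternatingMap.smul_apply, smul_eq_mul, cov_apply α w]
  have hw (j : Fin l → Fin n) : detSplit h' (fun b => stdVec (j b)) w =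
      ∑ r : Fin k → Fin n, (∏ a, w a (r a)) *
        (δ * detSplit h (fun b => stdVec (r b)) (fun b => stdVec (j b))) := by
    refine (cov_apply (volumeContraction h' j) w).trans (Finset.sum_congr rfl fun r _ => ?_)
    rw [← hδ]
    rfl
  simp only [hw, Finset.mul_sum]
  rw [Finset.sum_comm]
  refine Finset.sum_congr rfl fun r _ => ?_
  have h5 := sum_sum_detSplit h α r
  have h6 : √|G.det| * √|G.det| = (σ.flat n).det * G.det := by
    rw [Real.mul_self_sqrt (abs_nonneg _), hG.abs_det]
  have h7 := hG.det_ne_zero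
  have h8 : (k.factorial : ℝ) ≠ 0 := Nat.cast_ne_zero.2 k.factorial_ne_zero
  have h9 : (l.factorial : ℝ) ≠ 0 := Nat.cast_ne_zero.2 l.factorial_ne_zero
  trans √|G.det| * √|G.det| / (k.factorial * l.factorial) * G.det⁻¹ * (∏ a, w a (r a)) * δ *
    ((k.factorial * l.factorial) * α fun a => stdVec (r a))
  · rw [← h5, Finset.mul_sum]
    refine Finset.sum_congr rfl fun j _ => ?_
    simp only [← Finset.mul_sum]
    ring
  · rw [h6]
    field_simp

/-- Applying the Hodge star twice is multiplication by a nonzero constant, which only depends on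
the degree and the signature. -/
theorem exists_hodgeStar_hodgeStar (σ : Signature) (h : k + l = n) (h' : l + k = n) :
    ∃ ε : ℝ, ε ≠ 0 ∧ ∀ G : Matrix (Fin n) (Fin n) ℝ, σ.IsGram G →
      (∀ α : Cov n k, hodgeStar h' G (hodgeStar h G α) = ε • α) ∧
      ∀ β : Cov n l, hodgeStar h G (hodgeStar h' G β) = ε • β := by
  obtain ⟨δ, hδ, hswap⟩ := exists_detSplit_swap h h'
  have hswap' (w : Fin l → Coord n) (u : Fin k → Coord n) :
      detSplit h u w = δ * detSplit h' w u := by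
    rw [hswap, ← mul_assoc, hδ, one_mul]
  refine ⟨(σ.flat n).det * δ, ?_, fun G hG => ⟨hodgeStar_hodgeStar_of_swap h h' hswap hG,
    hodgeStar_hodgeStar_of_swap h' h hswap' hG⟩⟩
  intro h0
  have h1 := σ.flat_det_mul_self n
  have : ((σ.flat n).det * δ) * ((σ.flat n).det * δ) = 1 := by
    linear_combination (δ * δ) * h1 + hδ
  rw [h0] at this
  simp at this

theorem Patch.star_apply {σ : Signature} (V : Patch σ n) {m : ℕ} (h : k + l = n) (α : Forms n m) :
    V.star m α l = V.starForm m h (α k) := by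
  obtain rfl : k = n - l := by omega
  simp only [Patch.star, LinearMap.pi_apply, dif_pos (show l ≤ n by omega)]
  rfl

/-- The constant does not depend on the coordinate patch, so that it can enter natural maps of
theories. -/
theorem exists_star_star (σ : Signature) (h : k + l = n) :
    ∃ ε : ℝ, ε ≠ 0 ∧ ∀ (V : Patch σ n) (m : ℕ) (α : Forms n m),
      V.star m (V.star m α) k = ε • α k ∧ V.star m (V.star m α) l = ε • α l := by
  have h' : l + k = n := (add_comm l k).trans h
  obtain ⟨ε, hε, H⟩ := exists_hodgeStar_hodgeStar σ h h'
  refine ⟨ε, hε, fun V m α => ⟨?_, ?_⟩⟩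
  · rw [V.star_apply h', V.star_apply h]
    ext1
    funext z
    exact (H _ (V.isGram_metric z.1)).1 _
  · rw [V.star_apply h, V.star_apply h']
    ext1
    funext z
    exact (H _ (V.isGram_metric z.1)).2 _

end DoubleStar

/-! ### Maps and homotopies of graded groups with differentials -/

/-- An additive map that preserves the degree and commutes with the differential on homogeneous
elements. -/
structure DiffGroup.GradedHom (A B : DiffGroup) where
  map : A.carrier →+ B.carrier
  mem (i : ℤ) (x : A.carrier) : x ∈ A.degree i → map x ∈ B.degree i
  comm (i : ℤ) (x : A.carrier) : x ∈ A.degree i → map (A.diff x) = B.diff (map x)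

/-- An additive map that lowers the degree by one, and whose graded commutator with the differential
is the identity minus the endomorphism `e`. -/
structure DiffGroup.Contraction (A : DiffGroup) (e : A.carrier → A.carrier) where
  map : A.carrier →+ A.carrier
  mem (i j : ℤ) (x : A.carrier) : j + 1 = i → x ∈ A.degree i → map x ∈ A.degree j
  comm (i : ℤ) (x : A.carrier) : x ∈ A.degree i → x = map (A.diff x) + A.diff (map x) + e x

section GradedMap

variable {J : Type} [Category.{0} J] {K L : J ⥤ DiffGroup}

/-- A natural family of maps that preserve the degree and commute with the differential on
homogeneous elements. -/
structure GradedMap (K L : J ⥤ DiffGroup) where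
  hom (X : J) : DiffGroup.GradedHom (K.obj X) (L.obj X)
  natural {X Y : J} (u : X ⟶ Y) (x : (K.obj X).carrier) :
    (hom Y).map ((K.map u).map x) = (L.map u).map ((hom X).map x)

namespace GradedMap

/-- The map of complexes given by a graded map. -/
def toNatTrans (f : GradedMap K L) : K ⋙ DiffGroup.toComplex ⟶ L ⋙ DiffGroup.toComplex where
  app X :=
    { f := fun i => AddCommGrpCat.ofHom
        { toFun := fun x => ⟨(f.hom X).map x.1, (f.hom X).mem i x.1 x.2⟩
          map_zero' := Subtype.ext (map_zero ((f.hom X).map))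
          map_add' := fun x y => Subtype.ext (map_add ((f.hom X).map) x.1 y.1) }
      comm' := by
        intro i j hij
        change i + 1 = j at hij
        change AddCommGrpCat.ofHom _ ≫
            (if h : i + 1 = j then AddCommGrpCat.ofHom ((L.obj X).restrictDiff h) else 0) =
          (if h : i + 1 = j then AddCommGrpCat.ofHom ((K.obj X).restrictDiff h) else 0) ≫
            AddCommGrpCat.ofHom _
        rw [dif_pos hij, dif_pos hij]
        ext x
        exact ((f.hom X).comm i x.1 x.2).symm }
  naturality X Y u := by
    ext i x
    exact Subtype.ext (f.natural u x.1)

end GradedMap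

/-- A natural family of contractions onto the endomorphisms `e`. -/
structure GradedHomotopy (e : ∀ X : J, (K.obj X).carrier → (K.obj X).carrier) where
  contraction (X : J) : DiffGroup.Contraction (K.obj X) (e X)
  natural {X Y : J} (u : X ⟶ Y) (x : (K.obj X).carrier) :
    (contraction Y).map ((K.map u).map x) = (K.map u).map ((contraction X).map x)

/-- The component of a graded homotopy on elements of degree `i`, with values in degree `j`, with
the sign that is appropriate for a homotopy from `e` to the identity. -/
def GradedHomotopy.component {e : ∀ X : J, (K.obj X).carrier → (K.obj X).carrier}
    (H : GradedHomotopy e) (X : J) (i j : ℤ) (hij : j + 1 = i) :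
    (K.obj X).degree i →+ (K.obj X).degree j where
  toFun x := ⟨-(H.contraction X).map x.1, neg_mem ((H.contraction X).mem i j x.1 hij x.2)⟩
  map_zero' := by ext; simp
  map_add' x y := by
    ext
    change -(H.contraction X).map (x.1 + y.1) =
      -(H.contraction X).map x.1 + -(H.contraction X).map y.1
    rw [map_add, neg_add]

/-- The components of a graded homotopy as maps of abelian groups. -/
def GradedHomotopy.hom {e : ∀ X : J, (K.obj X).carrier → (K.obj X).carrier}
    (H : GradedHomotopy e) (X : J) (i j : ℤ) :
    AddCommGrpCat.of ((K.obj X).degree i) ⟶ AddCommGrpCat.of ((K.obj X).degree j) :=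
  if hij : j + 1 = i then AddCommGrpCat.ofHom (H.component X i j hij) else 0

theorem GradedHomotopy.hom_apply {e : ∀ X : J, (K.obj X).carrier → (K.obj X).carrier}
    (H : GradedHomotopy e) (X : J) {i j : ℤ} (hij : j + 1 = i) (x : (K.obj X).degree i) :
    (H.hom X i j).hom x = H.component X i j hij x := by
  exact congrArg (fun a : AddCommGrpCat.of _ ⟶ AddCommGrpCat.of _ => a.hom x) (dif_pos hij)

theorem toComplex_d_apply (A : DiffGroup) {i j : ℤ} (hij : i + 1 = j) (x : A.degree i) :
    ((DiffGroup.toComplex.obj A).d i j).hom x = A.restrictDiff hij x := by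
  change (if h : i + 1 = j then AddCommGrpCat.ofHom (A.restrictDiff h) else 0).hom x = _
  rw [dif_pos hij]
  rfl

theorem GradedHomotopy.nonempty_naturalHomotopy (f : GradedMap K L) (g : GradedMap L K)
    (H : GradedHomotopy fun X x => (g.hom X).map ((f.hom X).map x)) :
    Nonempty (NaturalHomotopy (f.toNatTrans ≫ g.toNatTrans) (𝟙 (K ⋙ DiffGroup.toComplex))) := by
  refine ⟨⟨fun i j X => H.hom X i j, fun i j X Y u => ?_, fun X i j k hij hjk => ?_⟩⟩
  · by_cases hij : j + 1 = i
    · refine AddCommGrpCat.hom_ext (AddMonoidHom.ext fun x => ?_)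
      refine (H.hom_apply Y hij _).trans (Eq.trans ?_
        (congrArg ((DiffGroup.toComplex.map (K.map u)).f j).hom (H.hom_apply X hij x)).symm)
      refine Subtype.ext ?_
      exact (congrArg Neg.neg (H.natural u x.1)).trans (map_neg (K.map u).map _).symm
    · have h (X : J) : H.hom X i j = 0 := dif_neg hij
      rw [h, h]
      exact comp_zero.trans zero_comp.symm
  · refine AddCommGrpCat.hom_ext (AddMonoidHom.ext fun x => ?_)
    have h1 : (H.hom X k j).hom (((DiffGroup.toComplex.obj (K.obj X)).d j k).hom x) =
        H.component X k j hjk ((K.obj X).restrictDiff hjk x) :=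
      (H.hom_apply X hjk _).trans (congrArg _ (toComplex_d_apply _ hjk x))
    have h2 : ((DiffGroup.toComplex.obj (K.obj X)).d i j).hom ((H.hom X j i).hom x) =
        (K.obj X).restrictDiff hij (H.component X j i hij x) :=
      (congrArg _ (H.hom_apply X hij x)).trans (toComplex_d_apply _ hij _)
    refine Eq.trans ?_ (congrArg₂ (fun a b => a + b + x) h1 h2).symm
    refine Subtype.ext ?_
    change (g.hom X).map ((f.hom X).map x.1) = -(H.contraction X).map ((K.obj X).diff x.1) +
      (K.obj X).diff (-(H.contraction X).map x.1) + x.1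
    have h (G : Type) [AddCommGroup G] (x a b c : G) (hx : x = a + b + c) : c = -a + -b + x := by
      rw [hx]
      abel
    rw [map_neg]
    exact h _ _ _ _ _ ((H.contraction X).comm j x.1 x.2)

theorem GradedMap.isNaturalHomotopyEquiv (f : GradedMap K L) (g : GradedMap L K)
    (H : GradedHomotopy fun X x => (g.hom X).map ((f.hom X).map x))
    (H' : GradedHomotopy fun X x => (f.hom X).map ((g.hom X).map x)) :
    IsNaturalHomotopyEquiv f.toNatTrans :=
  ⟨g.toNatTrans, H.nonempty_naturalHomotopy, H'.nonempty_naturalHomotopy⟩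

end GradedMap

section Patchwise

variable {σ : Signature} {n : ℕ}

/-- The restriction of a graded map to a coordinate patch. -/
def GradedMap.atPatch {K L : (PatchCat σ n)ᵒᵖ × CartSpᵒᵖ ⥤ DiffGroup} (f : GradedMap K L)
    (V : (PatchCat σ n)ᵒᵖ) :
    GradedMap ((Functor.curry.obj K).obj V) ((Functor.curry.obj L).obj V) where
  hom X := f.hom (V, X)
  natural _ := f.natural _

theorem isPatchwiseHomotopyEquiv_of_gradedMap {K L : (PatchCat σ n)ᵒᵖ × CartSpᵒᵖ ⥤ DiffGroup}
    (f : GradedMap K L)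
    (h : ∀ V, IsNaturalHomotopyEquiv (f.atPatch V).toNatTrans) :
    IsPatchwiseHomotopyEquiv (K := Functor.curry.obj (K ⋙ DiffGroup.toComplex))
      (L := Functor.curry.obj (L ⋙ DiffGroup.toComplex)) (Functor.curry.map f.toNatTrans) :=
  h

end Patchwise

/-! ### Operations on families of forms -/

section Operations

variable {n m : ℕ}

theorem keep_apply (P : ℕ → Prop) [DecidablePred P] (α : Forms n m) (k : ℕ) :
    keep n m P α k = if P k then α k else 0 := by
  by_cases h : P k <;> simp [keep, h]

theorem alternate_apply (α : Forms n m) (k : ℕ) : alternate n m α k = (-1 : ℝ) ^ k • α k := rfl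

theorem dForms_apply_zero (α : Forms n m) : dForms n m α 0 = 0 := rfl

theorem cone_apply (α : Forms n m) (k : ℕ) : cone n m α k = coneForm n m k (α (k + 1)) := rfl

theorem const_apply_succ (r : Param m) (k : ℕ) : const n m r (k + 1) = 0 := rfl

theorem intConst_eq (z : ℤ) : intConst n m z = const n m (intParam m z) := rfl

theorem poincare_zero (α : Forms n m) :
    coneForm n m 0 (dForm n m 0 (α 0)) + const n m (atOrigin n m α) 0 = α 0 := by
  have h := congrFun (dForms_cone_add_cone_dForms α) 0
  rwa [Pi.add_apply, Pi.add_apply, dForms_apply_zero, zero_add] at h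

theorem poincare_succ (α : Forms n m) (k : ℕ) :
    dForm n m k (coneForm n m k (α (k + 1))) +
      coneForm n m (k + 1) (dForm n m (k + 1) (α (k + 1))) = α (k + 1) :=
  dForm_coneForm_add _

theorem atOrigin_eq_zero {α : Forms n m} (h : α 0 = 0) : atOrigin n m α = 0 := by
  ext s
  change (α 0).1 (0, s) Fin.elim0 = 0
  rw [h]
  rfl

theorem atOrigin_dForms (α : Forms n m) : atOrigin n m (dForms n m α) = 0 :=
  atOrigin_eq_zero rfl

end Operations

section Operations

variable {n m : ℕ}

/-- The Poincaré lemma for the complex of forms of degree at most `p`: the homotopy fails to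
contract only the forms of top degree `p`. -/
theorem poincare_truncated {p : ℕ} {C : Forms n m} (hC : ∀ k, ¬ k ≤ p → C k = 0) :
    cone n m (keep n m (· ≤ p) (dForms n m C)) + keep n m (· ≤ p) (dForms n m (cone n m C)) +
      const n m (atOrigin n m C) = C - cone n m (dForms n m (keep n m (· = p) C)) := by
  funext k
  match k with
  | 0 =>
    have h1 := poincare_zero C
    by_cases hp : p = 0
    · subst hp
      simp only [Pi.add_apply, Pi.sub_apply, cone_apply, keep_apply, dForms_apply_succ,
        dForms_apply_zero, zero_add, ↓reduceIte, map_zero, nonpos_iff_eq_zero, one_ne_zero]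
      linear_combination (norm := module) h1
    · simp only [Pi.add_apply, Pi.sub_apply, cone_apply, keep_apply, dForms_apply_succ,
        dForms_apply_zero, zero_add, ↓reduceIte, map_zero, Nat.one_le_iff_ne_zero.2 hp,
        Ne.symm hp, zero_le]
      linear_combination (norm := module) h1
  | k + 1 =>
    have h1 := poincare_succ C k
    rcases lt_trichotomy (k + 1) p with hk | hk | hk
    · simp only [Pi.add_apply, Pi.sub_apply, cone_apply, keep_apply, dForms_apply_succ,
        const_apply_succ, hk.ne, hk.le, Nat.succ_le_of_lt hk, ↓reduceIte, map_zero]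
      linear_combination (norm := module) h1
    · subst hk
      simp only [Pi.add_apply, Pi.sub_apply, cone_apply, keep_apply, dForms_apply_succ,
        const_apply_succ, ↓reduceIte, map_zero, le_refl, Nat.not_succ_le_self]
      linear_combination (norm := module) h1
    · simp [cone_apply, keep_apply, dForms_apply_succ, const_apply_succ, hk.ne', hk.not_ge,
        hC (k + 1) (by omega), show ¬ k + 1 + 1 ≤ p by omega]
      module

end Operations

/-! ### The two presentations of Maxwell theory on a coordinate patch -/

/-- The group that underlies the second presentation of Maxwell theory. -/
abbrev TildeElt (n m : ℕ) : Type := ℤ × Forms n m × Param m × Forms n m × Forms n m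

/-- The group that underlies Maxwell theory. -/
abbrev MaxwellElt (n m : ℕ) : Type := ℤ × Forms n m × Forms n m

section TildeMaxwell

variable {σ : Signature} {n : ℕ} {V : Patch σ n} {m p q : ℕ} {κ : ℝ}

variable (V m p q κ) in
/-- The differential of the second presentation of Maxwell theory, in terms of `p = n-q-2`. -/
def tildeDiff (x : TildeElt n m) : TildeElt n m :=
  (0, keep n m (· ≤ q) (dForms n m x.2.1) + intConst n m x.1, 0,
    keep n m (· ≤ p) (dForms n m x.2.2.2.1) + const n m x.2.2.1,
    V.star m (dForms n m (keep n m (· = q) x.2.1)) +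
      (-κ) • dForms n m (keep n m (· = p) x.2.2.2.1))

variable (V m q κ) in
/-- The differential of Maxwell theory. -/
def maxwellDifferential (x : MaxwellElt n m) : MaxwellElt n m :=
  (0, keep n m (· ≤ q) (dForms n m x.2.1) + intConst n m x.1,
    κ • dForms n m (V.star m (dForms n m (keep n m (· = q) x.2.1))) + dForms n m x.2.2)

theorem maxwellTildePatch_diff (h : p + q + 2 = n) (hq : q + 2 ≤ n)
    (x : TildeElt n m) :
    (maxwellTildePatch V m q κ hq).diff x = tildeDiff V m p q κ x := by
  obtain rfl : p = n - q - 2 := by omega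
  rfl

theorem mem_maxwellTildePatch_degree (h : p + q + 2 = n) (hq : q + 2 ≤ n) {i : ℤ}
    {x : TildeElt n m} :
    x ∈ (maxwellTildePatch V m q κ hq).degree i ↔
      x.1 ∈ onlyIf ℤ (i = -q - 1) ∧ x.2.1 ∈ formsIn n m (fun k => (k : ℤ) = i + q ∧ k ≤ q) ∧
      x.2.2.1 ∈ onlyIf (Param m) (i = -p - 1) ∧
      x.2.2.2.1 ∈ formsIn n m (fun k => (k : ℤ) = i + p ∧ k ≤ p) ∧
      x.2.2.2.2 ∈ formsIn n m (fun k => i = 1 ∧ k = p + 1) := by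
  obtain rfl : p = n - q - 2 := by omega
  rw [show n - q - 2 + 1 = n - q - 1 by omega]
  rfl

/-- The Hodge star of the curvature of a `q`-form is a form of degree `p + 1`. -/
theorem star_dForms_keep_mem (h : p + q + 2 = n) (A : Forms n m) :
    V.star m (dForms n m (keep n m (· = q) A)) ∈ formsIn n m (· = p + 1) := by
  refine star_mem V (P := (· = q + 1)) (fun k l hkl hk => by omega) ?_
  exact dForms_mem (P := (· = q)) (fun k hk => by omega)
    (keep_mem (P := fun _ => True) (fun k _ hk => hk) fun k hk => absurd trivial hk)

variable (n m κ) in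
/-- The map from the second presentation of Maxwell theory to the first, which sends the form `ρ`
of degree `n-q-1` to `κ dρ`. -/
def tildeToMaxwell : TildeElt n m →+ MaxwellElt n m :=
  AddMonoidHom.mk'
    (fun x : TildeElt n m => ((x.1, x.2.1, κ • dForms n m x.2.2.2.2) : MaxwellElt n m))
    fun x y => by
    refine Prod.ext rfl (Prod.ext rfl ?_)
    simp only [Prod.snd_add, map_add, smul_add]

variable (V m p q κ) in
/-- The homotopy inverse of `tildeToMaxwell` given by integration along rays. It commutes with the
differentials only on homogeneous elements. -/
def maxwellToTilde : MaxwellElt n m →+ TildeElt n m :=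
  AddMonoidHom.mk' (fun x : MaxwellElt n m => ((x.1, x.2.1, 0,
    κ⁻¹ • cone n m (V.star m (dForms n m (keep n m (· = q) x.2.1))),
    κ⁻¹ • cone n m (keep n m (· = p + 2) x.2.2)) : TildeElt n m)) fun x y => by
    refine Prod.ext rfl (Prod.ext rfl (Prod.ext (add_zero _).symm (Prod.ext ?_ ?_)))
    · simp only [Prod.snd_add, Prod.fst_add, map_add, smul_add]
    · simp only [Prod.snd_add, map_add, smul_add]

variable (n m κ) in
/-- The homotopy that contracts what `tildeToMaxwell` forgets: the row of `r` and `C`, and the exact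
part of `ρ`, which is the image of the top forms `C`. -/
def tildeMaxwellHomotopy : TildeElt n m →+ TildeElt n m :=
  AddMonoidHom.mk' (fun x : TildeElt n m => ((0, 0, atOrigin n m x.2.2.2.1,
    cone n m x.2.2.2.1 + (-κ⁻¹) • cone n m x.2.2.2.2, 0) : TildeElt n m)) fun x y => by
    refine Prod.ext (add_zero _).symm (Prod.ext (add_zero _).symm (Prod.ext ?_ (Prod.ext ?_
      (add_zero _).symm)))
    · simp only [Prod.snd_add, Prod.fst_add, map_add]
    · simp only [Prod.snd_add, Prod.fst_add, map_add, smul_add]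
      module

variable (n m p) in
/-- The homotopy that contracts the forms of degree greater than `p + 2`. -/
def maxwellHomotopy : MaxwellElt n m →+ MaxwellElt n m :=
  AddMonoidHom.mk' (fun x : MaxwellElt n m =>
    ((0, 0, keep n m (p + 2 ≤ ·) (cone n m x.2.2)) : MaxwellElt n m)) fun x y => by
    refine Prod.ext (add_zero _).symm (Prod.ext (add_zero _).symm ?_)
    simp only [Prod.snd_add, map_add]

theorem tildeToMaxwell_mem (h : p + q + 2 = n) (hq : q + 2 ≤ n) {i : ℤ}
    {x : TildeElt n m}
    (hx : x ∈ (maxwellTildePatch V m q κ hq).degree i) :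
    tildeToMaxwell n m κ x ∈ (maxwellPatch V m q κ).degree i := by
  rw [mem_maxwellTildePatch_degree h hq] at hx
  exact ⟨hx.1, hx.2.1, smul_mem_formsIn _ (dForms_mem (fun k hk => by push_cast; omega) hx.2.2.2.2)⟩

theorem tildeToMaxwell_diff (x : TildeElt n m) :
    tildeToMaxwell n m κ (tildeDiff V m p q κ x) =
      maxwellDifferential V m q κ (tildeToMaxwell n m κ x) := by
  refine Prod.ext rfl (Prod.ext rfl ?_)
  change κ • dForms n m (V.star m (dForms n m (keep n m (· = q) x.2.1)) + (-κ) • dForms n m _) =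
    κ • dForms n m (V.star m (dForms n m (keep n m (· = q) x.2.1))) +
      dForms n m (κ • dForms n m _)
  simp only [map_add, map_smul, dForms_dForms, smul_zero, add_zero]

theorem maxwellToTilde_mem (h : p + q + 2 = n) (hq : q + 2 ≤ n) {i : ℤ}
    {x : MaxwellElt n m} (hx : x ∈ (maxwellPatch V m q κ).degree i) :
    maxwellToTilde V m p q κ x ∈ (maxwellTildePatch V m q κ hq).degree i := by
  rw [mem_maxwellTildePatch_degree h hq]
  obtain ⟨hz, hA, hβ⟩ := hx
  refine ⟨hz, hA, zero_mem _, smul_mem_formsIn _ ?_, smul_mem_formsIn _ ?_⟩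
  · have h1 : keep n m (· = q) x.2.1 ∈ formsIn n m fun k => i = 0 ∧ k = q :=
      keep_mem (fun k h h' => by omega) hA
    have h2 := dForms_mem (Q := fun k => i = 0 ∧ k = q + 1) (fun k h => by omega) h1
    have h3 := star_mem V (Q := fun k => i = 0 ∧ k = p + 1) (fun k l hkl h => by omega) h2
    exact cone_mem (fun k hk => by omega) h3
  · exact cone_mem (P := fun k => i = 1 ∧ k = p + 2) (fun k hk => by omega)
      (keep_mem (fun k h h' => by omega) hβ)

theorem maxwellToTilde_diff (h : p + q + 2 = n) (hκ : κ ≠ 0) {i : ℤ}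
    {x : MaxwellElt n m} (hx : x ∈ (maxwellPatch V m q κ).degree i) :
    maxwellToTilde V m p q κ (maxwellDifferential V m q κ x) =
      tildeDiff V m p q κ (maxwellToTilde V m p q κ x) := by
  obtain ⟨z, A, β⟩ := x
  obtain ⟨hz, hA, hβ⟩ := hx
  have hS := mem_formsIn.1 (star_dForms_keep_mem (V := V) h A)
  have hβ' (k : ℕ) (hk : ¬ p + 2 ≤ k) : β k = 0 := mem_formsIn.1 hβ k fun h => hk (by omega)
  refine Prod.ext rfl (Prod.ext rfl (Prod.ext rfl (Prod.ext ?_ ?_)))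
  · change κ⁻¹ • cone n m (V.star m (dForms n m (keep n m (· = q)
      (keep n m (· ≤ q) (dForms n m A) + intConst n m z)))) =
      keep n m (· ≤ p) (dForms n m (κ⁻¹ • cone n m (V.star m (dForms n m
        (keep n m (· = q) A))))) + const n m 0
    generalize V.star m (dForms n m (keep n m (· = q) A)) = S at *
    simp only [map_add, dForms_keep_eq_keep_dForms, dForms_keep_intConst, map_zero, add_zero,
      smul_zero]
    funext k
    match k with
    | 0 => simp [keep_apply, dForms_apply_zero]
    | k + 1 =>
      rw [keep_apply]
      split_ifs with hk
      · rw [dForms_apply_succ, Pi.smul_apply, cone_apply, hS _ (by omega)]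
        simp
      · rfl
  · change κ⁻¹ • cone n m (keep n m (· = p + 2)
        (κ • dForms n m (V.star m (dForms n m (keep n m (· = q) A))) + dForms n m β)) =
      V.star m (dForms n m (keep n m (· = q) A)) + (-κ) • dForms n m (keep n m (· = p)
        (κ⁻¹ • cone n m (V.star m (dForms n m (keep n m (· = q) A)))))
    generalize V.star m (dForms n m (keep n m (· = q) A)) = S at *
    funext k
    match k with
    | 0 => simp [cone_apply, keep_apply, dForms_apply_zero, hS 0]
    | k + 1 =>
      by_cases hk : k = p
      · subst hk
        have h1 := poincare_succ S k
        simp [cone_apply, keep_apply, dForms_apply_succ, hβ' (k + 1), hκ]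
        linear_combination (norm := (match_scalars <;> simp [hκ])) h1
      · simp [cone_apply, keep_apply, dForms_apply_succ, hS (k + 1), hk]

theorem tildeMaxwellHomotopy_mem (h : p + q + 2 = n) (hq : q + 2 ≤ n) {i j : ℤ} (hij : j + 1 = i)
    {x : TildeElt n m}
    (hx : x ∈ (maxwellTildePatch V m q κ hq).degree i) :
    tildeMaxwellHomotopy n m κ x ∈ (maxwellTildePatch V m q κ hq).degree j := by
  rw [mem_maxwellTildePatch_degree h hq] at hx ⊢
  obtain ⟨hz, hA, hr, hC, hρ⟩ := hx
  refine ⟨zero_mem _, zero_mem _, atOrigin_mem (fun h => by omega) hC,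
    add_mem (cone_mem (fun k hk => by omega) hC)
      (smul_mem_formsIn _ (cone_mem (fun k hk => by omega) hρ)), zero_mem _⟩

theorem tildeMaxwellHomotopy_comm (h : p + q + 2 = n) (hq : q + 2 ≤ n) (hκ : κ ≠ 0) {i : ℤ}
    {x : TildeElt n m}
    (hx : x ∈ (maxwellTildePatch V m q κ hq).degree i) :
    x = tildeMaxwellHomotopy n m κ (tildeDiff V m p q κ x) +
      tildeDiff V m p q κ (tildeMaxwellHomotopy n m κ x) +
      maxwellToTilde V m p q κ (tildeToMaxwell n m κ x) := by
  rw [mem_maxwellTildePatch_degree h hq] at hx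
  obtain ⟨z, A, r, C, ρ⟩ := x
  obtain ⟨hz, hA, hr, hC, hρ⟩ := hx
  have hC' (k : ℕ) (hk : ¬ k ≤ p) : C k = 0 := mem_formsIn.1 hC k fun h => hk h.2
  have hρ' (k : ℕ) (hk : ¬ k = p + 1) : ρ k = 0 := mem_formsIn.1 hρ k fun h => hk h.2
  refine Prod.ext ?_ (Prod.ext ?_ (Prod.ext ?_ (Prod.ext ?_ ?_)))
  · change z = 0 + 0 + z
    simp
  · change A = 0 + (keep n m (· ≤ q) (dForms n m 0) + intConst n m 0) + A
    simp
  · change r = atOrigin n m (keep n m (· ≤ p) (dForms n m C) + const n m r) + 0 + 0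
    rw [map_add, atOrigin_const, atOrigin_eq_zero (by simp [keep_apply, dForms_apply_zero])]
    simp
  · change C = (cone n m (keep n m (· ≤ p) (dForms n m C) + const n m r) +
        (-κ⁻¹) • cone n m (V.star m (dForms n m (keep n m (· = q) A)) +
          (-κ) • dForms n m (keep n m (· = p) C))) +
      (keep n m (· ≤ p) (dForms n m (cone n m C + (-κ⁻¹) • cone n m ρ)) +
        const n m (atOrigin n m C)) +
      κ⁻¹ • cone n m (V.star m (dForms n m (keep n m (· = q) A)))
    have h1 := poincare_truncated hC'
    have h2 : keep n m (· ≤ p) (dForms n m (cone n m ρ)) = 0 := by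
      funext k
      match k with
      | 0 => simp [keep_apply, dForms_apply_zero]
      | k + 1 =>
        by_cases hk : k + 1 ≤ p
        · simp [keep_apply, dForms_apply_succ, cone_apply, hρ' (k + 1) (by omega)]
        · simp [keep_apply, hk]
    simp only [map_add, map_smul, cone_const, h2]
    linear_combination (norm := (match_scalars <;> simp [hκ])) -h1
  · change ρ = 0 + (V.star m (dForms n m (keep n m (· = q) 0)) + (-κ) • dForms n m
        (keep n m (· = p) (cone n m C + (-κ⁻¹) • cone n m ρ))) +
      κ⁻¹ • cone n m (keep n m (· = p + 2) (κ • dForms n m ρ))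
    rw [map_zero, map_zero, map_zero, zero_add, zero_add]
    funext k
    match k with
    | 0 => simp [cone_apply, keep_apply, dForms_apply_zero, hρ' 0]
    | k + 1 =>
      by_cases hk : k = p
      · subst hk
        have h1 := poincare_succ ρ k
        simp [cone_apply, keep_apply, dForms_apply_succ, hC' (k + 1), hκ]
        linear_combination (norm := (match_scalars <;> simp [hκ])) -h1
      · simp [cone_apply, keep_apply, dForms_apply_succ, hρ' (k + 1), hk]

theorem maxwellHomotopy_mem (h : p + q + 2 = n) {i j : ℤ} (hij : j + 1 = i)
    {x : MaxwellElt n m} (hx : x ∈ (maxwellPatch V m q κ).degree i) :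
    maxwellHomotopy n m p x ∈ (maxwellPatch V m q κ).degree j :=
  ⟨zero_mem _, zero_mem _, keep_mem (P := fun k => (k : ℤ) = j + n - q - 1)
    (fun k hk hk' => ⟨hk, by omega⟩) (cone_mem (fun k hk => by push_cast at hk; omega) hx.2.2)⟩

theorem maxwellHomotopy_comm (h : p + q + 2 = n) (hκ : κ ≠ 0) {i : ℤ}
    {x : MaxwellElt n m} (hx : x ∈ (maxwellPatch V m q κ).degree i) :
    x = maxwellHomotopy n m p (maxwellDifferential V m q κ x) +
      maxwellDifferential V m q κ (maxwellHomotopy n m p x) +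
      tildeToMaxwell n m κ (maxwellToTilde V m p q κ x) := by
  obtain ⟨z, A, β⟩ := x
  obtain ⟨hz, hA, hβ⟩ := hx
  have hS := mem_formsIn.1 (star_dForms_keep_mem (V := V) h A)
  have hβ' (k : ℕ) (hk : ¬ p + 2 ≤ k) : β k = 0 := mem_formsIn.1 hβ k fun h => hk (by omega)
  refine Prod.ext ?_ (Prod.ext ?_ ?_)
  · change z = 0 + 0 + z
    simp
  · change A = 0 + (keep n m (· ≤ q) (dForms n m 0) + intConst n m 0) + A
    simp
  · change β = keep n m (p + 2 ≤ ·) (cone n m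
        (κ • dForms n m (V.star m (dForms n m (keep n m (· = q) A))) + dForms n m β)) +
      (κ • dForms n m (V.star m (dForms n m (keep n m (· = q) 0))) +
        dForms n m (keep n m (p + 2 ≤ ·) (cone n m β))) +
      κ • dForms n m (κ⁻¹ • cone n m (keep n m (· = p + 2) β))
    generalize V.star m (dForms n m (keep n m (· = q) A)) = S at *
    funext k
    match k with
    | 0 => simp [keep_apply, dForms_apply_zero, hβ' 0]
    | k + 1 =>
      have h1 := poincare_succ β k
      rcases lt_trichotomy (k + 1) (p + 2) with hk | hk | hk
      · simp [cone_apply, keep_apply, dForms_apply_succ, hβ' (k + 1), show ¬ p + 2 ≤ k by omega,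
          show ¬ p + 2 ≤ k + 1 by omega]
      · obtain rfl : k = p + 1 := by omega
        simp [cone_apply, keep_apply, dForms_apply_succ, hS (p + 1 + 1), hκ]
        linear_combination (norm := module) -h1
      · simp [cone_apply, keep_apply, dForms_apply_succ, hS (k + 1), hκ,
          show p + 2 ≤ k by omega, show p + 1 ≤ k by omega, show ¬ k = p + 1 by omega,
          show ¬ k = p by omega]
        linear_combination (norm := module) -h1

end TildeMaxwell

/-! ### The equivalence of the two presentations -/

section Transport

variable {σ : Signature} {n : ℕ} (V : (PatchCat σ n)ᵒᵖ) {X Y : CartSpᵒᵖ} (g : X ⟶ Y)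

theorem transport_cone (α : Forms n X.unop.dim) :
    (transport (𝟙 V : V ⟶ V).unop g.unop).form (cone n _ α) =
      cone n _ ((transport (𝟙 V : V ⟶ V).unop g.unop).form α) := by
  rw [unop_id]
  exact pullback_id_cone g.unop.2 α

theorem transport_atOrigin (α : Forms n X.unop.dim) :
    (transport (𝟙 V : V ⟶ V).unop g.unop).param (atOrigin n _ α) =
      atOrigin n _ ((transport (𝟙 V : V ⟶ V).unop g.unop).form α) := by
  rw [unop_id]
  exact pullback_id_atOrigin g.unop.2 α

end Transport

section TildeMaxwell

variable {σ : Signature} {n p q : ℕ} {κ : ℝ} (h : p + q + 2 = n) (hq : q + 2 ≤ n)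

section Patch

variable (V : Patch σ n) (m : ℕ)

variable (κ) in
/-- The map `tildeToMaxwell` as a map of graded groups with differentials. -/
def tildeToMaxwellHom :
    DiffGroup.GradedHom (maxwellTildePatch V m q κ hq) (maxwellPatch V m q κ) where
  map := tildeToMaxwell n m κ
  mem _ _ := tildeToMaxwell_mem h hq
  comm _ x _ := (congrArg _ (maxwellTildePatch_diff h hq x)).trans (tildeToMaxwell_diff x)

/-- The map `maxwellToTilde` as a map of graded groups with differentials. -/
def maxwellToTildeHom (hκ : κ ≠ 0) :
    DiffGroup.GradedHom (maxwellPatch V m q κ) (maxwellTildePatch V m q κ hq) where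
  map := maxwellToTilde V m p q κ
  mem _ _ := maxwellToTilde_mem h hq
  comm _ _ hx := (maxwellToTilde_diff h hκ hx).trans (maxwellTildePatch_diff h hq _).symm

/-- The homotopy `tildeMaxwellHomotopy` as a contraction. -/
def tildeMaxwellContraction (hκ : κ ≠ 0) :
    (maxwellTildePatch V m q κ hq).Contraction fun x =>
      (maxwellToTildeHom h hq V m hκ).map ((tildeToMaxwellHom κ h hq V m).map x) where
  map := tildeMaxwellHomotopy n m κ
  mem _ _ _ hij := tildeMaxwellHomotopy_mem h hq hij
  comm _ x hx := by
    refine (tildeMaxwellHomotopy_comm h hq hκ hx).trans ?_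
    exact congrArg₂ (fun a b => tildeMaxwellHomotopy n m κ a + b +
      maxwellToTilde V m p q κ (tildeToMaxwell n m κ x)) (maxwellTildePatch_diff h hq _).symm
      (maxwellTildePatch_diff h hq _).symm

/-- The homotopy `maxwellHomotopy` as a contraction. -/
def maxwellContraction (hκ : κ ≠ 0) :
    (maxwellPatch V m q κ).Contraction fun x =>
      (tildeToMaxwellHom κ h hq V m).map ((maxwellToTildeHom h hq V m hκ).map x) where
  map := maxwellHomotopy n m p
  mem _ _ _ hij := maxwellHomotopy_mem h hij
  comm _ _ := maxwellHomotopy_comm h hκ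

end Patch

section Natural

variable {V W : Patch σ n} {m m' : ℕ} (T : Transport V W m m')

theorem tildeToMaxwell_natural (x : TildeElt n m') :
    tildeToMaxwell n m κ ((T.maxwellTilde q κ hq).map x) =
      (T.maxwell q κ).map (tildeToMaxwell n m' κ x) := by
  refine Prod.ext rfl (Prod.ext rfl ?_)
  change κ • dForms n m (T.form x.2.2.2.2) = T.form (κ • dForms n m' x.2.2.2.2)
  rw [T.form_smul, T.form_dForms]

theorem maxwellToTilde_natural (hT : ∀ α, T.form (cone n m' α) = cone n m (T.form α))
    (x : MaxwellElt n m') :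
    maxwellToTilde V m p q κ ((T.maxwell q κ).map x) =
      (T.maxwellTilde q κ hq).map (maxwellToTilde W m' p q κ x) := by
  refine Prod.ext rfl (Prod.ext rfl (Prod.ext (map_zero T.param).symm (Prod.ext ?_ ?_)))
  · change κ⁻¹ • cone n m (V.star m (dForms n m (keep n m (· = q) (T.form x.2.1)))) =
      T.form (κ⁻¹ • cone n m' (W.star m' (dForms n m' (keep n m' (· = q) x.2.1))))
    rw [T.form_smul, hT, T.form_star, T.form_dForms, T.form_keep]
  · change κ⁻¹ • cone n m (keep n m (· = p + 2) (T.form x.2.2)) =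
      T.form (κ⁻¹ • cone n m' (keep n m' (· = p + 2) x.2.2))
    rw [T.form_smul, hT, T.form_keep]

theorem tildeMaxwellHomotopy_natural (hT : ∀ α, T.form (cone n m' α) = cone n m (T.form α))
    (hT' : ∀ α, T.param (atOrigin n m' α) = atOrigin n m (T.form α)) (x : TildeElt n m') :
    tildeMaxwellHomotopy n m κ ((T.maxwellTilde q κ hq).map x) =
      (T.maxwellTilde q κ hq).map (tildeMaxwellHomotopy n m' κ x) := by
  refine Prod.ext rfl (Prod.ext (map_zero T.form).symm (Prod.ext (hT' _).symm (Prod.ext ?_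
    (map_zero T.form).symm)))
  change cone n m (T.form x.2.2.2.1) + (-κ⁻¹) • cone n m (T.form x.2.2.2.2) =
    T.form (cone n m' x.2.2.2.1 + (-κ⁻¹) • cone n m' x.2.2.2.2)
  rw [map_add, T.form_smul, hT, hT]

theorem maxwellHomotopy_natural (hT : ∀ α, T.form (cone n m' α) = cone n m (T.form α))
    (x : MaxwellElt n m') :
    maxwellHomotopy n m p ((T.maxwell q κ).map x) =
      (T.maxwell q κ).map (maxwellHomotopy n m' p x) := by
  refine Prod.ext rfl (Prod.ext (map_zero T.form).symm ?_)
  change keep n m (p + 2 ≤ ·) (cone n m (T.form x.2.2)) =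
    T.form (keep n m' (p + 2 ≤ ·) (cone n m' x.2.2))
  rw [T.form_keep, hT]

end Natural

variable (κ) in
/-- The map `tildeToMaxwell` on all coordinate patches and in all families. -/
def tildeToMaxwellMap : GradedMap (maxwellTildeDiff σ n q κ hq) (maxwellDiff σ n q κ) where
  hom VX := tildeToMaxwellHom κ h hq VX.1.unop VX.2.unop.dim
  natural u := tildeToMaxwell_natural hq (transport u.1.unop u.2.unop)

variable (V : (PatchCat σ n)ᵒᵖ)

/-- The map `maxwellToTilde` in all families on a coordinate patch. -/
def maxwellToTildeMap (hκ : κ ≠ 0) :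
    GradedMap ((Functor.curry.obj (maxwellDiff σ n q κ)).obj V)
      ((Functor.curry.obj (maxwellTildeDiff σ n q κ hq)).obj V) where
  hom X := maxwellToTildeHom h hq V.unop X.unop.dim hκ
  natural u := maxwellToTilde_natural hq _ (transport_cone V u)

/-- The homotopy `tildeMaxwellHomotopy` in all families on a coordinate patch. -/
def tildeMaxwellGradedHomotopy (hκ : κ ≠ 0) :
    GradedHomotopy fun X x => ((maxwellToTildeMap h hq V hκ).hom X).map
      ((((tildeToMaxwellMap κ h hq).atPatch V).hom X).map x) where
  contraction X := tildeMaxwellContraction h hq V.unop X.unop.dim hκ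
  natural u := tildeMaxwellHomotopy_natural hq _ (transport_cone V u) (transport_atOrigin V u)

/-- The homotopy `maxwellHomotopy` in all families on a coordinate patch. -/
def maxwellGradedHomotopy (hκ : κ ≠ 0) :
    GradedHomotopy fun X x => (((tildeToMaxwellMap κ h hq).atPatch V).hom X).map
      (((maxwellToTildeMap h hq V hκ).hom X).map x) where
  contraction X := maxwellContraction h hq V.unop X.unop.dim hκ
  natural u := maxwellHomotopy_natural _ (transport_cone V u)

/-- The two presentations of Maxwell theory are homotopy equivalent on coordinate patches. -/
theorem isPatchwiseHomotopyEquiv_tildeToMaxwell (σ : Signature) (hκ : κ ≠ 0) :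
    IsPatchwiseHomotopyEquiv (K := MaxwellTilde σ n q κ hq) (L := Maxwell σ n q κ)
      (Functor.curry.map (tildeToMaxwellMap κ h hq).toNatTrans) :=
  isPatchwiseHomotopyEquiv_of_gradedMap _ fun V =>
    GradedMap.isNaturalHomotopyEquiv _ (maxwellToTildeMap h hq V hκ)
      (tildeMaxwellGradedHomotopy h hq V hκ) (maxwellGradedHomotopy h hq V hκ)

end TildeMaxwell

/-! ### The coupled theory on a coordinate patch -/

/-- The group that underlies Maxwell theory coupled to a `BF` theory. -/
abbrev BFElt (n m : ℕ) : Type :=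
  ℤ × Forms n m × ℤ × Forms n m × Forms n m × Param m × Forms n m × ℤ × Forms n m

section TildeBF

variable {σ : Signature} {n : ℕ} {V : Patch σ n} {m p q : ℕ} {κ ε : ℝ}

variable (V m p q κ) in
/-- The differential of the coupled theory, in terms of `q = n-p-2`. -/
def bfDiff (x : BFElt n m) : BFElt n m :=
  let y := x.1
  let B := x.2.1
  let z := x.2.2.1
  let A := x.2.2.2.1
  let r := x.2.2.2.2.2.1
  let C := x.2.2.2.2.2.2.1
  let w := x.2.2.2.2.2.2.2.1
  let E := x.2.2.2.2.2.2.2.2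
  (0,
    dForms n m B + intConst n m y,
    -y,
    keep n m (· ≤ p) (dForms n m A) + intConst n m z + keep n m (· ≤ p) (alternate n m B),
    V.star m (dForms n m (keep n m (· = p) A)) + (-κ) • dForms n m (keep n m (· = q) C) +
      ((-1 : ℝ) ^ (p + 1)) • V.star m (keep n m (· = p + 1) B),
    0,
    keep n m (· ≤ q) (dForms n m C) + const n m r + intConst n m (-w),
    0,
    dForms n m E + const n m r + intConst n m w)

theorem maxwellBFPatch_diff (h : p + q + 2 = n) (hp : p + 2 ≤ n) (x : BFElt n m) :
    (maxwellBFPatch V m p κ hp).diff x = bfDiff V m p q κ x := by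
  obtain rfl : q = n - p - 2 := by omega
  rfl

theorem mem_maxwellBFPatch_degree (h : p + q + 2 = n) (hp : p + 2 ≤ n) {i : ℤ} {x : BFElt n m} :
    x ∈ (maxwellBFPatch V m p κ hp).degree i ↔
      x.1 ∈ onlyIf ℤ (i = -p - 2) ∧ x.2.1 ∈ formsIn n m (fun k => (k : ℤ) = i + p + 1) ∧
      x.2.2.1 ∈ onlyIf ℤ (i = -p - 1) ∧
      x.2.2.2.1 ∈ formsIn n m (fun k => (k : ℤ) = i + p ∧ k ≤ p) ∧
      x.2.2.2.2.1 ∈ formsIn n m (fun k => i = 1 ∧ k = q + 1) ∧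
      x.2.2.2.2.2.1 ∈ onlyIf (Param m) (i = -q - 1) ∧
      x.2.2.2.2.2.2.1 ∈ formsIn n m (fun k => (k : ℤ) = i + q ∧ k ≤ q) ∧
      x.2.2.2.2.2.2.2.1 ∈ onlyIf ℤ (i = -q - 1) ∧
      x.2.2.2.2.2.2.2.2 ∈ formsIn n m (fun k => (k : ℤ) = i + q) := by
  obtain rfl : q = n - p - 2 := by omega
  rw [show n - p - 2 + 1 = n - p - 1 by omega]
  rfl

theorem keep_mem_eq (k : ℕ) (α : Forms n m) : keep n m (· = k) α ∈ formsIn n m (· = k) :=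
  keep_mem (P := fun _ => True) (fun _ _ h => h) fun _ hk => absurd trivial hk

/-- A form in a single degree is fixed by the projection to that degree. -/
theorem keep_eq_self {P : ℕ → Prop} [DecidablePred P] {α : Forms n m} (h : α ∈ formsIn n m P) :
    keep n m P α = α := by
  funext k
  rw [keep_apply]
  split_ifs with hk
  · rfl
  · exact (mem_formsIn.1 h k hk).symm

theorem keep_eq_zero {P Q : ℕ → Prop} [DecidablePred P] {α : Forms n m} (h : α ∈ formsIn n m Q)
    (hPQ : ∀ k, P k → ¬ Q k) : keep n m P α = 0 := by
  funext k
  rw [keep_apply]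
  split_ifs with hk
  · exact mem_formsIn.1 h k (hPQ k hk)
  · rfl

theorem alternate_alternate (α : Forms n m) : alternate n m (alternate n m α) = α := by
  funext k
  rw [alternate_apply, alternate_apply, smul_smul, ← mul_pow]
  simp

theorem keep_dForms (k : ℕ) (α : Forms n m) :
    keep n m (· = k + 1) (dForms n m α) = dForms n m (keep n m (· = k) α) := by
  funext j
  match j with
  | 0 => simp [keep_apply, dForms_apply_zero]
  | j + 1 =>
    by_cases hj : j = k
    · simp [keep_apply, dForms_apply_succ, hj]
    · simp [keep_apply, dForms_apply_succ, hj]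

/-- The Poincaré lemma for forms of positive degree. -/
theorem dForms_cone_add {k : ℕ} {α : Forms n m} (h : α ∈ formsIn n m (· = k + 1)) :
    dForms n m (cone n m α) + cone n m (dForms n m α) = α := by
  have h1 := dForms_cone_add_cone_dForms α
  rwa [atOrigin_eq_zero (mem_formsIn.1 h 0 (by omega)), map_zero, add_zero] at h1

theorem alternate_const (r : Param m) : alternate n m (const n m r) = const n m r := by
  funext k
  match k with
  | 0 => simp [alternate_apply]
  | k + 1 => simp [alternate_apply, const_apply_succ]

theorem keep_alternate (P : ℕ → Prop) [DecidablePred P] (α : Forms n m) :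
    keep n m P (alternate n m α) = alternate n m (keep n m P α) := by
  funext k
  by_cases hk : P k <;> simp [keep_apply, alternate_apply, hk]

/-- The contraction of the forms `B` in the first row of the coupled theory: in degrees at most `p`
they cancel against the second row, and in higher degrees the Poincaré lemma applies. -/
theorem poincare_coupled (A B : Forms n m) (hA : ∀ k, ¬ k ≤ p → A k = 0) :
    alternate n m (keep n m (· ≤ p) (dForms n m A)) + keep n m (· ≤ p) B +
        keep n m (p + 1 ≤ ·) (cone n m (dForms n m B)) + dForms n m (alternate n m A) +
        dForms n m (keep n m (p + 1 ≤ ·) (cone n m B)) +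
        dForms n m (cone n m (keep n m (· = p + 1) B)) =
      B + ((-1 : ℝ) ^ p) • dForms n m (keep n m (· = p) A) := by
  funext k
  match k with
  | 0 => simp [keep_apply, alternate_apply, dForms_apply_zero]
  | k + 1 =>
    have h1 := poincare_succ B k
    rcases lt_trichotomy k p with hk | hk | hk
    · simp only [Pi.add_apply, Pi.smul_apply, cone_apply, keep_apply, alternate_apply,
        dForms_apply_succ, map_smul, map_zero, ↓reduceIte, hk.ne, Nat.succ_le_of_lt hk,
        Nat.add_right_cancel_iff, show ¬ p + 1 ≤ k + 1 by omega, show ¬ p + 1 ≤ k by omega,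
        pow_succ]
      module
    · subst hk
      simp only [Pi.add_apply, Pi.smul_apply, cone_apply, keep_apply, alternate_apply,
        dForms_apply_succ, map_smul, map_zero, ↓reduceIte, le_refl, Nat.not_succ_le_self]
      linear_combination (norm := module) h1
    · simp only [Pi.add_apply, Pi.smul_apply, cone_apply, keep_apply, alternate_apply,
        dForms_apply_succ, smul_zero, map_zero, ↓reduceIte, hk.ne', Nat.add_right_cancel_iff,
        hA k (by omega), show ¬ k + 1 ≤ p by omega, show p + 1 ≤ k + 1 by omega,
        show p + 1 ≤ k by omega]
      linear_combination (norm := module) h1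

variable (V p κ ε m) in
/-- The map from the second presentation of `q`-form Maxwell theory with coupling `1/κ` to the
coupled theory. Here `ε` is the constant such that `⋆⋆ = ε` on forms of degree `p + 1`.

The integers go to the fourth row and, with the opposite sign, to the constants of the third row,
where their difference is twice the integer; this fixes the factor `-2` on the forms `A`, and then
compatibility with the differential into the forms of degree `q + 1` fixes the two coefficients that
involve `ε`. -/
def tildeToBF : TildeElt n m →+ BFElt n m :=
  AddMonoidHom.mk' (fun x : TildeElt n m => ((0,
    ((-1) ^ p * (2 / ε)) • dForms n m (keep n m (· = p) x.2.2.2.1), 0, 0,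
    (2 * κ / ε) • V.star m x.2.2.2.2, -intParam m x.1, (-2 : ℝ) • x.2.1, x.1, 0) : BFElt n m))
    fun x y => by
    refine Prod.ext (add_zero _).symm (Prod.ext ?_ (Prod.ext (add_zero _).symm
      (Prod.ext (add_zero _).symm (Prod.ext ?_ (Prod.ext ?_ (Prod.ext ?_ (Prod.ext rfl
      (add_zero _).symm)))))))
    all_goals simp only [Prod.fst_add, Prod.snd_add, map_add, smul_add, neg_add]

variable (V p κ ε m) in
/-- The homotopy inverse of `tildeToBF`. The forms `E` of the fourth row are contractible onto their
values at the origin, which the differential shifts by the constants of that row; they enter so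
that the constants `x - m` and `x + m` recombine to the integer `m`. -/
def bfToTilde : BFElt n m →+ TildeElt n m :=
  AddMonoidHom.mk' (fun x : BFElt n m => ((x.2.2.2.2.2.2.2.1,
    (-(1 / 2) : ℝ) • x.2.2.2.2.2.2.1 + (1 / 2 : ℝ) • const n m (atOrigin n m x.2.2.2.2.2.2.2.2), 0,
    ((-1) ^ p * (ε / 2)) • cone n m (keep n m (· = p + 1) x.2.1) +
      (-(ε / 2)) • cone n m (dForms n m (keep n m (· = p) x.2.2.2.1)),
    (2 * κ)⁻¹ • V.star m x.2.2.2.2.1 +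
      ((-1) ^ p * (ε / (2 * κ))) • cone n m (keep n m (· = p + 2) x.2.1)) : TildeElt n m))
    fun x y => by
    refine Prod.ext rfl (Prod.ext ?_ (Prod.ext (add_zero _).symm (Prod.ext ?_ ?_)))
    all_goals
      simp only [Prod.fst_add, Prod.snd_add, map_add, smul_add]
      exact add_add_add_comm _ _ _ _

variable (n m) in
/-- The homotopy that contracts what `tildeToBF` forgets. -/
def tildeBFHomotopy : TildeElt n m →+ TildeElt n m :=
  AddMonoidHom.mk' (fun x : TildeElt n m => ((0, 0, atOrigin n m x.2.2.2.1,
    cone n m x.2.2.2.1, 0) : TildeElt n m)) fun x y => by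
    refine Prod.ext (add_zero _).symm (Prod.ext (add_zero _).symm (Prod.ext ?_ (Prod.ext ?_
      (add_zero _).symm)))
    all_goals simp only [Prod.snd_add, Prod.fst_add, map_add]

variable (n p m) in
/-- The homotopy that contracts the first two rows of the coupled theory against each other, and the
fourth row together with the constants of the third. -/
def bfHomotopy : BFElt n m →+ BFElt n m :=
  AddMonoidHom.mk' (fun x : BFElt n m => ((-x.2.2.1,
    alternate n m x.2.2.2.1 + keep n m (p + 1 ≤ ·) (cone n m x.2.1), 0, 0, 0,
    atOrigin n m x.2.2.2.2.2.2.2.2, 0, 0, cone n m x.2.2.2.2.2.2.2.2) : BFElt n m)) fun x y => by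
    refine Prod.ext ?_ (Prod.ext ?_ (Prod.ext (add_zero _).symm
      (Prod.ext (add_zero _).symm (Prod.ext (add_zero _).symm (Prod.ext ?_
      (Prod.ext (add_zero _).symm (Prod.ext (add_zero _).symm ?_)))))))
    · exact neg_add _ _
    · simp only [Prod.snd_add, Prod.fst_add, map_add]
      exact add_add_add_comm _ _ _ _
    · simp only [Prod.snd_add, map_add]
      rfl
    · simp only [Prod.snd_add, map_add]

theorem tildeToBF_mem (h : p + q + 2 = n) (hp : p + 2 ≤ n) (hq : q + 2 ≤ n) {i : ℤ} {κ' : ℝ}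
    {x : TildeElt n m} (hx : x ∈ (maxwellTildePatch V m q κ' hq).degree i) :
    tildeToBF V m p κ ε x ∈ (maxwellBFPatch V m p κ hp).degree i := by
  rw [mem_maxwellTildePatch_degree h hq] at hx
  rw [mem_maxwellBFPatch_degree h hp]
  obtain ⟨hz, hA, hr, hC, hρ⟩ := hx
  refine ⟨zero_mem _, smul_mem_formsIn _ ?_, zero_mem _, zero_mem _, smul_mem_formsIn _ ?_,
    neg_mem (map_mem_onlyIf _ hz), smul_mem_formsIn _ hA, hz, zero_mem _⟩
  · exact dForms_mem (fun k hk => by push_cast; omega)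
      (keep_mem (Q := fun k => (k : ℤ) = i + p) (fun k hk _ => hk.1) hC)
  · exact star_mem V (fun k l hkl hk => by omega) hρ

theorem bfToTilde_mem (h : p + q + 2 = n) (hp : p + 2 ≤ n) (hq : q + 2 ≤ n) {i : ℤ} {κ' : ℝ}
    {x : BFElt n m} (hx : x ∈ (maxwellBFPatch V m p κ hp).degree i) :
    bfToTilde V m p κ ε x ∈ (maxwellTildePatch V m q κ' hq).degree i := by
  rw [mem_maxwellBFPatch_degree h hp] at hx
  rw [mem_maxwellTildePatch_degree h hq]
  obtain ⟨hy, hB, hz, hA, hρ, hr, hC, hw, hE⟩ := hx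
  refine ⟨hw, add_mem (smul_mem_formsIn _ hC) (smul_mem_formsIn _ ?_), zero_mem _,
    add_mem (smul_mem_formsIn _ ?_) (smul_mem_formsIn _ ?_),
    add_mem (smul_mem_formsIn _ ?_) (smul_mem_formsIn _ ?_)⟩
  · exact const_mem (P := ((0 : ℕ) : ℤ) = i + q) (fun h => ⟨h, Nat.zero_le q⟩)
      (atOrigin_mem (fun h => h) hE)
  · exact cone_mem (P := fun k => i = 0 ∧ k = p + 1) (fun k hk => by omega)
      (keep_mem (fun k h h' => by omega) hB)
  · exact cone_mem (P := fun k => i = 0 ∧ k = p + 1) (fun k hk => by omega)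
      (dForms_mem (P := fun k => i = 0 ∧ k = p) (fun k hk => by omega)
        (keep_mem (fun k h h' => by omega) hA))
  · exact star_mem V (fun k l hkl hk => by omega) hρ
  · exact cone_mem (P := fun k => i = 1 ∧ k = p + 2) (fun k hk => by omega)
      (keep_mem (fun k h h' => by omega) hB)

theorem tildeBFHomotopy_mem (h : p + q + 2 = n) (hq : q + 2 ≤ n) {i j : ℤ} (hij : j + 1 = i)
    {x : TildeElt n m} (hx : x ∈ (maxwellTildePatch V m q κ hq).degree i) :
    tildeBFHomotopy n m x ∈ (maxwellTildePatch V m q κ hq).degree j := by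
  rw [mem_maxwellTildePatch_degree h hq] at hx ⊢
  exact ⟨zero_mem _, zero_mem _, atOrigin_mem (fun h => by omega) hx.2.2.2.1,
    cone_mem (fun k hk => by omega) hx.2.2.2.1, zero_mem _⟩

theorem bfHomotopy_mem (h : p + q + 2 = n) (hp : p + 2 ≤ n) {i j : ℤ} (hij : j + 1 = i)
    {x : BFElt n m} (hx : x ∈ (maxwellBFPatch V m p κ hp).degree i) :
    bfHomotopy n m p x ∈ (maxwellBFPatch V m p κ hp).degree j := by
  rw [mem_maxwellBFPatch_degree h hp] at hx ⊢
  obtain ⟨hy, hB, hz, hA, hρ, hr, hC, hw, hE⟩ := hx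
  refine ⟨neg_mem (mem_onlyIf.2 fun h => mem_onlyIf.1 hz fun h' => h (by omega)),
    add_mem (alternate_mem (fun k hk => by omega) hA)
      (keep_mem (P := fun k => (k : ℤ) = j + p + 1) (fun k hk _ => hk)
        (cone_mem (fun k hk => by push_cast at hk; omega) hB)),
    zero_mem _, zero_mem _, zero_mem _, atOrigin_mem (fun h => by push_cast at h; omega) hE,
    zero_mem _, zero_mem _, cone_mem (fun k hk => by push_cast at hk; omega) hE⟩

theorem tildeToBF_diff (hκ : κ ≠ 0) (hε : ε ≠ 0)
    (hV : ∀ α ∈ formsIn n m (· = q + 1), V.star m (V.star m α) = ε • α) (x : TildeElt n m) :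
    tildeToBF V m p κ ε (tildeDiff V m p q κ⁻¹ x) =
      bfDiff V m p q κ (tildeToBF V m p κ ε x) := by
  obtain ⟨z, A, r, C, ρ⟩ := x
  have hd : dForms n m (keep n m (· = p) C) ∈ formsIn n m (· = p + 1) :=
    dForms_mem (P := (· = p)) (fun k hk => by omega) (keep_mem_eq p C)
  have hd' : dForms n m (keep n m (· = q) A) ∈ formsIn n m (· = q + 1) :=
    dForms_mem (P := (· = q)) (fun k hk => by omega) (keep_mem_eq q A)
  refine Prod.ext rfl (Prod.ext ?_ (Prod.ext neg_zero.symm (Prod.ext ?_ (Prod.ext ?_ (Prod.ext ?_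
    (Prod.ext ?_ (Prod.ext rfl ?_)))))))
  · change ((-1) ^ p * (2 / ε)) • dForms n m (keep n m (· = p)
        (keep n m (· ≤ p) (dForms n m C) + const n m r)) =
      dForms n m (((-1) ^ p * (2 / ε)) • dForms n m (keep n m (· = p) C)) + intConst n m 0
    simp only [map_add, map_smul, dForms_keep_eq_keep_dForms, dForms_keep_const, dForms_dForms,
      smul_zero, map_zero, add_zero]
  · change 0 = keep n m (· ≤ p) (dForms n m 0) + intConst n m 0 + keep n m (· ≤ p)
      (alternate n m (((-1) ^ p * (2 / ε)) • dForms n m (keep n m (· = p) C)))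
    rw [keep_eq_zero (alternate_mem (Q := (· = p + 1)) (fun _ hk => hk) (smul_mem_formsIn _ hd))
      fun k hk => by omega]
    simp only [map_zero, add_zero]
  · change (2 * κ / ε) • V.star m (V.star m (dForms n m (keep n m (· = q) A)) +
        (-κ⁻¹) • dForms n m (keep n m (· = p) C)) =
      V.star m (dForms n m (keep n m (· = p) 0)) +
        (-κ) • dForms n m (keep n m (· = q) ((-2 : ℝ) • A)) +
        ((-1 : ℝ) ^ (p + 1)) • V.star m (keep n m (· = p + 1)
          (((-1) ^ p * (2 / ε)) • dForms n m (keep n m (· = p) C)))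
    rw [keep_eq_self (smul_mem_formsIn _ hd)]
    simp only [map_add, map_smul, map_zero, hV _ hd', zero_add]
    generalize dForms n m (keep n m (· = q) A) = S
    generalize V.star m (dForms n m (keep n m (· = p) C)) = T
    obtain hs | hs := neg_one_pow_eq_or ℝ p <;> rw [pow_succ, hs] <;> match_scalars <;> field_simp
  · change -intParam m 0 = 0
    simp
  · change (-2 : ℝ) • (keep n m (· ≤ q) (dForms n m A) + intConst n m z) =
      keep n m (· ≤ q) (dForms n m ((-2 : ℝ) • A)) + const n m (-intParam m z) + intConst n m (-z)
    rw [map_neg, map_neg, ← intConst_eq, map_smul, map_smul]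
    module
  · change 0 = dForms n m 0 + const n m (-intParam m z) + intConst n m z
    rw [map_neg, ← intConst_eq, map_zero]
    module

theorem bfToTilde_diff (hκ : κ ≠ 0) (hε : ε ≠ 0)
    (hV : ∀ α ∈ formsIn n m (· = p + 1), V.star m (V.star m α) = ε • α) (x : BFElt n m) :
    bfToTilde V m p κ ε (bfDiff V m p q κ x) =
      tildeDiff V m p q κ⁻¹ (bfToTilde V m p κ ε x) := by
  obtain ⟨y, B, z, A, ρ, r, C, w, E⟩ := x
  have hd : dForms n m (keep n m (· = p) A) ∈ formsIn n m (· = p + 1) :=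
    dForms_mem (P := (· = p)) (fun k hk => by omega) (keep_mem_eq p A)
  have hB := keep_mem_eq (p + 1) B
  refine Prod.ext rfl (Prod.ext ?_ (Prod.ext rfl (Prod.ext ?_ ?_)))
  · change (-(1 / 2) : ℝ) • (keep n m (· ≤ q) (dForms n m C) + const n m r + intConst n m (-w)) +
        (1 / 2 : ℝ) • const n m (atOrigin n m (dForms n m E + const n m r + intConst n m w)) =
      keep n m (· ≤ q) (dForms n m ((-(1 / 2) : ℝ) • C +
        (1 / 2 : ℝ) • const n m (atOrigin n m E))) + intConst n m w
    simp only [map_add, map_smul, atOrigin_dForms, atOrigin_const, intConst_eq, dForms_const,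
      map_zero, map_neg]
    module
  · change ((-1) ^ p * (ε / 2)) • cone n m (keep n m (· = p + 1) (dForms n m B + intConst n m y)) +
        (-(ε / 2)) • cone n m (dForms n m (keep n m (· = p) (keep n m (· ≤ p) (dForms n m A) +
          intConst n m z + keep n m (· ≤ p) (alternate n m B)))) =
      keep n m (· ≤ p) (dForms n m (((-1) ^ p * (ε / 2)) • cone n m (keep n m (· = p + 1) B) +
        (-(ε / 2)) • cone n m (dForms n m (keep n m (· = p) A)))) + const n m 0
    have h0 {α : Forms n m} (hα : α ∈ formsIn n m (· = p + 1)) :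
        keep n m (· ≤ p) (dForms n m (cone n m α)) = 0 :=
      keep_eq_zero (dForms_mem (P := (· = p)) (Q := (· = p + 1)) (fun k hk => by omega)
        (cone_mem (fun k hk => by omega) hα)) fun k hk => by omega
    simp only [map_add, map_smul, h0 hB, h0 hd, keep_succ_intConst, dForms_keep_eq_keep_dForms,
      dForms_keep_intConst, dForms_keep_alternate, map_zero]
    generalize cone n m (keep n m (· = p + 1) (dForms n m B)) = S
    module
  · change (2 * κ)⁻¹ • V.star m (V.star m (dForms n m (keep n m (· = p) A)) +
          (-κ) • dForms n m (keep n m (· = q) C) +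
          ((-1 : ℝ) ^ (p + 1)) • V.star m (keep n m (· = p + 1) B)) +
        ((-1) ^ p * (ε / (2 * κ))) • cone n m (keep n m (· = p + 2)
          (dForms n m B + intConst n m y)) =
      V.star m (dForms n m (keep n m (· = q) ((-(1 / 2) : ℝ) • C +
          (1 / 2 : ℝ) • const n m (atOrigin n m E)))) +
        (-κ⁻¹) • dForms n m (keep n m (· = p) (((-1) ^ p * (ε / 2)) •
          cone n m (keep n m (· = p + 1) B) +
          (-(ε / 2)) • cone n m (dForms n m (keep n m (· = p) A))))
    have h0 {α : Forms n m} (hα : α ∈ formsIn n m (· = p + 1)) :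
        keep n m (· = p) (cone n m α) = cone n m α :=
      keep_eq_self (cone_mem (fun k hk => by omega) hα)
    have h1 := dForms_cone_add hB
    have h2 := dForms_cone_add hd
    rw [dForms_dForms, map_zero, add_zero] at h2
    simp only [map_add, map_smul, h0 hB, h0 hd, h2, hV _ hB, hV _ hd, dForms_keep_const,
      smul_zero, add_zero, keep_dForms,
      show keep n m (· = p + 2) (intConst n m y) = 0 from keep_const_eq_zero (by omega) _]
    generalize dForms n m (cone n m (keep n m (· = p + 1) B)) = S at h1 ⊢
    generalize cone n m (dForms n m (keep n m (· = p + 1) B)) = S' at h1 ⊢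
    rw [← h1]
    generalize dForms n m (keep n m (· = p) A) = T
    generalize V.star m (dForms n m (keep n m (· = q) C)) = T'
    obtain hs | hs := neg_one_pow_eq_or ℝ p <;> rw [pow_succ, hs] <;> match_scalars <;>
      field_simp <;> ring

theorem tildeBFHomotopy_comm (h : p + q + 2 = n) (hq : q + 2 ≤ n) (hκ : κ ≠ 0) (hε : ε ≠ 0)
    (hV : ∀ α ∈ formsIn n m (· = p + 1), V.star m (V.star m α) = ε • α) {i : ℤ} {κ' : ℝ}
    {x : TildeElt n m} (hx : x ∈ (maxwellTildePatch V m q κ' hq).degree i) :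
    x = tildeBFHomotopy n m (tildeDiff V m p q κ' x) +
      tildeDiff V m p q κ' (tildeBFHomotopy n m x) +
      bfToTilde V m p κ ε (tildeToBF V m p κ ε x) := by
  rw [mem_maxwellTildePatch_degree h hq] at hx
  obtain ⟨z, A, r, C, ρ⟩ := x
  obtain ⟨hz, hA, hr, hC, hρ⟩ := hx
  have hd : dForms n m (keep n m (· = p) C) ∈ formsIn n m (· = p + 1) :=
    dForms_mem (P := (· = p)) (fun k hk => by omega) (keep_mem_eq p C)
  refine Prod.ext ?_ (Prod.ext ?_ (Prod.ext ?_ (Prod.ext ?_ ?_)))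
  · change z = 0 + 0 + z
    simp
  · change A = 0 + (keep n m (· ≤ q) (dForms n m 0) + intConst n m 0) +
      ((-(1 / 2) : ℝ) • (-2 : ℝ) • A + (1 / 2 : ℝ) • const n m (atOrigin n m 0))
    simp only [map_zero]
    module
  · change r = atOrigin n m (keep n m (· ≤ p) (dForms n m C) + const n m r) + 0 + 0
    rw [map_add, atOrigin_const, atOrigin_eq_zero (by simp [keep_apply, dForms_apply_zero])]
    simp
  · change C = cone n m (keep n m (· ≤ p) (dForms n m C) + const n m r) +
      (keep n m (· ≤ p) (dForms n m (cone n m C)) + const n m (atOrigin n m C)) +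
      (((-1) ^ p * (ε / 2)) • cone n m (keep n m (· = p + 1)
        (((-1) ^ p * (2 / ε)) • dForms n m (keep n m (· = p) C))) +
      (-(ε / 2)) • cone n m (dForms n m (keep n m (· = p) 0)))
    have h1 := poincare_truncated fun k hk => mem_formsIn.1 hC k fun h => hk h.2
    rw [keep_eq_self (smul_mem_formsIn _ hd)]
    simp only [map_add, map_smul, cone_const, map_zero, add_zero, smul_zero]
    obtain hs | hs := neg_one_pow_eq_or ℝ p <;> rw [hs] <;>
      linear_combination (norm := (match_scalars <;> field_simp <;> ring)) -h1
  · change ρ = 0 + (V.star m (dForms n m (keep n m (· = q) 0)) + (-κ') • dForms n m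
        (keep n m (· = p) (cone n m C))) +
      ((2 * κ)⁻¹ • V.star m ((2 * κ / ε) • V.star m ρ) + ((-1) ^ p * (ε / (2 * κ))) •
        cone n m (keep n m (· = p + 2)
          (((-1) ^ p * (2 / ε)) • dForms n m (keep n m (· = p) C))))
    rw [keep_eq_zero (smul_mem_formsIn _ hd) fun k hk => by omega,
      keep_eq_zero (cone_mem (Q := (· < p)) (fun k hk => by omega) hC) fun k hk => by omega]
    simp only [map_smul, map_zero, hV ρ (formsIn_mono (fun k hk => hk.2) hρ)]
    match_scalars
    field_simp

/-- On homogeneous elements the forms `A` and `C` of the truncated rows have no components of higher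
degree, which the projections in the differential would discard. -/
theorem bfHomotopy_comm (h : p + q + 2 = n) (hp : p + 2 ≤ n) (hκ : κ ≠ 0) (hε : ε ≠ 0)
    (hV : ∀ α ∈ formsIn n m (· = q + 1), V.star m (V.star m α) = ε • α) {i : ℤ}
    {x : BFElt n m} (hx : x ∈ (maxwellBFPatch V m p κ hp).degree i) :
    x = bfHomotopy n m p (bfDiff V m p q κ x) + bfDiff V m p q κ (bfHomotopy n m p x) +
      tildeToBF V m p κ ε (bfToTilde V m p κ ε x) := by
  rw [mem_maxwellBFPatch_degree h hp] at hx
  obtain ⟨y, B, z, A, ρ, r, C, w, E⟩ := x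
  obtain ⟨hy, hB, hz, hA, hρ, hr, hC, hw, hE⟩ := hx
  have hA' (k : ℕ) (hk : ¬ k ≤ p) : A k = 0 := mem_formsIn.1 hA k fun h => hk h.2
  refine Prod.ext ?_ (Prod.ext ?_ (Prod.ext ?_ (Prod.ext ?_ (Prod.ext ?_ (Prod.ext ?_
    (Prod.ext ?_ (Prod.ext ?_ ?_)))))))
  · change y = - -y + 0 + 0
    simp
  · change B = alternate n m (keep n m (· ≤ p) (dForms n m A) + intConst n m z +
          keep n m (· ≤ p) (alternate n m B)) +
        keep n m (p + 1 ≤ ·) (cone n m (dForms n m B + intConst n m y)) +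
      (dForms n m (alternate n m A + keep n m (p + 1 ≤ ·) (cone n m B)) + intConst n m (-z)) +
      ((-1) ^ p * (2 / ε)) • dForms n m (keep n m (· = p)
        (((-1) ^ p * (ε / 2)) • cone n m (keep n m (· = p + 1) B) +
          (-(ε / 2)) • cone n m (dForms n m (keep n m (· = p) A))))
    have hd : dForms n m (keep n m (· = p) A) ∈ formsIn n m (· = p + 1) :=
      dForms_mem (P := (· = p)) (fun k hk => by omega) (keep_mem_eq p A)
    have h0 {α : Forms n m} (hα : α ∈ formsIn n m (· = p + 1)) :
        keep n m (· = p) (cone n m α) = cone n m α :=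
      keep_eq_self (cone_mem (fun k hk => by omega) hα)
    have h1 := poincare_coupled A B hA'
    have h2 := dForms_cone_add hd
    rw [dForms_dForms, map_zero, add_zero] at h2
    simp only [map_add, map_smul, keep_alternate, alternate_alternate, intConst_eq,
      alternate_const, cone_const, map_zero, map_neg, h0 hd, h0 (keep_mem_eq (p + 1) B), h2]
    obtain hs | hs := neg_one_pow_eq_or ℝ p <;> rw [hs] at h1 ⊢ <;>
      linear_combination (norm := (match_scalars <;> field_simp <;> ring)) -h1
  · change z = 0 + - -z + 0
    simp
  · change A = 0 + (keep n m (· ≤ p) (dForms n m 0) + intConst n m 0 + keep n m (· ≤ p)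
      (alternate n m (alternate n m A + keep n m (p + 1 ≤ ·) (cone n m B)))) + 0
    rw [keep_alternate, map_add, map_add, keep_alternate, alternate_alternate,
      keep_eq_self (α := A) (mem_formsIn.2 fun k hk => hA' k hk),
      keep_eq_zero (Q := (p + 1 ≤ ·)) (keep_mem (P := fun _ => True) (fun _ _ h => h) fun k hk =>
        absurd trivial hk) fun k hk => by omega]
    simp only [map_zero, add_zero, zero_add]
  · change ρ = 0 + (V.star m (dForms n m (keep n m (· = p) 0)) +
        (-κ) • dForms n m (keep n m (· = q) 0) +
        ((-1 : ℝ) ^ (p + 1)) • V.star m (keep n m (· = p + 1)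
          (alternate n m A + keep n m (p + 1 ≤ ·) (cone n m B)))) +
      (2 * κ / ε) • V.star m ((2 * κ)⁻¹ • V.star m ρ +
        ((-1) ^ p * (ε / (2 * κ))) • cone n m (keep n m (· = p + 2) B))
    have h1 : keep n m (· = p + 1) (alternate n m A + keep n m (p + 1 ≤ ·) (cone n m B)) =
        cone n m (keep n m (· = p + 2) B) := by
      funext k
      by_cases hk : k = p + 1
      · subst hk
        simp [keep_apply, alternate_apply, cone_apply, hA']
      · simp [keep_apply, cone_apply, hk]
    rw [h1]
    simp only [map_add, map_smul, map_zero, hV ρ (formsIn_mono (fun k hk => hk.2) hρ)]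
    generalize V.star m (cone n m (keep n m (· = p + 2) B)) = S
    obtain hs | hs := neg_one_pow_eq_or ℝ p <;> rw [pow_succ, hs] <;> match_scalars <;>
      field_simp <;> ring
  · change r = atOrigin n m (dForms n m E + const n m r + intConst n m w) + 0 + -intParam m w
    simp only [map_add, atOrigin_dForms, atOrigin_const, intConst_eq]
    module
  · change C = 0 + (keep n m (· ≤ q) (dForms n m 0) + const n m (atOrigin n m E) +
        intConst n m (-0)) +
      (-2 : ℝ) • ((-(1 / 2) : ℝ) • C + (1 / 2 : ℝ) • const n m (atOrigin n m E))
    simp only [map_zero, neg_zero]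
    module
  · change w = 0 + 0 + w
    simp
  · change E = cone n m (dForms n m E + const n m r + intConst n m w) +
      (dForms n m (cone n m E) + const n m (atOrigin n m E) + intConst n m 0) + 0
    have h1 := dForms_cone_add_cone_dForms E
    simp only [map_add, cone_const, intConst_eq, map_zero]
    linear_combination (norm := module) -h1

end TildeBF

/-! ### The equivalence with the coupled theory -/

section TildeBF

variable {σ : Signature} {n p q : ℕ} {κ ε : ℝ} (h : p + q + 2 = n) (hp : p + 2 ≤ n)
  (hq : q + 2 ≤ n) (hκ : κ ≠ 0) (hε : ε ≠ 0)

section Patch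

variable (V : Patch σ n) (m : ℕ)

/-- The map `tildeToBF` as a map of graded groups with differentials. -/
def tildeToBFHom (hV : ∀ α ∈ formsIn n m (· = q + 1), V.star m (V.star m α) = ε • α) :
    DiffGroup.GradedHom (maxwellTildePatch V m q κ⁻¹ hq) (maxwellBFPatch V m p κ hp) where
  map := tildeToBF V m p κ ε
  mem _ _ := tildeToBF_mem h hp hq
  comm _ x _ := (congrArg _ (maxwellTildePatch_diff h hq x)).trans
    ((tildeToBF_diff hκ hε hV x).trans (maxwellBFPatch_diff h hp _).symm)

/-- The map `bfToTilde` as a map of graded groups with differentials. -/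
def bfToTildeHom (hV : ∀ α ∈ formsIn n m (· = p + 1), V.star m (V.star m α) = ε • α) :
    DiffGroup.GradedHom (maxwellBFPatch V m p κ hp) (maxwellTildePatch V m q κ⁻¹ hq) where
  map := bfToTilde V m p κ ε
  mem _ _ := bfToTilde_mem h hp hq
  comm _ x _ := (congrArg _ (maxwellBFPatch_diff h hp x)).trans
    ((bfToTilde_diff hκ hε hV x).trans (maxwellTildePatch_diff h hq _).symm)

/-- The homotopy `tildeBFHomotopy` as a contraction. -/
def tildeBFContraction (hV : ∀ α ∈ formsIn n m (· = p + 1), V.star m (V.star m α) = ε • α)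
    (hV' : ∀ α ∈ formsIn n m (· = q + 1), V.star m (V.star m α) = ε • α) :
    (maxwellTildePatch V m q κ⁻¹ hq).Contraction fun x =>
      (bfToTildeHom h hp hq hκ hε V m hV).map ((tildeToBFHom h hp hq hκ hε V m hV').map x) where
  map := tildeBFHomotopy n m
  mem _ _ _ hij := tildeBFHomotopy_mem h hq hij
  comm _ x hx := by
    refine (tildeBFHomotopy_comm h hq hκ hε hV hx).trans ?_
    exact congrArg₂ (fun a b => tildeBFHomotopy n m a + b +
      bfToTilde V m p κ ε (tildeToBF V m p κ ε x)) (maxwellTildePatch_diff h hq _).symm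
      (maxwellTildePatch_diff h hq _).symm

/-- The homotopy `bfHomotopy` as a contraction. -/
def bfContraction (hV : ∀ α ∈ formsIn n m (· = p + 1), V.star m (V.star m α) = ε • α)
    (hV' : ∀ α ∈ formsIn n m (· = q + 1), V.star m (V.star m α) = ε • α) :
    (maxwellBFPatch V m p κ hp).Contraction fun x =>
      (tildeToBFHom h hp hq hκ hε V m hV').map ((bfToTildeHom h hp hq hκ hε V m hV).map x) where
  map := bfHomotopy n m p
  mem _ _ _ hij := bfHomotopy_mem h hp hij
  comm _ x hx := by
    refine (bfHomotopy_comm h hp hκ hε hV' hx).trans ?_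
    exact congrArg₂ (fun a b => bfHomotopy n m p a + b +
      tildeToBF V m p κ ε (bfToTilde V m p κ ε x)) (maxwellBFPatch_diff h hp _).symm
      (maxwellBFPatch_diff h hp _).symm

end Patch

section Natural

variable {V W : Patch σ n} {m m' : ℕ} (T : Transport V W m m')

theorem Transport.param_intParam (z : ℤ) : T.param (intParam m' z) = intParam m z := by
  have h1 := (T.form_const (intParam m' z)).symm.trans (T.form_intConst z)
  have h2 := congrArg (atOrigin n m) h1
  rwa [intConst_eq, atOrigin_const, atOrigin_const] at h2

theorem tildeToBF_natural {κ' : ℝ} (x : TildeElt n m') :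
    tildeToBF V m p κ ε ((T.maxwellTilde q κ' hq).map x) =
      (T.maxwellBF p κ hp).map (tildeToBF W m' p κ ε x) := by
  refine Prod.ext rfl (Prod.ext ?_ (Prod.ext rfl (Prod.ext (map_zero T.form).symm (Prod.ext ?_
    (Prod.ext ?_ (Prod.ext (T.form_smul _ _).symm (Prod.ext rfl (map_zero T.form).symm)))))))
  · change ((-1) ^ p * (2 / ε)) • dForms n m (keep n m (· = p) (T.form x.2.2.2.1)) =
      T.form (((-1) ^ p * (2 / ε)) • dForms n m' (keep n m' (· = p) x.2.2.2.1))
    rw [T.form_smul, T.form_dForms, T.form_keep]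
  · change (2 * κ / ε) • V.star m (T.form x.2.2.2.2) =
      T.form ((2 * κ / ε) • W.star m' x.2.2.2.2)
    rw [T.form_smul, T.form_star]
  · change -intParam m x.1 = T.param (-intParam m' x.1)
    rw [map_neg, T.param_intParam]

theorem bfToTilde_natural {κ' : ℝ} (hT : ∀ α, T.form (cone n m' α) = cone n m (T.form α))
    (hT' : ∀ α, T.param (atOrigin n m' α) = atOrigin n m (T.form α)) (x : BFElt n m') :
    bfToTilde V m p κ ε ((T.maxwellBF p κ hp).map x) =
      (T.maxwellTilde q κ' hq).map (bfToTilde W m' p κ ε x) := by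
  refine Prod.ext rfl (Prod.ext ?_ (Prod.ext (map_zero T.param).symm (Prod.ext ?_ ?_)))
  · change (-(1 / 2) : ℝ) • T.form x.2.2.2.2.2.2.1 +
        (1 / 2 : ℝ) • const n m (atOrigin n m (T.form x.2.2.2.2.2.2.2.2)) =
      T.form ((-(1 / 2) : ℝ) • x.2.2.2.2.2.2.1 +
        (1 / 2 : ℝ) • const n m' (atOrigin n m' x.2.2.2.2.2.2.2.2))
    rw [map_add, T.form_smul, T.form_smul, T.form_const, hT']
  · change ((-1) ^ p * (ε / 2)) • cone n m (keep n m (· = p + 1) (T.form x.2.1)) +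
        (-(ε / 2)) • cone n m (dForms n m (keep n m (· = p) (T.form x.2.2.2.1))) =
      T.form (((-1) ^ p * (ε / 2)) • cone n m' (keep n m' (· = p + 1) x.2.1) +
        (-(ε / 2)) • cone n m' (dForms n m' (keep n m' (· = p) x.2.2.2.1)))
    rw [map_add, T.form_smul, T.form_smul, hT, hT, T.form_dForms, T.form_keep, T.form_keep]
  · change (2 * κ)⁻¹ • V.star m (T.form x.2.2.2.2.1) +
        ((-1) ^ p * (ε / (2 * κ))) • cone n m (keep n m (· = p + 2) (T.form x.2.1)) =
      T.form ((2 * κ)⁻¹ • W.star m' x.2.2.2.2.1 +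
        ((-1) ^ p * (ε / (2 * κ))) • cone n m' (keep n m' (· = p + 2) x.2.1))
    rw [map_add, T.form_smul, T.form_smul, T.form_star, hT, T.form_keep]

theorem tildeBFHomotopy_natural {κ' : ℝ} (hT : ∀ α, T.form (cone n m' α) = cone n m (T.form α))
    (hT' : ∀ α, T.param (atOrigin n m' α) = atOrigin n m (T.form α)) (x : TildeElt n m') :
    tildeBFHomotopy n m ((T.maxwellTilde q κ' hq).map x) =
      (T.maxwellTilde q κ' hq).map (tildeBFHomotopy n m' x) :=
  Prod.ext rfl (Prod.ext (map_zero T.form).symm (Prod.ext (hT' _).symm (Prod.ext (hT _).symm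
    (map_zero T.form).symm)))

theorem bfHomotopy_natural (hT : ∀ α, T.form (cone n m' α) = cone n m (T.form α))
    (hT' : ∀ α, T.param (atOrigin n m' α) = atOrigin n m (T.form α)) (x : BFElt n m') :
    bfHomotopy n m p ((T.maxwellBF p κ hp).map x) =
      (T.maxwellBF p κ hp).map (bfHomotopy n m' p x) := by
  refine Prod.ext rfl (Prod.ext ?_ (Prod.ext rfl (Prod.ext (map_zero T.form).symm
    (Prod.ext (map_zero T.form).symm (Prod.ext (hT' _).symm (Prod.ext (map_zero T.form).symm
    (Prod.ext rfl (hT _).symm)))))))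
  change alternate n m (T.form x.2.2.2.1) + keep n m (p + 1 ≤ ·) (cone n m (T.form x.2.1)) =
    T.form (alternate n m' x.2.2.2.1 + keep n m' (p + 1 ≤ ·) (cone n m' x.2.1))
  rw [map_add, T.form_alternate, T.form_keep, hT]

end Natural

/-- The map `tildeToBF` on all coordinate patches and in all families. -/
def tildeToBFMap (hV' : ∀ (V : Patch σ n) (m : ℕ), ∀ α ∈ formsIn n m (· = q + 1),
      V.star m (V.star m α) = ε • α) :
    GradedMap (maxwellTildeDiff σ n q κ⁻¹ hq) (maxwellBFDiff σ n p κ hp) where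
  hom VX := tildeToBFHom h hp hq hκ hε VX.1.unop VX.2.unop.dim (hV' _ _)
  natural u := tildeToBF_natural hp hq (transport u.1.unop u.2.unop)

variable (V : (PatchCat σ n)ᵒᵖ)

/-- The map `bfToTilde` in all families on a coordinate patch. -/
def bfToTildeMap (hV : ∀ (V : Patch σ n) (m : ℕ), ∀ α ∈ formsIn n m (· = p + 1),
      V.star m (V.star m α) = ε • α) :
    GradedMap ((Functor.curry.obj (maxwellBFDiff σ n p κ hp)).obj V)
      ((Functor.curry.obj (maxwellTildeDiff σ n q κ⁻¹ hq)).obj V) where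
  hom X := bfToTildeHom h hp hq hκ hε V.unop X.unop.dim (hV _ _)
  natural u := bfToTilde_natural hp hq _ (transport_cone V u) (transport_atOrigin V u)

/-- The homotopy `tildeBFHomotopy` in all families on a coordinate patch. -/
def tildeBFGradedHomotopy
    (hV : ∀ (V : Patch σ n) (m : ℕ), ∀ α ∈ formsIn n m (· = p + 1),
      V.star m (V.star m α) = ε • α)
    (hV' : ∀ (V : Patch σ n) (m : ℕ), ∀ α ∈ formsIn n m (· = q + 1),
      V.star m (V.star m α) = ε • α) :
    GradedHomotopy fun X x => ((bfToTildeMap h hp hq hκ hε V hV).hom X).map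
      ((((tildeToBFMap h hp hq hκ hε hV').atPatch V).hom X).map x) where
  contraction X := tildeBFContraction h hp hq hκ hε V.unop X.unop.dim (hV _ _) (hV' _ _)
  natural u := tildeBFHomotopy_natural hq _ (transport_cone V u) (transport_atOrigin V u)

/-- The homotopy `bfHomotopy` in all families on a coordinate patch. -/
def bfGradedHomotopy
    (hV : ∀ (V : Patch σ n) (m : ℕ), ∀ α ∈ formsIn n m (· = p + 1),
      V.star m (V.star m α) = ε • α)
    (hV' : ∀ (V : Patch σ n) (m : ℕ), ∀ α ∈ formsIn n m (· = q + 1),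
      V.star m (V.star m α) = ε • α) :
    GradedHomotopy fun X x => (((tildeToBFMap h hp hq hκ hε hV').atPatch V).hom X).map
      (((bfToTildeMap h hp hq hκ hε V hV).hom X).map x) where
  contraction X := bfContraction h hp hq hκ hε V.unop X.unop.dim (hV _ _) (hV' _ _)
  natural u := bfHomotopy_natural hp _ (transport_cone V u) (transport_atOrigin V u)

/-- The square of the Hodge star on forms in one of two complementary degrees. -/
theorem star_star_eq_smul {V : Patch σ n} {m k l : ℕ} (hkl : k + l = n)
    (hV : ∀ α, V.star m (V.star m α) k = ε • α k) {α : Forms n m}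
    (hα : α ∈ formsIn n m (· = k)) : V.star m (V.star m α) = ε • α := by
  have h1 : V.star m α ∈ formsIn n m (· = l) := star_mem V (fun _ _ h h' => by omega) hα
  have h2 : V.star m (V.star m α) ∈ formsIn n m (· = k) :=
    star_mem V (fun _ _ h h' => by omega) h1
  funext j
  by_cases hj : j = k
  · subst hj
    exact hV α
  · rw [mem_formsIn.1 h2 j hj, Pi.smul_apply, mem_formsIn.1 hα j hj, smul_zero]

/-- The coupled theory is homotopy equivalent, on coordinate patches, to the second presentation of
the dual Maxwell theory with the inverse coupling. -/
theorem exists_isPatchwiseHomotopyEquiv_tilde_bf (σ : Signature) {n p q : ℕ} {κ : ℝ}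
    (h : p + q + 2 = n) (hp : p + 2 ≤ n) (hq : q + 2 ≤ n) (hκ : κ ≠ 0) :
    ∃ f : MaxwellTilde σ n q κ⁻¹ hq ⟶ MaxwellBF σ n p κ hp, IsPatchwiseHomotopyEquiv f := by
  obtain ⟨ε, hε, hs⟩ := exists_star_star σ (show (p + 1) + (q + 1) = n by omega)
  have hV (V : Patch σ n) (m : ℕ) (α : Forms n m) (hα : α ∈ formsIn n m (· = p + 1)) :
      V.star m (V.star m α) = ε • α :=
    star_star_eq_smul (l := q + 1) (by omega) (fun α => (hs V m α).1) hα
  have hV' (V : Patch σ n) (m : ℕ) (α : Forms n m) (hα : α ∈ formsIn n m (· = q + 1)) :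
      V.star m (V.star m α) = ε • α :=
    star_star_eq_smul (l := p + 1) (by omega) (fun α => (hs V m α).2) hα
  exact ⟨_, isPatchwiseHomotopyEquiv_of_gradedMap (tildeToBFMap h hp hq hκ hε hV') fun V =>
    GradedMap.isNaturalHomotopyEquiv _ (bfToTildeMap h hp hq hκ hε V hV)
      (tildeBFGradedHomotopy h hp hq hκ hε V hV hV') (bfGradedHomotopy h hp hq hκ hε V hV hV')⟩

end TildeBF

end HigherMaxwell
end

theorem mainTheorem6 (σ : HigherMaxwell.Signature) (n p : ℕ) (hp : p + 2 ≤ n) (κ : ℝ)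
    (hκ : κ ≠ 0) :
    Nonempty ((HigherMaxwell.MaxwellBF σ n p κ hp).sheaf ≅
      (HigherMaxwell.MaxwellTilde σ n (n - p - 2) (1 / κ) (by omega)).sheaf) ∧
    Nonempty ((HigherMaxwell.MaxwellBF σ n p κ hp).moduliStack ≅
      (HigherMaxwell.MaxwellTilde σ n (n - p - 2) (1 / κ) (by omega)).moduliStack) ∧
    Nonempty ((HigherMaxwell.MaxwellBF σ n p κ hp).moduliStack ≅
      (HigherMaxwell.Maxwell σ n (n - p - 2) (1 / κ)).moduliStack) := by
  have h : p + (n - p - 2) + 2 = n := by omega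
  have hq : n - p - 2 + 2 ≤ n := by omega
  rw [one_div]
  obtain ⟨f, hf⟩ := HigherMaxwell.exists_isPatchwiseHomotopyEquiv_tilde_bf σ h hp hq hκ
  have hg := HigherMaxwell.isPatchwiseHomotopyEquiv_tildeToMaxwell h hq σ (inv_ne_zero hκ)
  obtain ⟨e₁⟩ := hf.sheaf
  obtain ⟨e₂⟩ := hf.moduliStack
  obtain ⟨e₃⟩ := hg.moduliStack
  exact ⟨⟨e₁.symm⟩, ⟨e₂.symm⟩, ⟨e₂.symm ≪≫ e₃⟩⟩
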